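/- Let $\Bbbk$ be a field; all vector spaces are finite-dimensional over $\Bbbk$, $\otimes=\otimes_\Bbbk$, and structure maps $\alpha$ are bijective. **Conventions.** A Hom-algebra $(A,\mu,1_A,\alpha)$ satisfies $\alpha(a)(bc)=(ab)\alpha(c)$, $\alpha(1_A)=1_A$, $1_Aa=a1_A=\alpha(a)$. A Hom-coalgebra $(C,\alpha,\Delta,\varepsilon)$ satisfies $\varepsilon\alpha=\varepsilon$, $\alpha(c_1)\otimes\Delta(c_2)=\Delta(c_1)\otimes\alpha(c_2)$, $\varepsilon(c_1)c_2=c_1\varepsilon(c_2)=\alpha(c)$. A Hom-bialgebra is both, with $\Delta,\varepsilon$ multiplicative and unit preserving. A right $C$-Hom-comodule is $(M,\alpha_M,\rho)$, $\rho(m)=m_0\otimes m_1\in M\otimes C$, with $\alpha_M(m_0)\otimes\Delta(m_1)=\rho(m_0)\otimes\alpha(m_1)$ and $\varepsilon(m_1)m_0=\alpha_M(m)$; with the colinear maps these form the category $Corep(C)$. For $i,j\in\mathbb Z$ let $\mathcal H^{i,j}$ be the monoidal category of pairs $(X,\alpha_X)$, $\alpha_X\in Aut(X)$, with morphisms the linear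 maps commuting with the $\alpha$'s, tensor product $(X\otimes Y,\alpha_X\otimes\alpha_Y)$, unit $(\Bbbk,id)$, associativity constraint $(x\otimes y)\otimes z\mapsto\alpha_X^{i+1}(x)\otimes(y\otimes\alpha_Z^{-j-1}(z))$ and unit constraints $\lambda\otimes x\mapsto\lambda\alpha_X^{j+1}(x)$, $x\otimes\lambda\mapsto\lambda\alpha_X^{i+1}(x)$. If $A$ is an object of $\mathcal H^{i,j}$ with multiplication, unit, comultiplication and counit that are morphisms in $\mathcal H^{i,j}$, the functor $\ddot A=-\otimes A$ on $\mathcal H^{i,j}$ carries the maps $$\delta_X(x\otimes a)=(\alpha_X(x)\otimes a_1)\otimes\alpha_A^{-1}(a_2),\quad \epsilon_X(x\otimes a)=\varepsilon(a)\alpha_X^{-1}(x),$$ $$\ddot A_2(X,Y)\big((x\otimes a)\otimes(y\otimes b)\big)=(x\otimes y)\otimes\alpha_A^i(a)\alpha_A^j(b),\quad \ddot A_0(\lambda)=\lambda\otimes1_A .$$ A functor with such maps is a *bicomonad* if $(\delta,\epsilon)$ is a comonad, $(\ddot A_2,\ddot A_0)$ is a (lax) monoidal functor, and $\delta,\epsilon$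 are monoidal natural transformations. For comonads $F=(F,\Delta,\varepsilon)$, $G=(G,\delta,\epsilon)$, a natural transformation $\psi:FG\to GF$ is a *comonad distributive law* if $G\psi\circ\psi G\circ F\delta=\delta F\circ\psi$, $\psi F\circ F\psi\circ\Delta G=G\Delta\circ\psi$, $G\varepsilon\circ\psi=\varepsilon G$, $\epsilon F\circ\psi=F\epsilon$. If $F,G$ are bicomonads, it is *monoidal* if moreover $\psi_{M\otimes N}\circ F(G_2(M,N))\circ F_2(GM,GN)=G(F_2(M,N))\circ G_2(FM,FN)\circ(\psi_M\otimes\psi_N)$ and $\psi_I\circ F(G_0)\circ F_0=G(F_0)\circ G_0$. A *$\psi$-bicomodule* is an object $M$ with an $F$-comodule structure $\theta$ and a $G$-comodule structure $\rho$ such that $\psi_M\circ F(\rho)\circ\theta=G(\theta)\circ\rho$; morphisms are the maps that are both $F$- and $G$-colinear. **Theorem 4.10.** Let $i,j,n\in\mathbb Z$, let $(B,\alpha_B)$, $(H,\alpha_H)$ be Hom-bialgebras and let $\varphi:B\otimes H\to H\otimes B$, $\varphi(b\otimes h)=\sum h^\varphi\otimes b^\varphi$, be a linear map with $\varphi\circ(\alpha_B\otimes\alpha_H)=(\alpha_H\otimes\alpha_B)\circ\varphi$.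 Let $$\ddot\varphi(n)_X:(X\otimes B)\otimes H\to(X\otimes H)\otimes B,\quad (x\otimes b)\otimes h\mapsto\sum(x\otimes\alpha_H(h)^\varphi)\otimes\alpha_B^n(\alpha_B^{-n-1}(b)^\varphi),$$ a natural transformation $\ddot H\ddot B\to\ddot B\ddot H$ on $\mathcal H^{i,j}$, and equip $B\otimes H$ with $\alpha_B\otimes\alpha_H$, the product $(a\otimes h)(b\otimes g)=ab\otimes hg$, the unit $1_B\otimes1_H$, and $$\Delta(b\otimes h)=\sum(b_1\otimes{h_1}^\varphi)\otimes({b_2}^\varphi\otimes h_2),\qquad\varepsilon(b\otimes h)=\varepsilon_B(b)\varepsilon_H(h).$$ The following are equivalent: 1. $\ddot\varphi(n)$ is a comonad distributive law and the category of $\ddot\varphi(n)$-bicomodules is a monoidal category with the tensor product, unit object and constraints of $\mathcal H^{i,j}$, the coactions on $U\otimes V$ being $u\otimes v\mapsto(u_{(0)}\otimes v_{(0)})\otimes\alpha_H^i(u_{(1)})\alpha_H^j(v_{(1)})$ and $u\otimes v\mapsto(u_{[0]}\otimes v_{[0]})\otimes\alpha_B^i(u_{[1]})\alpha_B^j(v_{[1]})$,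 and those on the unit $\Bbbk$ being $\lambda\mapsto\lambda\otimes1_H$ and $\lambda\mapsto\lambda\otimes1_B$. 2. $\varphi$ is a monoidal Hom-cotwistor, that is, for all $a,b\in B$, $h,g\in H$ (superscripts $\varphi,\phi$ denoting two applications of the map $\varphi$): (M1) $\sum{\alpha_H(h)^\varphi}^\phi\otimes{b_1}^\phi\otimes{b_2}^\varphi=\sum\alpha_H(h^\varphi)\otimes{b^\varphi}_1\otimes{b^\varphi}_2$; (M2) $\sum{h_1}^\varphi\otimes{h_2}^\phi\otimes{\alpha_B(b)^\varphi}^\phi=\sum{h^\varphi}_1\otimes{h^\varphi}_2\otimes\alpha_B(b^\varphi)$; (M3) $\sum\varepsilon_H(h^\varphi)b^\varphi=\varepsilon_H(h)b$; (M4) $\sum\varepsilon_B(b^\varphi)h^\varphi=\varepsilon_B(b)h$; (M5) $\sum h^\varphi g^\phi\otimes a^\varphi b^\phi=\sum(hg)^\varphi\otimes(ab)^\varphi$; (M6) $\sum{1_H}^\varphi\otimes{1_B}^\varphi=1_H\otimes1_B$. 3. $\ddot\varphi(n):\ddot H\ddot B\to\ddot B\ddot H$ is a monoidal comonad distributive law.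 4. $\ddot H\ddot B=(-\otimes B)\otimes H$ is a bicomonad on $\mathcal H^{i,j}$, with comultiplication $\ddot H\ddot\varphi(n)\ddot B\circ\Delta\delta$ and counit $\varepsilon\epsilon$ (where $(\Delta,\varepsilon)$ and $(\delta,\epsilon)$ are the comonad structures of $\ddot H$ and $\ddot B$) and the monoidal structure of a composite of monoidal functors. 5. $B\otimes H$ is a Hom-bialgebra. 6. $-\otimes(B\otimes H)$ is a bicomonad on $\mathcal H^{i,j}$. 7. $B\otimes H$ is a Hom-coalgebra and $Corep(B\otimes H)$ is a monoidal category, denoted $Corep^{i,j}(B\otimes H)$, with the tensor product, unit object and constraints of $\mathcal H^{i,j}$, the coaction on $U\otimes V$ being $u\otimes v\mapsto(u_0\otimes v_0)\otimes\alpha_{B\otimes H}^i(u_1)\alpha_{B\otimes H}^j(v_1)$ and that on $\Bbbk$ being $\lambda\mapsto\lambda\otimes(1_B\otimes1_H)$. Moreover, if these conditions hold, then for every $m\in\mathbb Z$ the monoidal category of $\ddot\varphi(m)$-bicomodules is isomorphic to $Corep^{i,j}(B\otimes H)$, by a strict monoidal isomorphism of categories that leaves the underlying objects and maps of $\mathcal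 H^{i,j}$ unchanged. -/

import Mathlib

open CategoryTheory MonoidalCategory
open scoped TensorProduct

/-! ## Comonads, monoidal comonads, distributive laws and bicomodules on a category -/

namespace HomCotwist

universe v u

section Comonads

variable (C : Type u) [Category.{v} C]

/-- The data of a comonad (an endofunctor, a comultiplication and a counit), without the axioms. -/
structure ComonadData where
  /-- the endofunctor -/
  F : C ⥤ C
  /-- the comultiplication -/
  δ : F ⟶ F ⋙ F
  /-- the counit -/
  ε : F ⟶ 𝟭 C

/-- The data of a monoidal comonad: comonad data on `F`, together with the structure maps
`F X ⊗ F Y ⟶ F (X ⊗ Y)` and `𝟙_ ⟶ F 𝟙_` of a monoidal functor, without the axioms. -/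
structure MonoidalComonadData [MonoidalCategory C] extends ComonadData C where
  /-- the map `F X ⊗ F Y ⟶ F (X ⊗ Y)` -/
  μ : ∀ X Y : C, F.obj X ⊗ F.obj Y ⟶ F.obj (X ⊗ Y)
  /-- the map `𝟙_ ⟶ F 𝟙_` -/
  η : 𝟙_ C ⟶ F.obj (𝟙_ C)

variable {C}

/-- The data underlying a comonad. -/
def ComonadData.ofComonad (W : Comonad C) : ComonadData C := ⟨W.toFunctor, W.δ, W.ε⟩

/-- The data form a comonad. -/
def ComonadData.IsComonad (D : ComonadData C) : Prop :=
  ∃ W : Comonad C, ComonadData.ofComonad W = D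

/-- `(X, ρ)` is a comodule: `ρ` is coassociative and counital. -/
structure ComonadData.IsComodule (D : ComonadData C) {X : C} (ρ : X ⟶ D.F.obj X) : Prop where
  coassoc : ρ ≫ D.F.map ρ = ρ ≫ D.δ.app X
  counit : ρ ≫ D.ε.app X = 𝟙 X

/-- `f` is a colinear map `(X, ρ) ⟶ (Y, σ)`. -/
def ComonadData.IsColinear (D : ComonadData C) {X Y : C} (ρ : X ⟶ D.F.obj X) (σ : Y ⟶ D.F.obj Y)
    (f : X ⟶ Y) : Prop :=
  ρ ≫ D.F.map f = f ≫ σ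

/-- `φ : F G ⟶ G F` (with `F = D.F`, `G = E.F`) is a comonad distributive law. -/
structure IsDistributiveLaw (D E : ComonadData C) (φ : E.F ⋙ D.F ⟶ D.F ⋙ E.F) : Prop where
  L1 : ∀ X, D.F.map (E.δ.app X) ≫ φ.app (E.F.obj X) ≫ E.F.map (φ.app X) =
    φ.app X ≫ E.δ.app (D.F.obj X)
  L2 : ∀ X, D.δ.app (E.F.obj X) ≫ D.F.map (φ.app X) ≫ φ.app (D.F.obj X) =
    φ.app X ≫ E.F.map (D.δ.app X)
  L3 : ∀ X, φ.app X ≫ E.F.map (D.ε.app X) = D.ε.app (E.F.obj X)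
  L4 : ∀ X, φ.app X ≫ E.ε.app (D.F.obj X) = D.F.map (E.ε.app X)

/-- `(X, θ, ρ)` is a `φ`-bicomodule: `θ` is an `F`-comodule structure, `ρ` is a `G`-comodule
structure, and `φ_X ∘ F(ρ) ∘ θ = G(θ) ∘ ρ`. -/
structure IsBicomodule (D E : ComonadData C) (φ : E.F ⋙ D.F ⟶ D.F ⋙ E.F)
    {X : C} (θ : X ⟶ D.F.obj X) (ρ : X ⟶ E.F.obj X) : Prop where
  left : D.IsComodule θ
  right : E.IsComodule ρ
  compat : θ ≫ D.F.map ρ ≫ φ.app X = ρ ≫ E.F.map θ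

/-- The `φ`-bicomodules. -/
structure Bicomodule (D E : ComonadData C) (φ : E.F ⋙ D.F ⟶ D.F ⋙ E.F) where
  /-- the underlying object -/
  X : C
  /-- the `F`-coaction -/
  θ : X ⟶ D.F.obj X
  /-- the `G`-coaction -/
  ρ : X ⟶ E.F.obj X
  isBicomodule : IsBicomodule D E φ θ ρ

/-- Bicomodule morphisms: morphisms that are both `F`-colinear and `G`-colinear. -/
@[ext]
structure Bicomodule.Hom {D E : ComonadData C} {φ : E.F ⋙ D.F ⟶ D.F ⋙ E.F}
    (M N : Bicomodule D E φ) where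
  /-- the underlying morphism -/
  f : M.X ⟶ N.X
  left : D.IsColinear M.θ N.θ f
  right : E.IsColinear M.ρ N.ρ f

theorem ComonadData.isColinear_id (D : ComonadData C) {X : C} (ρ : X ⟶ D.F.obj X) :
    D.IsColinear ρ ρ (𝟙 X) := by
  simp [ComonadData.IsColinear]

theorem ComonadData.IsColinear.comp {D : ComonadData C} {X Y Z : C} {ρ : X ⟶ D.F.obj X}
    {σ : Y ⟶ D.F.obj Y} {τ : Z ⟶ D.F.obj Z} {f : X ⟶ Y} {g : Y ⟶ Z}
    (hf : D.IsColinear ρ σ f) (hg : D.IsColinear σ τ g) : D.IsColinear ρ τ (f ≫ g) := by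
  unfold ComonadData.IsColinear at *
  rw [Functor.map_comp, ← Category.assoc, hf, Category.assoc, hg, Category.assoc]

instance (D E : ComonadData C) (φ : E.F ⋙ D.F ⟶ D.F ⋙ E.F) : Category (Bicomodule D E φ) where
  Hom M N := Bicomodule.Hom M N
  id M := ⟨𝟙 M.X, D.isColinear_id _, E.isColinear_id _⟩
  comp f g := ⟨f.f ≫ g.f, f.left.comp g.left, f.right.comp g.right⟩
  id_comp _ := Bicomodule.Hom.ext (Category.id_comp _)
  comp_id _ := Bicomodule.Hom.ext (Category.comp_id _)
  assoc _ _ _ := Bicomodule.Hom.ext (Category.assoc _ _ _)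

/-- The functor sending a bicomodule to its underlying object. -/
def Bicomodule.forget (D E : ComonadData C) (φ : E.F ⋙ D.F ⟶ D.F ⋙ E.F) :
    Bicomodule D E φ ⥤ C where
  obj M := M.X
  map f := f.f
  map_id _ := rfl
  map_comp _ _ := rfl

theorem ComonadData.IsColinear.inv {D : ComonadData C} {X Y : C} {ρ : X ⟶ D.F.obj X}
    {σ : Y ⟶ D.F.obj Y} {e : X ≅ Y} (h : D.IsColinear ρ σ e.hom) : D.IsColinear σ ρ e.inv := by
  unfold ComonadData.IsColinear at *
  rw [Iso.eq_inv_comp, ← Category.assoc, ← h, Category.assoc, ← D.F.map_comp, e.hom_inv_id,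
    D.F.map_id, Category.comp_id]

/-- An isomorphism of `C` that is a bicomodule morphism is an isomorphism of bicomodules. -/
def Bicomodule.mkIso {D E : ComonadData C} {φ : E.F ⋙ D.F ⟶ D.F ⋙ E.F}
    {M N : Bicomodule D E φ} (e : M.X ≅ N.X)
    (h : D.IsColinear M.θ N.θ e.hom ∧ E.IsColinear M.ρ N.ρ e.hom) : M ≅ N where
  hom := ⟨e.hom, h.1, h.2⟩
  inv := ⟨e.inv, h.1.inv, h.2.inv⟩
  hom_inv_id := Bicomodule.Hom.ext e.hom_inv_id
  inv_hom_id := Bicomodule.Hom.ext e.inv_hom_id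

variable [MonoidalCategory C]

/-- The structure maps `μ`, `η` make `F` a (lax) monoidal functor. -/
def MonoidalComonadData.IsMonoidalFunctor (D : MonoidalComonadData C) : Prop :=
  ∃ L : D.F.LaxMonoidal, L.ε = D.η ∧ ∀ X Y, L.μ X Y = D.μ X Y

/-- The data form a bicomonad (monoidal comonad). -/
structure MonoidalComonadData.IsBicomonad (D : MonoidalComonadData C) : Prop where
  isComonad : D.toComonadData.IsComonad
  isMonoidalFunctor : D.IsMonoidalFunctor
  C1 : ∀ X Y, (D.δ.app X ⊗ₘ D.δ.app Y) ≫ D.μ (D.F.obj X) (D.F.obj Y) ≫ D.F.map (D.μ X Y) =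
    D.μ X Y ≫ D.δ.app (X ⊗ Y)
  C2 : ∀ X Y, D.μ X Y ≫ D.ε.app (X ⊗ Y) = (D.ε.app X ⊗ₘ D.ε.app Y)
  C3 : D.η ≫ D.F.map D.η = D.η ≫ D.δ.app (𝟙_ C)
  C4 : D.η ≫ D.ε.app (𝟙_ C) = 𝟙 (𝟙_ C)

/-- `φ` is a monoidal comonad distributive law. -/
structure IsMonoidalDistributiveLaw (D E : MonoidalComonadData C)
    (φ : E.F ⋙ D.F ⟶ D.F ⋙ E.F) : Prop where
  isDistributiveLaw : IsDistributiveLaw D.toComonadData E.toComonadData φ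
  tensor : ∀ M N, D.μ (E.F.obj M) (E.F.obj N) ≫ D.F.map (E.μ M N) ≫ φ.app (M ⊗ N) =
    (φ.app M ⊗ₘ φ.app N) ≫ E.μ (D.F.obj M) (D.F.obj N) ≫ E.F.map (D.μ M N)
  unit : D.η ≫ D.F.map E.η ≫ φ.app (𝟙_ C) = E.η ≫ E.F.map D.η

/-- The smash coproduct `F G`, with comultiplication `F φ G ∘ Δ δ`, counit `ε ϵ`, and the
monoidal structure maps of a composite of monoidal functors. -/
def smashCoproduct (D E : MonoidalComonadData C) (φ : E.F ⋙ D.F ⟶ D.F ⋙ E.F) :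
    MonoidalComonadData C where
  F := E.F ⋙ D.F
  δ :=
    { app := fun X => D.δ.app (E.F.obj X) ≫ D.F.map (D.F.map (E.δ.app X)) ≫
        D.F.map (φ.app (E.F.obj X))
      naturality := fun X Y f => by
        have h1 := D.δ.naturality (E.F.map f)
        have h2 := E.δ.naturality f
        have h3 := φ.naturality (E.F.map f)
        simp only [Functor.comp_obj, Functor.comp_map] at h1 h2 h3 ⊢
        rw [reassoc_of% h1]
        have h4 := congrArg D.F.map h2
        simp only [Functor.map_comp] at h4
        simp only [← Functor.map_comp, Category.assoc]
        rw [reassoc_of% h4, h3] }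
  ε :=
    { app := fun X => D.F.map (E.ε.app X) ≫ D.ε.app X
      naturality := fun X Y f => by
        have h1 := D.ε.naturality f
        have h2 := E.ε.naturality f
        simp only [Functor.comp_map, Functor.id_map, Functor.comp_obj, Functor.id_obj] at h1 h2 ⊢
        rw [← Category.assoc, ← Functor.map_comp, h2, Functor.map_comp, Category.assoc, h1,
          Category.assoc] }
  μ X Y := D.μ (E.F.obj X) (E.F.obj Y) ≫ D.F.map (E.μ X Y)
  η := D.η ≫ D.F.map E.η

/-- The coaction `X ⊗ Y ⟶ F X ⊗ F Y ⟶ F (X ⊗ Y)` on a tensor product. -/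
def MonoidalComonadData.tensorCoaction (D : MonoidalComonadData C) {X Y : C}
    (ρ : X ⟶ D.F.obj X) (σ : Y ⟶ D.F.obj Y) : X ⊗ Y ⟶ D.F.obj (X ⊗ Y) :=
  (ρ ⊗ₘ σ) ≫ D.μ X Y

/-- The tensor coactions and the constraints of `C` live in the category of bicomodules: tensor
products and the unit are bicomodules, and tensor products of morphisms and the constraints are
colinear for both coactions. -/
structure BicomoduleTensor (D E : MonoidalComonadData C)
    (φ : E.F ⋙ D.F ⟶ D.F ⋙ E.F) : Prop where
  tensorObj : ∀ U V : Bicomodule D.toComonadData E.toComonadData φ,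
    IsBicomodule D.toComonadData E.toComonadData φ
      (D.tensorCoaction U.θ V.θ) (E.tensorCoaction U.ρ V.ρ)
  tensorUnit : IsBicomodule D.toComonadData E.toComonadData φ D.η E.η
  whiskerLeft : ∀ (U : Bicomodule D.toComonadData E.toComonadData φ)
    {V W : Bicomodule D.toComonadData E.toComonadData φ} (f : V ⟶ W),
    D.IsColinear (D.tensorCoaction U.θ V.θ) (D.tensorCoaction U.θ W.θ) (U.X ◁ f.f) ∧
    E.IsColinear (E.tensorCoaction U.ρ V.ρ) (E.tensorCoaction U.ρ W.ρ) (U.X ◁ f.f)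
  whiskerRight : ∀ {V W : Bicomodule D.toComonadData E.toComonadData φ} (f : V ⟶ W)
    (U : Bicomodule D.toComonadData E.toComonadData φ),
    D.IsColinear (D.tensorCoaction V.θ U.θ) (D.tensorCoaction W.θ U.θ) (f.f ▷ U.X) ∧
    E.IsColinear (E.tensorCoaction V.ρ U.ρ) (E.tensorCoaction W.ρ U.ρ) (f.f ▷ U.X)
  associator : ∀ U V W : Bicomodule D.toComonadData E.toComonadData φ,
    D.IsColinear (D.tensorCoaction (D.tensorCoaction U.θ V.θ) W.θ)
      (D.tensorCoaction U.θ (D.tensorCoaction V.θ W.θ)) (α_ U.X V.X W.X).hom ∧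
    E.IsColinear (E.tensorCoaction (E.tensorCoaction U.ρ V.ρ) W.ρ)
      (E.tensorCoaction U.ρ (E.tensorCoaction V.ρ W.ρ)) (α_ U.X V.X W.X).hom
  leftUnitor : ∀ U : Bicomodule D.toComonadData E.toComonadData φ,
    D.IsColinear (D.tensorCoaction D.η U.θ) U.θ (λ_ U.X).hom ∧
    E.IsColinear (E.tensorCoaction E.η U.ρ) U.ρ (λ_ U.X).hom
  rightUnitor : ∀ U : Bicomodule D.toComonadData E.toComonadData φ,
    D.IsColinear (D.tensorCoaction U.θ D.η) U.θ (ρ_ U.X).hom ∧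
    E.IsColinear (E.tensorCoaction U.ρ E.η) U.ρ (ρ_ U.X).hom

/-- The tensor product, unit and constraints on the category of bicomodules: those of `C`, with the
tensor coactions and the unit coactions `η`. -/
abbrev BicomoduleTensor.struct {D E : MonoidalComonadData C} {φ : E.F ⋙ D.F ⟶ D.F ⋙ E.F}
    (h : BicomoduleTensor D E φ) :
    MonoidalCategoryStruct (Bicomodule D.toComonadData E.toComonadData φ) where
  tensorObj U V := ⟨U.X ⊗ V.X, _, _, h.tensorObj U V⟩
  whiskerLeft U _ _ f := ⟨U.X ◁ f.f, (h.whiskerLeft U f).1, (h.whiskerLeft U f).2⟩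
  whiskerRight f U := ⟨f.f ▷ U.X, (h.whiskerRight f U).1, (h.whiskerRight f U).2⟩
  tensorUnit := ⟨𝟙_ C, _, _, h.tensorUnit⟩
  associator U V W := Bicomodule.mkIso (α_ U.X V.X W.X) (h.associator U V W)
  leftUnitor U := Bicomodule.mkIso (λ_ U.X) (h.leftUnitor U)
  rightUnitor U := Bicomodule.mkIso (ρ_ U.X) (h.rightUnitor U)

/-- The monoidal category structure `M` on the category of bicomodules is the one given by the
tensor coactions and the constraints of `C`. -/
def IsBicomoduleMonoidal {D E : MonoidalComonadData C} {φ : E.F ⋙ D.F ⟶ D.F ⋙ E.F}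
    (M : MonoidalCategory (Bicomodule D.toComonadData E.toComonadData φ)) : Prop :=
  ∃ h : BicomoduleTensor D E φ, M.toMonoidalCategoryStruct = h.struct

end Comonads

/-- A strict monoidal functor: a monoidal functor whose structure isomorphisms are identities. -/
def IsStrictMonoidal {C : Type*} [Category C] [MonoidalCategory C] {D : Type*} [Category D]
    [MonoidalCategory D] (P : C ⥤ D) : Prop :=
  ∃ L : P.Monoidal, (∃ h : 𝟙_ D = P.obj (𝟙_ C), L.ε = eqToHom h) ∧
    ∀ X Y, ∃ h : P.obj X ⊗ P.obj Y = P.obj (X ⊗ Y), L.μ X Y = eqToHom h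

/-! ## The monoidal category of finite-dimensional spaces with an automorphism -/

section HomSpaces

variable (k : Type u) [Field k]

/-- The objects: finite-dimensional `k`-spaces with an automorphism. The integers `i`, `j` only
enter the associativity and unit constraints. -/
structure HomSpace (i j : ℤ) where
  /-- the underlying space -/
  carrier : Type u
  [addCommGroup : AddCommGroup carrier]
  [module : Module k carrier]
  [finite : Module.Finite k carrier]
  /-- the automorphism -/
  α : carrier ≃ₗ[k] carrier

attribute [instance] HomSpace.addCommGroup HomSpace.module HomSpace.finite

variable {k} {i j : ℤ}

/-- The morphisms: linear maps that commute with the automorphisms. -/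
@[ext]
structure HomSpace.Hom (X Y : HomSpace k i j) where
  /-- the underlying linear map -/
  f : X.carrier →ₗ[k] Y.carrier
  comm : f ∘ₗ X.α.toLinearMap = Y.α.toLinearMap ∘ₗ f

instance : Category (HomSpace k i j) where
  Hom X Y := HomSpace.Hom X Y
  id X := ⟨LinearMap.id, rfl⟩
  comp f g := ⟨g.f ∘ₗ f.f, by
    rw [LinearMap.comp_assoc, f.comm, ← LinearMap.comp_assoc, g.comm, LinearMap.comp_assoc]⟩

/-- Building a morphism, with the type of morphisms of the category. -/
abbrev HomSpace.mkHom {X Y : HomSpace k i j} (f : X.carrier →ₗ[k] Y.carrier)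
    (h : f ∘ₗ X.α.toLinearMap = Y.α.toLinearMap ∘ₗ f) : X ⟶ Y := HomSpace.Hom.mk f h

@[ext]
theorem HomSpace.hom_ext {X Y : HomSpace k i j} {f g : X ⟶ Y} (h : f.f = g.f) : f = g :=
  HomSpace.Hom.ext h

@[simp] theorem HomSpace.id_f (X : HomSpace k i j) : HomSpace.Hom.f (𝟙 X) = LinearMap.id := rfl

@[simp] theorem HomSpace.comp_f {X Y Z : HomSpace k i j} (f : X ⟶ Y) (g : Y ⟶ Z) :
    HomSpace.Hom.f (f ≫ g) = g.f ∘ₗ f.f := rfl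

theorem HomSpace.comm_apply {X Y : HomSpace k i j} (f : X ⟶ Y) (x : X.carrier) :
    f.f (X.α x) = Y.α (f.f x) := LinearMap.congr_fun f.comm x

theorem zpow_comm {M : Type*} [AddCommGroup M] [Module k M] (a : M ≃ₗ[k] M) (n : ℤ) (x : M) :
    (a ^ n) (a x) = a ((a ^ n) x) := by
  have h : a ^ n * a = a * a ^ n := (Commute.refl a).zpow_left n
  exact LinearEquiv.congr_fun h x

theorem zpow_conj {M N : Type*} [AddCommGroup M] [Module k M] [AddCommGroup N] [Module k N]
    (f : M →ₗ[k] N) (a : M ≃ₗ[k] M) (b : N ≃ₗ[k] N) (h : ∀ x, f (a x) = b (f x)) (n : ℤ) (x : M) :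
    f ((a ^ n) x) = (b ^ n) (f x) := by
  have hinv : ∀ x, f (a⁻¹ x) = b⁻¹ (f x) := fun x => by
    have h1 : a (a⁻¹ x) = x := a.apply_symm_apply x
    have h2 : b⁻¹ (b (f (a⁻¹ x))) = f (a⁻¹ x) := b.symm_apply_apply _
    rw [← h2, ← h, h1]
  induction n generalizing x with
  | zero => simp
  | succ n ih => rw [zpow_add_one, zpow_add_one, LinearEquiv.mul_apply, ih, h,
      LinearEquiv.mul_apply]
  | pred n ih => rw [zpow_sub_one, zpow_sub_one, LinearEquiv.mul_apply, ih, hinv,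
      LinearEquiv.mul_apply]

theorem zpow_apply_zpow {M : Type*} [AddCommGroup M] [Module k M] (a : M ≃ₗ[k] M) (m n : ℤ)
    (x : M) : (a ^ m) ((a ^ n) x) = (a ^ (m + n)) x := by
  rw [zpow_add, LinearEquiv.mul_apply]

theorem HomSpace.zpow_apply {X Y : HomSpace k i j} (f : X ⟶ Y) (n : ℤ) (x : X.carrier) :
    f.f ((X.α ^ n) x) = (Y.α ^ n) (f.f x) :=
  zpow_conj f.f X.α Y.α (HomSpace.comm_apply f) n x

/-- An isomorphism from a linear equivalence commuting with the automorphisms. -/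
abbrev HomSpace.mkIso {X Y : HomSpace k i j} (e : X.carrier ≃ₗ[k] Y.carrier)
    (h : e.toLinearMap ∘ₗ X.α.toLinearMap = Y.α.toLinearMap ∘ₗ e.toLinearMap) : X ≅ Y where
  hom := HomSpace.mkHom e.toLinearMap h
  inv := HomSpace.mkHom e.symm.toLinearMap (LinearMap.ext fun y => by
    have h1 : e (X.α (e.symm y)) = Y.α (e (e.symm y)) := LinearMap.congr_fun h (e.symm y)
    simp only [LinearMap.comp_apply, LinearEquiv.coe_coe]
    rw [LinearEquiv.symm_apply_eq, h1, LinearEquiv.apply_symm_apply])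
  hom_inv_id := by ext x; simp
  inv_hom_id := by ext x; simp

/-- `(X, α_X) ⊗ (Y, α_Y) = (X ⊗ Y, α_X ⊗ α_Y)`. -/
abbrev HomSpace.tensor (X Y : HomSpace k i j) : HomSpace k i j where
  carrier := X.carrier ⊗[k] Y.carrier
  α := TensorProduct.congr X.α Y.α

/-- The constraints are `(x ⊗ y) ⊗ z ↦ α^(i+1) x ⊗ (y ⊗ α^(-j-1) z)`, `c ⊗ x ↦ c • α^(j+1) x` and
`x ⊗ c ↦ c • α^(i+1) x`. -/
instance : MonoidalCategoryStruct (HomSpace k i j) where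
  tensorObj X Y := X.tensor Y
  whiskerLeft X _ _ f := HomSpace.mkHom (f.f.lTensor X.carrier)
    (TensorProduct.ext' fun x y => by simp [HomSpace.comm_apply])
  whiskerRight f Y := HomSpace.mkHom (f.f.rTensor Y.carrier)
    (TensorProduct.ext' fun x y => by simp [HomSpace.comm_apply])
  tensorHom f g := HomSpace.mkHom (TensorProduct.map f.f g.f)
    (TensorProduct.ext' fun x y => by simp [HomSpace.comm_apply])
  tensorUnit := ⟨k, LinearEquiv.refl k k⟩
  associator X Y Z := HomSpace.mkIso (TensorProduct.assoc k X.carrier Y.carrier Z.carrier ≪≫ₗ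
    TensorProduct.congr (X.α ^ (i + 1))
      (TensorProduct.congr (LinearEquiv.refl k Y.carrier) (Z.α ^ (-j - 1))))
    (TensorProduct.ext_threefold fun x y z => by simp [zpow_comm])
  leftUnitor X := HomSpace.mkIso (TensorProduct.lid k X.carrier ≪≫ₗ (X.α ^ (j + 1)))
    (TensorProduct.ext' fun c x => by simp [zpow_comm])
  rightUnitor X := HomSpace.mkIso (TensorProduct.rid k X.carrier ≪≫ₗ (X.α ^ (i + 1)))
    (TensorProduct.ext' fun x c => by simp [zpow_comm])

section Lemmas

variable (X Y Z : HomSpace k i j)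

theorem HomSpace.whiskerLeft_f {Y Z : HomSpace k i j} (f : Y ⟶ Z) :
    HomSpace.Hom.f (X ◁ f) = f.f.lTensor X.carrier := rfl

theorem HomSpace.whiskerRight_f {Y Z : HomSpace k i j} (f : Y ⟶ Z) :
    HomSpace.Hom.f (f ▷ X) = f.f.rTensor X.carrier := rfl

theorem HomSpace.tensorHom_f {X Y X' Y' : HomSpace k i j} (f : X ⟶ Y) (g : X' ⟶ Y') :
    HomSpace.Hom.f (f ⊗ₘ g) = TensorProduct.map f.f g.f := rfl

theorem HomSpace.associator_f (x : X.carrier) (y : Y.carrier) (z : Z.carrier) :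
    HomSpace.Hom.f (α_ X Y Z).hom ((x ⊗ₜ[k] y) ⊗ₜ[k] z) =
      (X.α ^ (i + 1)) x ⊗ₜ[k] (y ⊗ₜ[k] (Z.α ^ (-j - 1)) z) := rfl

theorem HomSpace.leftUnitor_f (c : k) (x : X.carrier) :
    HomSpace.Hom.f (λ_ X).hom (c ⊗ₜ[k] x) = c • (X.α ^ (j + 1)) x :=
  ((X.α ^ (j + 1)).map_smul c x)

theorem HomSpace.rightUnitor_f (c : k) (x : X.carrier) :
    HomSpace.Hom.f (ρ_ X).hom (x ⊗ₜ[k] c) = c • (X.α ^ (i + 1)) x :=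
  ((X.α ^ (i + 1)).map_smul c x)

end Lemmas

instance : MonoidalCategory (HomSpace k i j) where
  tensorHom_def f g := HomSpace.hom_ext (TensorProduct.ext' fun x y => rfl)
  id_tensorHom_id X Y := HomSpace.hom_ext (TensorProduct.ext' fun x y => rfl)
  tensorHom_comp_tensorHom f g f' g' := HomSpace.hom_ext (TensorProduct.ext' fun x y => rfl)
  whiskerLeft_id X Y := HomSpace.hom_ext (TensorProduct.ext' fun x y => rfl)
  id_whiskerRight X Y := HomSpace.hom_ext (TensorProduct.ext' fun x y => rfl)
  associator_naturality {X Y Z X' Y' Z'} f g h :=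
    HomSpace.hom_ext (TensorProduct.ext_threefold fun x y z => by
      change (X'.α ^ (i + 1)) (f.f x) ⊗ₜ[k] (g.f y ⊗ₜ[k] (Z'.α ^ (-j - 1)) (h.f z)) =
        f.f ((X.α ^ (i + 1)) x) ⊗ₜ[k] (g.f y ⊗ₜ[k] h.f ((Z.α ^ (-j - 1)) z))
      rw [HomSpace.zpow_apply, HomSpace.zpow_apply])
  leftUnitor_naturality {X Y} f := HomSpace.hom_ext (TensorProduct.ext' fun c x => by
    change (Y.α ^ (j + 1)) (c • f.f x) = f.f ((X.α ^ (j + 1)) (c • x))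
    rw [HomSpace.zpow_apply, map_smul f.f])
  rightUnitor_naturality {X Y} f := HomSpace.hom_ext (TensorProduct.ext' fun x c => by
    change (Y.α ^ (i + 1)) (c • f.f x) = f.f ((X.α ^ (i + 1)) (c • x))
    rw [HomSpace.zpow_apply, map_smul f.f])
  pentagon W X Y Z := HomSpace.hom_ext (TensorProduct.ext_fourfold fun w x y z => by
    change (W.α ^ (i + 1)) ((W.α ^ (i + 1)) w) ⊗ₜ[k] ((X.α ^ (i + 1)) x ⊗ₜ[k]
        ((Y.α ^ (-j - 1)) y ⊗ₜ[k] (Z.α ^ (-j - 1)) ((Z.α ^ (-j - 1)) z))) =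
      HomSpace.Hom.f (α_ W X (Y ⊗ Z)).hom
        (((TensorProduct.congr W.α X.α) ^ (i + 1)) (w ⊗ₜ[k] x) ⊗ₜ[k]
          (y ⊗ₜ[k] (Z.α ^ (-j - 1)) z))
    rw [TensorProduct.congr_zpow, TensorProduct.congr_tmul]
    change _ = (W.α ^ (i + 1)) ((W.α ^ (i + 1)) w) ⊗ₜ[k] ((X.α ^ (i + 1)) x ⊗ₜ[k]
        (((TensorProduct.congr Y.α Z.α) ^ (-j - 1)) (y ⊗ₜ[k] (Z.α ^ (-j - 1)) z)))
    rw [TensorProduct.congr_zpow, TensorProduct.congr_tmul])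
  triangle X Y := HomSpace.hom_ext (TensorProduct.ext_threefold fun x c y => by
    change (X.α ^ (i + 1)) x ⊗ₜ[k] ((Y.α ^ (j + 1)) (c • (Y.α ^ (-j - 1)) y)) =
      (X.α ^ (i + 1)) (c • x) ⊗ₜ[k] y
    rw [map_smul, zpow_apply_zpow, map_smul, TensorProduct.tmul_smul, TensorProduct.smul_tmul']
    simp)

end HomSpaces

/-! ## Hom-algebras, Hom-coalgebras and Hom-bialgebras -/

section HomBialgebras

variable (k : Type u) [Field k]

/-- A finite-dimensional space `A` with an automorphism `α` and structure maps `mul`, `one`,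
`comul`, `counit` that are morphisms of spaces with automorphism, without the Hom-bialgebra axioms.
(For a Hom-bialgebra with bijective `α`, the four compatibilities with `α` are consequences
of the axioms.) -/
structure HomBialgebraData where
  /-- the underlying space -/
  carrier : Type u
  [addCommGroup : AddCommGroup carrier]
  [module : Module k carrier]
  [finite : Module.Finite k carrier]
  /-- the structure automorphism -/
  α : carrier ≃ₗ[k] carrier
  /-- the multiplication -/
  mul : carrier →ₗ[k] carrier →ₗ[k] carrier
  /-- the unit element -/
  one : carrier
  /-- the comultiplication -/
  comul : carrier →ₗ[k] carrier ⊗[k] carrier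
  /-- the counit -/
  counit : carrier →ₗ[k] k
  map_mul : ∀ a b, α (mul a b) = mul (α a) (α b)
  map_one : α one = one
  comul_map : ∀ a, comul (α a) = TensorProduct.congr α α (comul a)
  counit_map : ∀ a, counit (α a) = counit a

attribute [instance] HomBialgebraData.addCommGroup HomBialgebraData.module HomBialgebraData.finite

variable {k}

namespace HomBialgebraData

/-- `(A, mul, one, α)` is a Hom-algebra. -/
structure IsHomAlgebra (A : HomBialgebraData k) : Prop where
  map_one : A.α A.one = A.one
  hom_assoc : ∀ a b c, A.mul (A.α a) (A.mul b c) = A.mul (A.mul a b) (A.α c)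
  one_mul : ∀ a, A.mul A.one a = A.α a
  mul_one : ∀ a, A.mul a A.one = A.α a

/-- `(A, α, comul, counit)` is a Hom-coalgebra:
`ε ∘ α = ε`, `α(c₁) ⊗ Δ(c₂) = Δ(c₁) ⊗ α(c₂)` and `ε(c₁) c₂ = c₁ ε(c₂) = α(c)`. -/
structure IsHomCoalgebra (A : HomBialgebraData k) : Prop where
  counit_map : ∀ a, A.counit (A.α a) = A.counit a
  hom_coassoc : ∀ a, TensorProduct.map A.α.toLinearMap A.comul (A.comul a) =
    TensorProduct.assoc k A.carrier A.carrier A.carrier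
      (TensorProduct.map A.comul A.α.toLinearMap (A.comul a))
  counit_comul : ∀ a, TensorProduct.lid k A.carrier (A.counit.rTensor A.carrier (A.comul a)) = A.α a
  comul_counit : ∀ a, TensorProduct.rid k A.carrier (A.counit.lTensor A.carrier (A.comul a)) = A.α a

/-- A Hom-bialgebra: a Hom-algebra and a Hom-coalgebra such that `Δ` and `ε` are
multiplicative (componentwise product on `A ⊗ A`) and preserve the units. -/
structure IsHomBialgebra (A : HomBialgebraData k) : Prop where
  isHomAlgebra : A.IsHomAlgebra
  isHomCoalgebra : A.IsHomCoalgebra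
  comul_mul : ∀ a b, A.comul (A.mul a b) =
    TensorProduct.map₂ A.mul A.mul (A.comul a) (A.comul b)
  comul_one : A.comul A.one = A.one ⊗ₜ[k] A.one
  counit_mul : ∀ a b, A.counit (A.mul a b) = A.counit a * A.counit b
  counit_one : A.counit A.one = 1

/-- The product `a ⊗ b ↦ α^i(a) α^j(b)`, as a linear map on `A ⊗ A`. -/
def twistedMul (i j : ℤ) (A : HomBialgebraData k) : A.carrier ⊗[k] A.carrier →ₗ[k] A.carrier :=
  TensorProduct.lift (A.mul.compl₁₂ (A.α ^ i).toLinearMap (A.α ^ j).toLinearMap)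

@[simp]
theorem twistedMul_tmul (i j : ℤ) (A : HomBialgebraData k) (a b : A.carrier) :
    A.twistedMul i j (a ⊗ₜ[k] b) = A.mul ((A.α ^ i) a) ((A.α ^ j) b) := rfl

/-- `(x ⊗ a) ⊗ (y ⊗ b) ↦ (x ⊗ y) ⊗ α^i(a) α^j(b)`. -/
def tensorator (i j : ℤ) (A : HomBialgebraData k) (X Y : Type u) [AddCommGroup X] [Module k X]
    [AddCommGroup Y] [Module k Y] :
    (X ⊗[k] A.carrier) ⊗[k] (Y ⊗[k] A.carrier) →ₗ[k] (X ⊗[k] Y) ⊗[k] A.carrier :=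
  (A.twistedMul i j).lTensor (X ⊗[k] Y) ∘ₗ
    (TensorProduct.tensorTensorTensorComm k X A.carrier Y A.carrier).toLinearMap

@[simp]
theorem tensorator_tmul (i j : ℤ) (A : HomBialgebraData k) {X Y : Type u} [AddCommGroup X]
    [Module k X] [AddCommGroup Y] [Module k Y] (x : X) (y : Y) (a b : A.carrier) :
    A.tensorator i j X Y ((x ⊗ₜ[k] a) ⊗ₜ[k] (y ⊗ₜ[k] b)) =
      (x ⊗ₜ[k] y) ⊗ₜ[k] A.mul ((A.α ^ i) a) ((A.α ^ j) b) := rfl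

/-- `x ⊗ c ⊗ d ↦ (α_X(x) ⊗ c) ⊗ α⁻¹(d)`. -/
def tensorComulAux (A : HomBialgebraData k) {X : Type u} [AddCommGroup X] [Module k X]
    (αX : X ≃ₗ[k] X) :
    X ⊗[k] (A.carrier ⊗[k] A.carrier) →ₗ[k] (X ⊗[k] A.carrier) ⊗[k] A.carrier :=
  TensorProduct.map (αX.toLinearMap.rTensor A.carrier) A.α.symm.toLinearMap ∘ₗ
    (TensorProduct.assoc k X A.carrier A.carrier).symm.toLinearMap

/-- `x ⊗ h ↦ (α_X(x) ⊗ h₁) ⊗ α⁻¹(h₂)`. -/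
def tensorComul (A : HomBialgebraData k) {X : Type u} [AddCommGroup X] [Module k X]
    (αX : X ≃ₗ[k] X) : X ⊗[k] A.carrier →ₗ[k] (X ⊗[k] A.carrier) ⊗[k] A.carrier :=
  A.tensorComulAux αX ∘ₗ A.comul.lTensor X

/-- `x ⊗ h ↦ ε(h) α_X⁻¹(x)`. -/
def tensorCounit (A : HomBialgebraData k) {X : Type u} [AddCommGroup X] [Module k X]
    (αX : X ≃ₗ[k] X) : X ⊗[k] A.carrier →ₗ[k] X :=
  αX.symm.toLinearMap ∘ₗ (TensorProduct.rid k X).toLinearMap ∘ₗ A.counit.lTensor X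

@[simp]
theorem tensorCounit_tmul (A : HomBialgebraData k) {X : Type u} [AddCommGroup X] [Module k X]
    (αX : X ≃ₗ[k] X) (x : X) (h : A.carrier) :
    A.tensorCounit αX (x ⊗ₜ[k] h) = A.counit h • αX.symm x := by
  simp [tensorCounit]

theorem tensorComul_natural (A : HomBialgebraData k) {X Y : Type u} [AddCommGroup X] [Module k X]
    [AddCommGroup Y] [Module k Y] (αX : X ≃ₗ[k] X) (αY : Y ≃ₗ[k] Y) (f : X →ₗ[k] Y)
    (hf : ∀ x, f (αX x) = αY (f x)) :
    A.tensorComul αY ∘ₗ f.rTensor A.carrier =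
      (f.rTensor A.carrier).rTensor A.carrier ∘ₗ A.tensorComul αX := by
  refine TensorProduct.ext' fun x h => ?_
  simp only [tensorComul, LinearMap.comp_apply, LinearMap.rTensor_tmul, LinearMap.lTensor_tmul]
  induction A.comul h using TensorProduct.induction_on with
  | zero => simp
  | tmul c d => simp [tensorComulAux, hf]
  | add c d hc hd => simp only [TensorProduct.tmul_add, map_add, hc, hd]

theorem tensorComul_comm (A : HomBialgebraData k) {X : Type u} [AddCommGroup X] [Module k X]
    (αX : X ≃ₗ[k] X) :
    A.tensorComul αX ∘ₗ (TensorProduct.congr αX A.α).toLinearMap =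
      (TensorProduct.congr (TensorProduct.congr αX A.α) A.α).toLinearMap ∘ₗ A.tensorComul αX := by
  refine TensorProduct.ext' fun x h => ?_
  simp only [tensorComul, LinearMap.comp_apply, LinearEquiv.coe_coe, TensorProduct.congr_tmul,
    LinearMap.lTensor_tmul, A.comul_map]
  induction A.comul h using TensorProduct.induction_on with
  | zero => simp
  | tmul c d => simp [tensorComulAux]
  | add c d hc hd => simp only [TensorProduct.tmul_add, map_add, hc, hd]

/-- The tensor functor `_ ⊗ A` on spaces with automorphism, with the structure maps
`δ_X(x ⊗ h) = (α_X(x) ⊗ h₁) ⊗ α⁻¹(h₂)`, `ε_X(x ⊗ h) = ε(h) α_X⁻¹(x)`,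
`(x ⊗ a) ⊗ (y ⊗ b) ↦ (x ⊗ y) ⊗ α^i(a) α^j(b)` and `c ↦ c ⊗ 1`. -/
def tensorFunctor (i j : ℤ) (A : HomBialgebraData k) : MonoidalComonadData (HomSpace k i j) where
  F :=
    { obj := fun X => ⟨X.carrier ⊗[k] A.carrier, TensorProduct.congr X.α A.α⟩
      map := fun f => HomSpace.mkHom (f.f.rTensor A.carrier)
        (TensorProduct.ext' fun x y => by simp [HomSpace.comm_apply])
      map_id := fun X => HomSpace.hom_ext (TensorProduct.ext' fun x y => rfl)
      map_comp := fun f g => HomSpace.hom_ext (TensorProduct.ext' fun x y => rfl) }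
  δ :=
    { app := fun X => HomSpace.mkHom (A.tensorComul X.α) (A.tensorComul_comm X.α)
      naturality := fun X Y f => HomSpace.hom_ext
        (A.tensorComul_natural X.α Y.α f.f (HomSpace.comm_apply f)) }
  ε :=
    { app := fun X => HomSpace.mkHom (A.tensorCounit X.α)
        (TensorProduct.ext' fun x h => by simp [A.counit_map])
      naturality := fun X Y f => HomSpace.hom_ext (TensorProduct.ext' fun x h => by
        have hf : Y.α.symm (f.f x) = f.f (X.α.symm x) := by
          rw [LinearEquiv.symm_apply_eq, ← HomSpace.comm_apply, LinearEquiv.apply_symm_apply]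
        simp [hf]) }
  μ X Y := HomSpace.mkHom (A.tensorator i j X.carrier Y.carrier)
    (TensorProduct.ext_fourfold' fun x a y b => by
      change (X.α x ⊗ₜ[k] Y.α y) ⊗ₜ[k] A.mul ((A.α ^ i) (A.α a)) ((A.α ^ j) (A.α b)) =
        (X.α x ⊗ₜ[k] Y.α y) ⊗ₜ[k] A.α (A.mul ((A.α ^ i) a) ((A.α ^ j) b))
      rw [zpow_comm, zpow_comm, A.map_mul])
  η := HomSpace.mkHom ((TensorProduct.mk k k A.carrier).flip A.one)
    (LinearMap.ext fun c => by
      change c ⊗ₜ[k] A.one = c ⊗ₜ[k] A.α A.one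
      rw [A.map_one])

end HomBialgebraData

/-! ## Hom-cotwistors and the smash coproduct -/

open HomBialgebraData

/-- `φ ∘ (α_B ⊗ α_H) = (α_H ⊗ α_B) ∘ φ`. -/
def IsCompatible (B H : HomBialgebraData k)
    (φ : B.carrier ⊗[k] H.carrier →ₗ[k] H.carrier ⊗[k] B.carrier) : Prop :=
  φ ∘ₗ (TensorProduct.congr B.α H.α).toLinearMap =
    (TensorProduct.congr H.α B.α).toLinearMap ∘ₗ φ

/-- A Hom-cotwistor. With `φ(b ⊗ h) = ∑ h^φ ⊗ b^φ`, the conditions are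
* M1: `∑ (α(h)^φ)^ψ ⊗ b₁^ψ ⊗ b₂^φ = ∑ α(h^φ) ⊗ (b^φ)₁ ⊗ (b^φ)₂`,
* M2: `∑ h₁^φ ⊗ h₂^ψ ⊗ (α(b)^φ)^ψ = ∑ (h^φ)₁ ⊗ (h^φ)₂ ⊗ α(b^φ)`,
* M3: `∑ ε(h^φ) b^φ = ε(h) b`,
* M4: `∑ ε(b^φ) h^φ = ε(b) h`. -/
structure IsHomCotwistor (B H : HomBialgebraData k)
    (φ : B.carrier ⊗[k] H.carrier →ₗ[k] H.carrier ⊗[k] B.carrier) : Prop where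
  compatible : IsCompatible B H φ
  M1 : ∀ b h,
    TensorProduct.assoc k H.carrier B.carrier B.carrier (φ.rTensor B.carrier
      ((TensorProduct.assoc k B.carrier H.carrier B.carrier).symm (φ.lTensor B.carrier
        (TensorProduct.assoc k B.carrier B.carrier H.carrier (B.comul b ⊗ₜ[k] H.α h))))) =
    TensorProduct.map H.α.toLinearMap B.comul (φ (b ⊗ₜ[k] h))
  M2 : ∀ b h,
    φ.lTensor H.carrier (TensorProduct.assoc k H.carrier B.carrier H.carrier
      (φ.rTensor H.carrier ((TensorProduct.assoc k B.carrier H.carrier H.carrier).symm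
        (B.α b ⊗ₜ[k] H.comul h)))) =
    TensorProduct.assoc k H.carrier H.carrier B.carrier
      (TensorProduct.map H.comul B.α.toLinearMap (φ (b ⊗ₜ[k] h)))
  M3 : ∀ b h, TensorProduct.lid k B.carrier (H.counit.rTensor B.carrier (φ (b ⊗ₜ[k] h))) =
    H.counit h • b
  M4 : ∀ b h, TensorProduct.rid k H.carrier (B.counit.lTensor H.carrier (φ (b ⊗ₜ[k] h))) =
    B.counit b • h

/-- A monoidal Hom-cotwistor: a Hom-cotwistor with
* M5: `∑ h^φ g^ψ ⊗ a^φ b^ψ = ∑ (hg)^φ ⊗ (ab)^φ`,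
* M6: `∑ 1^φ ⊗ 1^φ = 1 ⊗ 1`. -/
structure IsMonoidalHomCotwistor (B H : HomBialgebraData k)
    (φ : B.carrier ⊗[k] H.carrier →ₗ[k] H.carrier ⊗[k] B.carrier) : Prop where
  isHomCotwistor : IsHomCotwistor B H φ
  M5 : ∀ a b h g, TensorProduct.map₂ H.mul B.mul (φ (a ⊗ₜ[k] h)) (φ (b ⊗ₜ[k] g)) =
    φ (B.mul a b ⊗ₜ[k] H.mul h g)
  M6 : φ (B.one ⊗ₜ[k] H.one) = H.one ⊗ₜ[k] B.one

/-- The map `b ⊗ h ↦ ∑ α(h)^φ ⊗ α^n(α^(-n-1)(b)^φ)`. -/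
def twistedMap (B H : HomBialgebraData k)
    (φ : B.carrier ⊗[k] H.carrier →ₗ[k] H.carrier ⊗[k] B.carrier) (n : ℤ) :
    B.carrier ⊗[k] H.carrier →ₗ[k] H.carrier ⊗[k] B.carrier :=
  (B.α ^ n).toLinearMap.lTensor H.carrier ∘ₗ φ ∘ₗ
    TensorProduct.map (B.α ^ (-n - 1)).toLinearMap H.α.toLinearMap

theorem twistedMap_comm (B H : HomBialgebraData k)
    (φ : B.carrier ⊗[k] H.carrier →ₗ[k] H.carrier ⊗[k] B.carrier) (hφ : IsCompatible B H φ)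
    (n : ℤ) (t : B.carrier ⊗[k] H.carrier) :
    twistedMap B H φ n (TensorProduct.congr B.α H.α t) =
      TensorProduct.congr H.α B.α (twistedMap B H φ n t) := by
  induction t using TensorProduct.induction_on with
  | zero => simp
  | add c d hc hd => simp only [map_add, hc, hd]
  | tmul b h =>
    have h1 : φ (B.α ((B.α ^ (-n - 1)) b) ⊗ₜ[k] H.α (H.α h)) =
        TensorProduct.congr H.α B.α (φ ((B.α ^ (-n - 1)) b ⊗ₜ[k] H.α h)) :=
      LinearMap.congr_fun hφ ((B.α ^ (-n - 1)) b ⊗ₜ[k] H.α h)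
    simp only [twistedMap, LinearMap.comp_apply, TensorProduct.congr_tmul, TensorProduct.map_tmul,
      LinearEquiv.coe_coe, zpow_comm, h1]
    induction φ ((B.α ^ (-n - 1)) b ⊗ₜ[k] H.α h) using TensorProduct.induction_on with
    | zero => simp
    | add c d hc hd => simp only [map_add, hc, hd]
    | tmul g c => simp [zpow_comm]

/-- `(x ⊗ b) ⊗ h ↦ ∑ (x ⊗ α(h)^φ) ⊗ α^n(α^(-n-1)(b)^φ)`. -/
def twistedLawMap (B H : HomBialgebraData k)
    (φ : B.carrier ⊗[k] H.carrier →ₗ[k] H.carrier ⊗[k] B.carrier) (n : ℤ)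
    (X : Type u) [AddCommGroup X] [Module k X] :
    (X ⊗[k] B.carrier) ⊗[k] H.carrier →ₗ[k] (X ⊗[k] H.carrier) ⊗[k] B.carrier :=
  (TensorProduct.assoc k X H.carrier B.carrier).symm.toLinearMap ∘ₗ
    (twistedMap B H φ n).lTensor X ∘ₗ (TensorProduct.assoc k X B.carrier H.carrier).toLinearMap

/-- The natural transformation `(_ ⊗ B) ⊗ H ⟶ (_ ⊗ H) ⊗ B`,
`(x ⊗ b) ⊗ h ↦ ∑ (x ⊗ α(h)^φ) ⊗ α^n(α^(-n-1)(b)^φ)`. -/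
def twistedLaw (i j : ℤ) (B H : HomBialgebraData k)
    (φ : B.carrier ⊗[k] H.carrier →ₗ[k] H.carrier ⊗[k] B.carrier) (hφ : IsCompatible B H φ)
    (n : ℤ) : (B.tensorFunctor i j).F ⋙ (H.tensorFunctor i j).F ⟶
      (H.tensorFunctor i j).F ⋙ (B.tensorFunctor i j).F where
  app X := HomSpace.mkHom (twistedLawMap B H φ n X.carrier)
    (TensorProduct.ext_threefold fun x b h => by
      have h1 := twistedMap_comm B H φ hφ n (b ⊗ₜ[k] h)
      rw [TensorProduct.congr_tmul] at h1
      change (TensorProduct.assoc k X.carrier H.carrier B.carrier).symm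
          (X.α x ⊗ₜ[k] twistedMap B H φ n (B.α b ⊗ₜ[k] H.α h)) =
        TensorProduct.congr (TensorProduct.congr X.α H.α) B.α
          ((TensorProduct.assoc k X.carrier H.carrier B.carrier).symm
            (x ⊗ₜ[k] twistedMap B H φ n (b ⊗ₜ[k] h)))
      rw [h1]
      induction twistedMap B H φ n (b ⊗ₜ[k] h) using TensorProduct.induction_on with
      | zero => simp
      | add c d hc hd => simp only [TensorProduct.tmul_add, map_add, hc, hd]
      | tmul g c => simp)
  naturality X Y f := HomSpace.hom_ext (TensorProduct.ext_threefold fun x b h => by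
    change (TensorProduct.assoc k Y.carrier H.carrier B.carrier).symm
        (f.f x ⊗ₜ[k] twistedMap B H φ n (b ⊗ₜ[k] h)) =
      (f.f.rTensor H.carrier).rTensor B.carrier
        ((TensorProduct.assoc k X.carrier H.carrier B.carrier).symm
          (x ⊗ₜ[k] twistedMap B H φ n (b ⊗ₜ[k] h)))
    induction twistedMap B H φ n (b ⊗ₜ[k] h) using TensorProduct.induction_on with
    | zero => simp
    | add c d hc hd => simp only [TensorProduct.tmul_add, map_add, hc, hd]
    | tmul g c => simp)

/-- `(b₁ ⊗ b₂) ⊗ (h₁ ⊗ h₂) ↦ ∑ (b₁ ⊗ h₁^φ) ⊗ (b₂^φ ⊗ h₂)`. -/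
def smashComulAux (B H : HomBialgebraData k)
    (φ : B.carrier ⊗[k] H.carrier →ₗ[k] H.carrier ⊗[k] B.carrier) :
    (B.carrier ⊗[k] B.carrier) ⊗[k] (H.carrier ⊗[k] H.carrier) →ₗ[k]
      (B.carrier ⊗[k] H.carrier) ⊗[k] (B.carrier ⊗[k] H.carrier) :=
  (TensorProduct.assoc k B.carrier H.carrier (B.carrier ⊗[k] H.carrier)).symm.toLinearMap ∘ₗ
    ((TensorProduct.assoc k H.carrier B.carrier H.carrier).toLinearMap ∘ₗ φ.rTensor H.carrier ∘ₗ
      (TensorProduct.assoc k B.carrier H.carrier H.carrier).symm.toLinearMap).lTensor B.carrier ∘ₗ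
    (TensorProduct.assoc k B.carrier B.carrier (H.carrier ⊗[k] H.carrier)).toLinearMap

/-- `Δ(b ⊗ h) = ∑ (b₁ ⊗ h₁^φ) ⊗ (b₂^φ ⊗ h₂)`. -/
def smashComul (B H : HomBialgebraData k)
    (φ : B.carrier ⊗[k] H.carrier →ₗ[k] H.carrier ⊗[k] B.carrier) :
    B.carrier ⊗[k] H.carrier →ₗ[k]
      (B.carrier ⊗[k] H.carrier) ⊗[k] (B.carrier ⊗[k] H.carrier) :=
  smashComulAux B H φ ∘ₗ TensorProduct.map B.comul H.comul

theorem smashComulAux_comm (B H : HomBialgebraData k)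
    (φ : B.carrier ⊗[k] H.carrier →ₗ[k] H.carrier ⊗[k] B.carrier) (hφ : IsCompatible B H φ)
    (s : B.carrier ⊗[k] B.carrier) (t : H.carrier ⊗[k] H.carrier) :
    smashComulAux B H φ (TensorProduct.congr B.α B.α s ⊗ₜ[k] TensorProduct.congr H.α H.α t) =
      TensorProduct.congr (TensorProduct.congr B.α H.α) (TensorProduct.congr B.α H.α)
        (smashComulAux B H φ (s ⊗ₜ[k] t)) := by
  induction s using TensorProduct.induction_on with
  | zero => simp
  | add c d hc hd => simp only [map_add, TensorProduct.add_tmul, hc, hd]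
  | tmul b b' =>
    induction t using TensorProduct.induction_on with
    | zero => simp
    | add c d hc hd => simp only [map_add, TensorProduct.tmul_add, hc, hd]
    | tmul h h' =>
      have h1 : φ (B.α b' ⊗ₜ[k] H.α h) = TensorProduct.congr H.α B.α (φ (b' ⊗ₜ[k] h)) :=
        LinearMap.congr_fun hφ (b' ⊗ₜ[k] h)
      simp only [smashComulAux, LinearMap.comp_apply, TensorProduct.congr_tmul,
        LinearEquiv.coe_coe, TensorProduct.assoc_tmul, LinearMap.lTensor_tmul,
        TensorProduct.assoc_symm_tmul, LinearMap.rTensor_tmul, h1]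
      induction φ (b' ⊗ₜ[k] h) using TensorProduct.induction_on with
      | zero => simp
      | add c d hc hd =>
        simp only [map_add, TensorProduct.tmul_add, TensorProduct.add_tmul, hc, hd]
      | tmul g c => simp

/-- The smash coproduct `B ⊗ H`: `α = α_B ⊗ α_H`, `(a ⊗ h)(b ⊗ g) = ab ⊗ hg`, unit `1 ⊗ 1`,
`Δ(b ⊗ h) = ∑ (b₁ ⊗ h₁^φ) ⊗ (b₂^φ ⊗ h₂)`, `ε(b ⊗ h) = ε(b) ε(h)`. -/
def smash (B H : HomBialgebraData k)
    (φ : B.carrier ⊗[k] H.carrier →ₗ[k] H.carrier ⊗[k] B.carrier) (hφ : IsCompatible B H φ) :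
    HomBialgebraData k where
  carrier := B.carrier ⊗[k] H.carrier
  α := TensorProduct.congr B.α H.α
  mul := TensorProduct.map₂ B.mul H.mul
  one := B.one ⊗ₜ[k] H.one
  comul := smashComul B H φ
  counit := LinearMap.mul' k k ∘ₗ TensorProduct.map B.counit H.counit
  map_mul s t := by
    induction s using TensorProduct.induction_on with
    | zero => simp
    | add c d hc hd => simp only [map_add, LinearMap.add_apply, hc, hd]
    | tmul a h =>
      induction t using TensorProduct.induction_on with
      | zero => simp
      | add c d hc hd => simp only [map_add, hc, hd]
      | tmul b g => simp [B.map_mul, H.map_mul]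
  map_one := by simp [B.map_one, H.map_one]
  comul_map t := by
    induction t using TensorProduct.induction_on with
    | zero => simp
    | add c d hc hd => simp only [map_add, hc, hd]
    | tmul b h =>
      simp only [smashComul, LinearMap.comp_apply, TensorProduct.congr_tmul,
        TensorProduct.map_tmul, B.comul_map, H.comul_map]
      exact smashComulAux_comm B H φ hφ _ _
  counit_map t := by
    induction t using TensorProduct.induction_on with
    | zero => simp
    | add c d hc hd => simp only [map_add, hc, hd]
    | tmul b h => simp [B.counit_map, H.counit_map]

/-! ## Hom-comodules -/

/-- `(M, α, ρ)` is a right `A`-Hom-comodule: `α(m₀) ⊗ Δ(m₁) = ρ(m₀) ⊗ α(m₁)` and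
`ε(m₁) m₀ = α(m)`. -/
structure IsHomComodule (A : HomBialgebraData k) {M : Type u} [AddCommGroup M] [Module k M]
    (α : M ≃ₗ[k] M) (ρ : M →ₗ[k] M ⊗[k] A.carrier) : Prop where
  hom_coassoc : ∀ m, TensorProduct.map α.toLinearMap A.comul (ρ m) =
    TensorProduct.assoc k M A.carrier A.carrier
      (TensorProduct.map ρ A.α.toLinearMap (ρ m))
  counit : ∀ m, TensorProduct.rid k M (A.counit.lTensor M (ρ m)) = α m

/-- The finite-dimensional right `A`-Hom-comodules with bijective structure map. -/
structure HomComodule (A : HomBialgebraData k) where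
  /-- the underlying space -/
  carrier : Type u
  [addCommGroup : AddCommGroup carrier]
  [module : Module k carrier]
  [finite : Module.Finite k carrier]
  /-- the structure automorphism -/
  α : carrier ≃ₗ[k] carrier
  /-- the coaction -/
  ρ : carrier →ₗ[k] carrier ⊗[k] A.carrier
  isHomComodule : IsHomComodule A α ρ

attribute [instance] HomComodule.addCommGroup HomComodule.module HomComodule.finite

/-- `f` is a colinear map `(M, ρ) ⟶ (N, σ)`. -/
def IsHomColinear (A : HomBialgebraData k) {M N : Type u} [AddCommGroup M] [Module k M]
    [AddCommGroup N] [Module k N] (ρ : M →ₗ[k] M ⊗[k] A.carrier) (σ : N →ₗ[k] N ⊗[k] A.carrier)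
    (f : M →ₗ[k] N) : Prop :=
  σ ∘ₗ f = f.rTensor A.carrier ∘ₗ ρ

namespace HomComodule

variable {A : HomBialgebraData k}

/-- The morphisms of Hom-comodules: the colinear maps. -/
@[ext]
structure Hom (M N : HomComodule A) where
  /-- the underlying linear map -/
  f : M.carrier →ₗ[k] N.carrier
  colinear : IsHomColinear A M.ρ N.ρ f

/-- The category `Corep(A)` of Hom-comodules. -/
instance : Category (HomComodule A) where
  Hom M N := Hom M N
  id M := ⟨LinearMap.id, by simp [IsHomColinear]⟩
  comp f g := ⟨g.f ∘ₗ f.f, by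
    have h1 := f.colinear
    have h2 := g.colinear
    unfold IsHomColinear at *
    rw [← LinearMap.comp_assoc, h2, LinearMap.comp_assoc, h1, ← LinearMap.comp_assoc,
      LinearMap.rTensor_comp]⟩

@[ext]
theorem hom_ext {M N : HomComodule A} {f g : M ⟶ N} (h : f.f = g.f) : f = g := Hom.ext h

/-- A morphism of Hom-comodules commutes with the structure automorphisms. -/
theorem Hom.comm {M N : HomComodule A} (f : Hom M N) (m : M.carrier) :
    f.f (M.α m) = N.α (f.f m) := by
  have h1 : N.ρ (f.f m) = f.f.rTensor A.carrier (M.ρ m) := LinearMap.congr_fun f.colinear m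
  rw [← M.isHomComodule.counit, ← N.isHomComodule.counit, h1]
  induction M.ρ m using TensorProduct.induction_on with
  | zero => simp
  | add c d hc hd => simp only [map_add, hc, hd]
  | tmul m a => simp

/-- The underlying space with automorphism. -/
abbrev toHomSpace (i j : ℤ) (M : HomComodule A) : HomSpace k i j := ⟨M.carrier, M.α⟩

/-- The functor sending a Hom-comodule to its underlying space with automorphism. -/
def forget (i j : ℤ) (A : HomBialgebraData k) : HomComodule A ⥤ HomSpace k i j where
  obj M := M.toHomSpace i j
  map f := HomSpace.mkHom f.f (LinearMap.ext fun m => f.comm m)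
  map_id _ := rfl
  map_comp _ _ := rfl

/-- The coaction `u ⊗ v ↦ (u₀ ⊗ v₀) ⊗ α^i(u₁) α^j(v₁)`. -/
def tensorCoaction (i j : ℤ) (A : HomBialgebraData k) {M N : Type u} [AddCommGroup M] [Module k M]
    [AddCommGroup N] [Module k N] (ρ : M →ₗ[k] M ⊗[k] A.carrier) (σ : N →ₗ[k] N ⊗[k] A.carrier) :
    M ⊗[k] N →ₗ[k] (M ⊗[k] N) ⊗[k] A.carrier :=
  A.tensorator i j M N ∘ₗ TensorProduct.map ρ σ

/-- The coaction `c ↦ c ⊗ 1` on the ground field. -/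
def unitCoaction (A : HomBialgebraData k) : k →ₗ[k] k ⊗[k] A.carrier :=
  (TensorProduct.mk k k A.carrier).flip A.one

/-- An isomorphism of spaces with automorphism that is colinear is an isomorphism of
Hom-comodules. -/
def mkIso {i j : ℤ} {M N : HomComodule A} (e : M.toHomSpace i j ≅ N.toHomSpace i j)
    (h : IsHomColinear A M.ρ N.ρ e.hom.f) : M ≅ N where
  hom := ⟨e.hom.f, h⟩
  inv := ⟨e.inv.f, by
    have h1 : e.inv.f ∘ₗ e.hom.f = LinearMap.id := congrArg HomSpace.Hom.f e.hom_inv_id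
    have h2 : e.hom.f ∘ₗ e.inv.f = LinearMap.id := congrArg HomSpace.Hom.f e.inv_hom_id
    unfold IsHomColinear at *
    have h3 : N.ρ = (e.hom.f.rTensor A.carrier ∘ₗ M.ρ) ∘ₗ e.inv.f := by
      rw [← h, LinearMap.comp_assoc, h2, LinearMap.comp_id]
    rw [h3, LinearMap.comp_assoc, ← LinearMap.comp_assoc, ← LinearMap.rTensor_comp, h1,
      LinearMap.rTensor_id, LinearMap.id_comp]⟩
  hom_inv_id := hom_ext (congrArg HomSpace.Hom.f e.hom_inv_id)
  inv_hom_id := hom_ext (congrArg HomSpace.Hom.f e.inv_hom_id)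

end HomComodule

/-- The tensor coactions and the constraints of the category of spaces with automorphism live in
the category of `A`-Hom-comodules: tensor products and the unit are Hom-comodules, and tensor
products of morphisms and the constraints are colinear. -/
structure HomComoduleTensor (i j : ℤ) (A : HomBialgebraData k) : Prop where
  tensorObj : ∀ U V : HomComodule A,
    IsHomComodule A (TensorProduct.congr U.α V.α) (HomComodule.tensorCoaction i j A U.ρ V.ρ)
  tensorUnit : IsHomComodule A (LinearEquiv.refl k k) (HomComodule.unitCoaction A)
  whiskerLeft : ∀ (U : HomComodule A) {V W : HomComodule A} (f : V ⟶ W),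
    IsHomColinear A (HomComodule.tensorCoaction i j A U.ρ V.ρ)
      (HomComodule.tensorCoaction i j A U.ρ W.ρ) (f.f.lTensor U.carrier)
  whiskerRight : ∀ {V W : HomComodule A} (f : V ⟶ W) (U : HomComodule A),
    IsHomColinear A (HomComodule.tensorCoaction i j A V.ρ U.ρ)
      (HomComodule.tensorCoaction i j A W.ρ U.ρ) (f.f.rTensor U.carrier)
  associator : ∀ U V W : HomComodule A,
    IsHomColinear A
      (HomComodule.tensorCoaction i j A (HomComodule.tensorCoaction i j A U.ρ V.ρ) W.ρ)
      (HomComodule.tensorCoaction i j A U.ρ (HomComodule.tensorCoaction i j A V.ρ W.ρ))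
      (α_ (U.toHomSpace i j) (V.toHomSpace i j) (W.toHomSpace i j)).hom.f
  leftUnitor : ∀ U : HomComodule A,
    IsHomColinear A (HomComodule.tensorCoaction i j A (HomComodule.unitCoaction A) U.ρ) U.ρ
      (λ_ (U.toHomSpace i j)).hom.f
  rightUnitor : ∀ U : HomComodule A,
    IsHomColinear A (HomComodule.tensorCoaction i j A U.ρ (HomComodule.unitCoaction A)) U.ρ
      (ρ_ (U.toHomSpace i j)).hom.f

/-- The tensor product, unit and constraints of `Corep^{i,j}(A)`: those of the category of spaces
with automorphism, with the coactions `u ⊗ v ↦ (u₀ ⊗ v₀) ⊗ α^i(u₁) α^j(v₁)` and `c ↦ c ⊗ 1`. -/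
abbrev HomComoduleTensor.struct {i j : ℤ} {A : HomBialgebraData k} (h : HomComoduleTensor i j A) :
    MonoidalCategoryStruct (HomComodule A) where
  tensorObj U V := ⟨U.carrier ⊗[k] V.carrier, TensorProduct.congr U.α V.α,
    HomComodule.tensorCoaction i j A U.ρ V.ρ, h.tensorObj U V⟩
  whiskerLeft U _ _ f := ⟨f.f.lTensor U.carrier, h.whiskerLeft U f⟩
  whiskerRight f U := ⟨f.f.rTensor U.carrier, h.whiskerRight f U⟩
  tensorUnit := ⟨k, LinearEquiv.refl k k, HomComodule.unitCoaction A, h.tensorUnit⟩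
  associator U V W := HomComodule.mkIso
    (α_ (U.toHomSpace i j) (V.toHomSpace i j) (W.toHomSpace i j)) (h.associator U V W)
  leftUnitor U := HomComodule.mkIso (λ_ (U.toHomSpace i j)) (h.leftUnitor U)
  rightUnitor U := HomComodule.mkIso (ρ_ (U.toHomSpace i j)) (h.rightUnitor U)

/-- The monoidal category structure `M` on `Corep(A)` is the one of `Corep^{i,j}(A)`. -/
def IsCorepMonoidal (i j : ℤ) {A : HomBialgebraData k} (M : MonoidalCategory (HomComodule A)) :
    Prop :=
  ∃ h : HomComoduleTensor i j A, M.toMonoidalCategoryStruct = h.struct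

/-- The category of bicomodules over the natural transformation `twistedLaw i j B H φ hφ n`. -/
abbrev TwistedBicomodule (i j : ℤ) (B H : HomBialgebraData k)
    (φ : B.carrier ⊗[k] H.carrier →ₗ[k] H.carrier ⊗[k] B.carrier) (hφ : IsCompatible B H φ)
    (n : ℤ) :=
  Bicomodule (H.tensorFunctor i j).toComonadData (B.tensorFunctor i j).toComonadData
    (twistedLaw i j B H φ hφ n)

end HomBialgebras

end HomCotwist

/-!
# Monoidal Hom-cotwistors and the smash coproduct of two Hom-bialgebras

Write `F = - ⊗ H` and `G = - ⊗ B`. Most of the equivalences are statements about two bicomonads `F`,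
`G` on an arbitrary monoidal category and a natural transformation `φ : F G ⟶ G F`. The key is that
`φ` is the comultiplication `F G ⟶ F G F G` of the smash coproduct followed by the counits of the
outer `F` and the outer `G`. Hence each axiom of `φ` is an axiom of the smash coproduct cut down by
counits: if `F G` is a bicomonad, then `φ` is a monoidal distributive law
(`isMonoidalDistributiveLaw_of_isBicomonad`). In the same way a coaction over the smash coproduct is
cut by counits into a pair of coactions, and over a distributive law the comodules over `F G` are
the `φ`-bicomodules (`isComodule_smashCoproduct`, `isBicomodule_of_smashCoproduct`). A comonad on a
monoidal functor is a bicomonad as soon as tensor products of comodules and the unit are comodules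
(`MonoidalComonadData.isBicomonad_of_isComodule`), as one sees on cofree comodules; so the
monoidality of the category of bicomodules makes `F G` a bicomonad (`isBicomonad_smashCoproduct`).
Conversely, over a monoidal distributive law the tensor product of bicomodules is a bicomodule
(`IsMonoidalDistributiveLaw.bicomoduleTensor`).

What remains is a translation between these axioms and identities for Hom-bialgebras. The (monoidal)
distributive laws for `(x ⊗ b) ⊗ h ↦ ∑ (x ⊗ α(h)^φ) ⊗ α^n(α^(-n-1)(b)^φ)` are the conditions on a
monoidal Hom-cotwistor composed with automorphisms and injective maps, and evaluating them at the
unit object loses nothing (`isMonoidalDistributiveLaw_twistedLaw_iff`). Likewise `- ⊗ A` is a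
bicomonad if and only if `A` is a Hom-bialgebra, and its comodules are the Hom-comodules over `A`
(`HomBialgebraData.isBicomonad_tensorFunctor`, `HomBialgebraData.isHomBialgebra_of_isBicomonad`,
`HomBialgebraData.isComodule_tensorFunctor_iff`). Finally
`(x ⊗ b) ⊗ h ↦ α⁻¹(x) ⊗ (α^(-n-2)(b) ⊗ h)` is an isomorphism from the smash coproduct `F G` to the
comonad `- ⊗ (B ⊗ H)` that respects all structure maps (`isCompatibleIso_smashFunctorIso`).

The isomorphism of categories is the composite of the last isomorphism with the correspondence
between comodules over `F G` and bicomodules. It does not touch the underlying objects and maps, so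
its strict monoidality says that the two coactions of a tensor product agree
(`smashCoaction_tensorObj`).
-/

namespace HomCotwist

universe v u

/-! ### Comonads, distributive laws and the smash comultiplication -/

section ComonadCalculus

variable {C : Type u} [Category.{v} C]

theorem map_comp_eq_comp {C' : Type*} [Category C'] (F : C ⥤ C') {W X Y Z : C} {a : W ⟶ X}
    {b : X ⟶ Z} {c : W ⟶ Y} {d : Y ⟶ Z} (h : a ≫ b = c ≫ d) :
    F.map a ≫ F.map b = F.map c ≫ F.map d := by
  rw [← F.map_comp, h, F.map_comp]

theorem map_comp_eq {C' : Type*} [Category C'] (F : C ⥤ C') {W X Z : C} {a : W ⟶ X}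
    {b : X ⟶ Z} {c : W ⟶ Z} (h : a ≫ b = c) : F.map a ≫ F.map b = F.map c := by
  rw [← F.map_comp, h]

namespace ComonadData

variable (D : ComonadData C)

/-- The component of the comultiplication at `X`. Its target is written `F (F X)`, not
`(F ⋙ F) X`, so that rewriting sees through it. -/
def comulAt (X : C) : D.F.obj X ⟶ D.F.obj (D.F.obj X) := D.δ.app X

/-- The component of the counit at `X`, with target `X` instead of `(𝟭 C) X`. -/
def counitAt (X : C) : D.F.obj X ⟶ X := D.ε.app X

theorem comulAt_naturality {X Y : C} (f : X ⟶ Y) :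
    D.F.map f ≫ D.comulAt Y = D.comulAt X ≫ D.F.map (D.F.map f) := D.δ.naturality f

theorem counitAt_naturality {X Y : C} (f : X ⟶ Y) :
    D.F.map f ≫ D.counitAt Y = D.counitAt X ≫ f := D.ε.naturality f

/-- The axioms of a comonad, in terms of components. -/
theorem isComonad_iff : D.IsComonad ↔
    (∀ X, D.comulAt X ≫ D.F.map (D.comulAt X) = D.comulAt X ≫ D.comulAt (D.F.obj X)) ∧
    (∀ X, D.comulAt X ≫ D.counitAt (D.F.obj X) = 𝟙 _) ∧
    (∀ X, D.comulAt X ≫ D.F.map (D.counitAt X) = 𝟙 _) := by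
  constructor
  · rintro ⟨W, rfl⟩
    exact ⟨W.coassoc, W.left_counit, W.right_counit⟩
  · rintro ⟨h₁, h₂, h₃⟩
    exact ⟨{ toFunctor := D.F, δ := D.δ, ε := D.ε, coassoc := h₁, left_counit := h₂,
             right_counit := h₃ }, rfl⟩

variable {D}

/-- The cofree comodule on `X`. -/
theorem IsComonad.isComodule_comulAt (h : D.IsComonad) (X : C) : D.IsComodule (D.comulAt X) :=
  ⟨(D.isComonad_iff.1 h).1 X, (D.isComonad_iff.1 h).2.1 X⟩

theorem IsComodule.coassoc' {X : C} {ρ : X ⟶ D.F.obj X} (h : D.IsComodule ρ) :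
    ρ ≫ D.F.map ρ = ρ ≫ D.comulAt X := h.coassoc

theorem IsComodule.counit' {X : C} {ρ : X ⟶ D.F.obj X} (h : D.IsComodule ρ) :
    ρ ≫ D.counitAt X = 𝟙 X := h.counit

end ComonadData

/-- The component at `X` of a transformation `F G ⟶ G F`, with source and target written as
`F (G X)` and `G (F X)`. -/
def lawAt {D E : ComonadData C} (φ : E.F ⋙ D.F ⟶ D.F ⋙ E.F) (X : C) :
    D.F.obj (E.F.obj X) ⟶ E.F.obj (D.F.obj X) := φ.app X

theorem lawAt_naturality {D E : ComonadData C} (φ : E.F ⋙ D.F ⟶ D.F ⋙ E.F) {X Y : C}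
    (f : X ⟶ Y) : D.F.map (E.F.map f) ≫ lawAt φ Y = lawAt φ X ≫ E.F.map (D.F.map f) :=
  φ.naturality f

namespace IsDistributiveLaw

variable {D E : ComonadData C} {φ : E.F ⋙ D.F ⟶ D.F ⋙ E.F}

theorem map_comulAt (h : IsDistributiveLaw D E φ) (X : C) :
    D.F.map (E.comulAt X) ≫ lawAt φ (E.F.obj X) ≫ E.F.map (lawAt φ X) =
      lawAt φ X ≫ E.comulAt (D.F.obj X) := h.L1 X

theorem comulAt_comp (h : IsDistributiveLaw D E φ) (X : C) :
    D.comulAt (E.F.obj X) ≫ D.F.map (lawAt φ X) ≫ lawAt φ (D.F.obj X) =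
      lawAt φ X ≫ E.F.map (D.comulAt X) := h.L2 X

theorem lawAt_counitAt_left (h : IsDistributiveLaw D E φ) (X : C) :
    lawAt φ X ≫ E.F.map (D.counitAt X) = D.counitAt (E.F.obj X) := h.L3 X

theorem lawAt_counitAt_right (h : IsDistributiveLaw D E φ) (X : C) :
    lawAt φ X ≫ E.counitAt (D.F.obj X) = D.F.map (E.counitAt X) := h.L4 X

end IsDistributiveLaw

section Smash

variable {D E : ComonadData C} (φ : E.F ⋙ D.F ⟶ D.F ⋙ E.F)

/-- The comultiplication `F φ G ∘ Δ δ` of the smash coproduct `F G`. -/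
def smashComulAt (X : C) :
    D.F.obj (E.F.obj X) ⟶ D.F.obj (E.F.obj (D.F.obj (E.F.obj X))) :=
  D.comulAt (E.F.obj X) ≫ D.F.map (D.F.map (E.comulAt X)) ≫ D.F.map (lawAt φ (E.F.obj X))

/-- The smash comultiplication, followed by the counit of the first copy of `F`. -/
theorem smashComulAt_counitAt (hD : D.IsComonad) (X : C) :
    smashComulAt φ X ≫ D.counitAt (E.F.obj (D.F.obj (E.F.obj X))) =
      D.F.map (E.comulAt X) ≫ lawAt φ (E.F.obj X) := by
  have h2 := (D.isComonad_iff.1 hD).2.1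
  simp only [smashComulAt, Category.assoc]
  rw [D.counitAt_naturality, reassoc_of% D.counitAt_naturality, reassoc_of% h2]

/-- The smash comultiplication, followed by the counit of the second copy of `G`. -/
theorem smashComulAt_map_counitAt (hE : E.IsComonad) (X : C) :
    smashComulAt φ X ≫ D.F.map (E.F.map (D.F.map (E.counitAt X))) =
      D.comulAt (E.F.obj X) ≫ D.F.map (lawAt φ X) := by
  have h3 := (E.isComonad_iff.1 hE).2.2
  simp only [smashComulAt, Category.assoc]
  rw [← map_comp_eq_comp D.F (lawAt_naturality φ _), ← reassoc_of% D.comulAt_naturality,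
    ← reassoc_of% D.comulAt_naturality, reassoc_of% map_comp_eq D.F (h3 X), D.F.map_id,
    Category.id_comp]

/-- The middle counits: `F δ ≫ φ G ≫ G F ε = φ`. -/
theorem map_comulAt_lawAt_counitAt (hE : E.IsComonad) (X : C) :
    D.F.map (E.comulAt X) ≫ lawAt φ (E.F.obj X) ≫ E.F.map (D.F.map (E.counitAt X)) =
      lawAt φ X := by
  have h3 := (E.isComonad_iff.1 hE).2.2
  rw [← lawAt_naturality, reassoc_of% map_comp_eq D.F (h3 X), D.F.map_id, Category.id_comp]

variable {φ}

/-- The smash comultiplication, followed by the counit of the first copy of `G`. Of the distributive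
laws only the compatibility with the counit of `G` enters, so that the lemma is available while the
other laws are still being derived. -/
theorem smashComulAt_map_counitAt_of_law
    (h4 : ∀ X, lawAt φ X ≫ E.counitAt (D.F.obj X) = D.F.map (E.counitAt X))
    (hE : E.IsComonad) (X : C) : smashComulAt φ X ≫ D.F.map (E.counitAt (D.F.obj (E.F.obj X))) =
      D.comulAt (E.F.obj X) := by
  have h2 := (E.isComonad_iff.1 hE).2.1
  simp only [smashComulAt, Category.assoc]
  rw [map_comp_eq D.F (h4 _), map_comp_eq D.F (map_comp_eq D.F (h2 X)),
    D.F.map_id, D.F.map_id, Category.comp_id]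

/-- The smash comultiplication of a distributive law is coassociative. -/
theorem smashComulAt_coassoc (hφ : IsDistributiveLaw D E φ) (hD : D.IsComonad)
    (hE : E.IsComonad) (X : C) :
    smashComulAt φ X ≫ D.F.map (E.F.map (smashComulAt φ X)) =
      smashComulAt φ X ≫ smashComulAt φ (D.F.obj (E.F.obj X)) := by
  obtain ⟨hD1, -, -⟩ := D.isComonad_iff.1 hD
  obtain ⟨hE1, -, -⟩ := E.isComonad_iff.1 hE
  have l1 := map_comp_eq_comp (D.F ⋙ D.F) (hφ.map_comulAt (E.F.obj X)).symm
  have l2 := map_comp_eq_comp D.F (hφ.comulAt_comp (E.F.obj X)).symm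
  have n1 := map_comp_eq_comp D.F (lawAt_naturality φ (D.F.map (E.comulAt X)))
  have n2 := map_comp_eq_comp (D.F ⋙ D.F) (lawAt_naturality φ (E.comulAt X))
  have n4 := map_comp_eq_comp D.F (D.comulAt_naturality (E.comulAt X))
  have n5 := map_comp_eq_comp D.F (lawAt_naturality φ (lawAt φ (E.F.obj X)))
  have e1 := map_comp_eq_comp (D.F ⋙ D.F ⋙ D.F) (hE1 X)
  simp only [Functor.map_comp, Functor.comp_map, Functor.comp_obj]
    at l1 l2 n1 n2 n4 n5 e1
  simp only [smashComulAt, Functor.map_comp, Category.assoc]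
  -- Both sides become `Δ ≫ F Δ ≫ FFF δ ≫ FFF δ G ≫ FF φ GG ≫ F φ F GG ≫ F G F φ G`.
  rw [reassoc_of% l2, ← reassoc_of% n1, ← reassoc_of% n2, reassoc_of% n4,
    reassoc_of% e1, reassoc_of% hD1, reassoc_of% D.comulAt_naturality (lawAt φ (E.F.obj X)),
    reassoc_of% D.comulAt_naturality (D.F.map (E.comulAt X)), reassoc_of% l1, n5]

theorem smashComulAt_smashCounitAt (hφ : IsDistributiveLaw D E φ) (hD : D.IsComonad)
    (hE : E.IsComonad) (X : C) :
    smashComulAt φ X ≫ D.F.map (E.counitAt (D.F.obj (E.F.obj X))) ≫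
      D.counitAt (D.F.obj (E.F.obj X)) = 𝟙 _ := by
  rw [reassoc_of% smashComulAt_map_counitAt_of_law hφ.lawAt_counitAt_right hE,
    (D.isComonad_iff.1 hD).2.1]

theorem smashComulAt_map_smashCounitAt (hφ : IsDistributiveLaw D E φ) (hD : D.IsComonad)
    (hE : E.IsComonad) (X : C) :
    smashComulAt φ X ≫ D.F.map (E.F.map (D.F.map (E.counitAt X) ≫ D.counitAt X)) = 𝟙 _ := by
  rw [Functor.map_comp, Functor.map_comp, reassoc_of% smashComulAt_map_counitAt φ hE,
    map_comp_eq D.F (hφ.lawAt_counitAt_left X), (D.isComonad_iff.1 hD).2.2]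

/-- `φ` is recovered from the smash comultiplication by cutting off the outer counits, so the
counit and coassociativity laws of the smash coproduct force the laws of `φ`. -/
theorem isDistributiveLaw_of_smashComulAt (hD : D.IsComonad) (hE : E.IsComonad)
    (h1 : ∀ X, smashComulAt φ X ≫ D.F.map (E.F.map (smashComulAt φ X)) =
      smashComulAt φ X ≫ smashComulAt φ (D.F.obj (E.F.obj X)))
    (h2 : ∀ X, smashComulAt φ X ≫ D.F.map (E.counitAt (D.F.obj (E.F.obj X))) ≫
      D.counitAt (D.F.obj (E.F.obj X)) = 𝟙 _)
    (h3 : ∀ X, smashComulAt φ X ≫ D.F.map (E.F.map (D.F.map (E.counitAt X) ≫ D.counitAt X)) =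
      𝟙 _) : IsDistributiveLaw D E φ := by
  obtain ⟨hD1, hD2, hD3⟩ := D.isComonad_iff.1 hD
  obtain ⟨hE1, hE2, hE3⟩ := E.isComonad_iff.1 hE
  -- Cut the right counit law by the counit of the remaining copy of `F`.
  have L3 : ∀ X, lawAt φ X ≫ E.F.map (D.counitAt X) = D.counitAt (E.F.obj X) := by
    intro X
    have h := h3 X =≫ D.counitAt (E.F.obj X)
    rw [Functor.map_comp, Functor.map_comp, reassoc_of% smashComulAt_map_counitAt φ hE,
      Category.id_comp] at h
    simp only [Category.assoc] at h
    rwa [D.counitAt_naturality, reassoc_of% D.counitAt_naturality, reassoc_of% hD2] at h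
  -- Cut the left counit law by the counit of the remaining copy of `G`.
  have L4 : ∀ X, lawAt φ X ≫ E.counitAt (D.F.obj X) = D.F.map (E.counitAt X) := by
    intro X
    have h := h2 X =≫ D.F.map (E.counitAt X)
    simp only [Category.assoc] at h
    rwa [reassoc_of% D.counitAt_naturality, reassoc_of% smashComulAt_counitAt φ hD,
      Category.id_comp, ← E.counitAt_naturality,
      reassoc_of% map_comulAt_lawAt_counitAt φ hE] at h
  -- Coassociativity takes place in `F G F G F G`. For this law the outer `F` of the first pair and
  -- the copies of `G` in the second and third pair are cut; for the next one, the first two copies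
  -- of `F` and the last copy of `G`.
  have L2 : ∀ X, D.comulAt (E.F.obj X) ≫ D.F.map (lawAt φ X) ≫ lawAt φ (D.F.obj X) =
      lawAt φ X ≫ E.F.map (D.comulAt X) := by
    intro X
    have h := h1 X =≫ (D.counitAt _ ≫ E.F.map (D.F.map (E.counitAt (D.F.obj (E.F.obj X)))) ≫
      E.F.map (D.F.map (D.F.map (E.counitAt X))))
    simp only [Category.assoc] at h
    rw [reassoc_of% D.counitAt_naturality, reassoc_of% smashComulAt_counitAt φ hD,
      reassoc_of% smashComulAt_counitAt φ hD, reassoc_of% map_comulAt_lawAt_counitAt φ hE,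
      reassoc_of% map_comp_eq E.F (smashComulAt_map_counitAt_of_law L4 hE X),
      ← map_comp_eq_comp E.F (D.comulAt_naturality _),
      reassoc_of% map_comulAt_lawAt_counitAt φ hE, ← lawAt_naturality,
      reassoc_of% smashComulAt_map_counitAt φ hE] at h
    exact h.symm
  have L1 : ∀ X, D.F.map (E.comulAt X) ≫ lawAt φ (E.F.obj X) ≫ E.F.map (lawAt φ X) =
      lawAt φ X ≫ E.comulAt (D.F.obj X) := by
    intro X
    have h := h1 X =≫ (D.counitAt _ ≫ E.F.map (D.counitAt (E.F.obj (D.F.obj (E.F.obj X)))) ≫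
      E.F.map (E.F.map (D.F.map (E.counitAt X))))
    simp only [Category.assoc] at h
    rw [reassoc_of% D.counitAt_naturality, reassoc_of% smashComulAt_counitAt φ hD,
      reassoc_of% smashComulAt_counitAt φ hD,
      reassoc_of% map_comp_eq E.F (smashComulAt_counitAt φ hD X), reassoc_of% L3,
      reassoc_of% D.counitAt_naturality, reassoc_of% smashComulAt_counitAt φ hD,
      ← E.comulAt_naturality,
      reassoc_of% map_comulAt_lawAt_counitAt φ hE] at h
    rwa [← E.F.map_comp, Category.assoc, map_comulAt_lawAt_counitAt φ hE] at h
  exact ⟨L1, L2, L3, L4⟩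

end Smash

end ComonadCalculus

/-! ### Bicomonads and transport along isomorphisms -/

section MonoidalComonads

variable {C : Type u} [Category.{v} C] [MonoidalCategory C]

namespace MonoidalComonadData

variable {D : MonoidalComonadData C}

theorem IsMonoidalFunctor.μ_naturality (h : D.IsMonoidalFunctor) {X Y X' Y' : C} (f : X ⟶ Y)
    (g : X' ⟶ Y') : (D.F.map f ⊗ₘ D.F.map g) ≫ D.μ Y Y' = D.μ X X' ≫ D.F.map (f ⊗ₘ g) := by
  obtain ⟨L, -, hμ⟩ := h
  simp only [← hμ]
  exact Functor.LaxMonoidal.μ_natural D.F f g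

theorem IsMonoidalFunctor.associativity (h : D.IsMonoidalFunctor) (X Y Z : C) :
    (D.μ X Y ▷ D.F.obj Z) ≫ D.μ (X ⊗ Y) Z ≫ D.F.map (α_ X Y Z).hom =
      (α_ (D.F.obj X) (D.F.obj Y) (D.F.obj Z)).hom ≫ (D.F.obj X ◁ D.μ Y Z) ≫ D.μ X (Y ⊗ Z) := by
  obtain ⟨L, -, hμ⟩ := h
  simp only [← hμ]
  exact L.associativity X Y Z

theorem IsMonoidalFunctor.left_unitality (h : D.IsMonoidalFunctor) (X : C) :
    (λ_ (D.F.obj X)).hom = (D.η ▷ D.F.obj X) ≫ D.μ (𝟙_ C) X ≫ D.F.map (λ_ X).hom := by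
  obtain ⟨L, hη, hμ⟩ := h
  simp only [← hμ, ← hη]
  exact L.left_unitality X

theorem IsMonoidalFunctor.right_unitality (h : D.IsMonoidalFunctor) (X : C) :
    (ρ_ (D.F.obj X)).hom = (D.F.obj X ◁ D.η) ≫ D.μ X (𝟙_ C) ≫ D.F.map (ρ_ X).hom := by
  obtain ⟨L, hη, hμ⟩ := h
  simp only [← hμ, ← hη]
  exact L.right_unitality X

theorem IsBicomonad.comulAt_tensor (h : D.IsBicomonad) (X Y : C) :
    (D.comulAt X ⊗ₘ D.comulAt Y) ≫ D.μ (D.F.obj X) (D.F.obj Y) ≫ D.F.map (D.μ X Y) =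
      D.μ X Y ≫ D.comulAt (X ⊗ Y) := h.C1 X Y

theorem IsBicomonad.counitAt_tensor (h : D.IsBicomonad) (X Y : C) :
    D.μ X Y ≫ D.counitAt (X ⊗ Y) = (D.counitAt X ⊗ₘ D.counitAt Y) := h.C2 X Y

theorem IsBicomonad.counitAt_unit (h : D.IsBicomonad) : D.η ≫ D.counitAt (𝟙_ C) = 𝟙 (𝟙_ C) := h.C4

theorem IsBicomonad.isComodule_tensorCoaction (h : D.IsBicomonad) {X Y : C} {ρ : X ⟶ D.F.obj X}
    {σ : Y ⟶ D.F.obj Y} (hρ : D.IsComodule ρ) (hσ : D.IsComodule σ) :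
    D.IsComodule (D.tensorCoaction ρ σ) := by
  constructor
  · change D.tensorCoaction ρ σ ≫ D.F.map (D.tensorCoaction ρ σ) =
      D.tensorCoaction ρ σ ≫ D.comulAt (X ⊗ Y)
    simp only [tensorCoaction, Functor.map_comp, Category.assoc]
    rw [← reassoc_of% h.isMonoidalFunctor.μ_naturality, ← h.comulAt_tensor,
      tensorHom_comp_tensorHom_assoc, tensorHom_comp_tensorHom_assoc, hρ.coassoc', hσ.coassoc']
  · change D.tensorCoaction ρ σ ≫ D.counitAt (X ⊗ Y) = 𝟙 _
    simp only [tensorCoaction, Category.assoc]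
    rw [h.counitAt_tensor, tensorHom_comp_tensorHom, hρ.counit', hσ.counit', id_tensorHom_id]

theorem IsBicomonad.isComodule_η (h : D.IsBicomonad) : D.IsComodule D.η :=
  ⟨h.C3, h.C4⟩

/-- A comonad on a monoidal functor is a bicomonad as soon as tensor products of comodules and the
unit are comodules: apply this to the cofree comodules on `X` and `Y`, and cut off the superfluous
copies of `F` by counits. -/
theorem isBicomonad_of_isComodule (hD : D.IsComonad) (hM : D.IsMonoidalFunctor)
    (ht : ∀ {X Y : C} (ρ : X ⟶ D.F.obj X) (σ : Y ⟶ D.F.obj Y), D.IsComodule ρ → D.IsComodule σ →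
      D.IsComodule (D.tensorCoaction ρ σ)) (hη : D.IsComodule D.η) : D.IsBicomonad := by
  obtain ⟨-, h2, h3⟩ := D.isComonad_iff.1 hD
  have key (X Y : C) := ht _ _ (hD.isComodule_comulAt X) (hD.isComodule_comulAt Y)
  refine ⟨hD, hM, fun X Y => ?_, fun X Y => ?_, hη.coassoc, hη.counit⟩
  · change (D.comulAt X ⊗ₘ D.comulAt Y) ≫ D.μ (D.F.obj X) (D.F.obj Y) ≫ D.F.map (D.μ X Y) =
      D.μ X Y ≫ D.comulAt (X ⊗ Y)
    have h := (key X Y).coassoc' =≫ D.F.map (D.F.map (D.counitAt X ⊗ₘ D.counitAt Y))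
    simp only [tensorCoaction, Functor.map_comp, Category.assoc] at h
    rw [← D.comulAt_naturality, ← map_comp_eq_comp D.F (hM.μ_naturality _ _),
      ← reassoc_of% hM.μ_naturality, ← reassoc_of% hM.μ_naturality (D.F.map (D.counitAt X)),
      ← reassoc_of% hM.μ_naturality (D.counitAt X)] at h
    simp only [tensorHom_comp_tensorHom_assoc] at h
    rw [map_comp_eq D.F (h3 X), map_comp_eq D.F (h3 Y), h3, h3, D.F.map_id, D.F.map_id,
      Category.comp_id, Category.comp_id, id_tensorHom_id, Category.id_comp] at h
    exact h
  · change D.μ X Y ≫ D.counitAt (X ⊗ Y) = (D.counitAt X ⊗ₘ D.counitAt Y)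
    have h := (key X Y).counit' =≫ (D.counitAt X ⊗ₘ D.counitAt Y)
    simp only [tensorCoaction, Category.assoc] at h
    rwa [← D.counitAt_naturality, ← reassoc_of% hM.μ_naturality, tensorHom_comp_tensorHom_assoc,
      h3, h3, id_tensorHom_id, Category.id_comp, Category.id_comp] at h

section Colinear

theorem IsMonoidalFunctor.isColinear_whiskerLeft (hM : D.IsMonoidalFunctor) {X Y Z : C}
    (ρ : X ⟶ D.F.obj X) {σ : Y ⟶ D.F.obj Y} {τ : Z ⟶ D.F.obj Z} {f : Y ⟶ Z}
    (hf : D.IsColinear σ τ f) :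
    D.IsColinear (D.tensorCoaction ρ σ) (D.tensorCoaction ρ τ) (X ◁ f) := by
  unfold ComonadData.IsColinear tensorCoaction at *
  rw [Category.assoc, ← id_tensorHom, ← hM.μ_naturality, tensorHom_comp_tensorHom_assoc, hf,
    tensorHom_comp_tensorHom_assoc, D.F.map_id, Category.comp_id, Category.id_comp]

theorem IsMonoidalFunctor.isColinear_whiskerRight (hM : D.IsMonoidalFunctor) {X Y Z : C}
    (ρ : X ⟶ D.F.obj X) {σ : Y ⟶ D.F.obj Y} {τ : Z ⟶ D.F.obj Z} {f : Y ⟶ Z}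
    (hf : D.IsColinear σ τ f) :
    D.IsColinear (D.tensorCoaction σ ρ) (D.tensorCoaction τ ρ) (f ▷ X) := by
  unfold ComonadData.IsColinear tensorCoaction at *
  rw [Category.assoc, ← tensorHom_id, ← hM.μ_naturality, tensorHom_comp_tensorHom_assoc, hf,
    tensorHom_comp_tensorHom_assoc, D.F.map_id, Category.comp_id, Category.id_comp]

theorem IsMonoidalFunctor.isColinear_associator (hM : D.IsMonoidalFunctor) {X Y Z : C}
    (ρ : X ⟶ D.F.obj X) (σ : Y ⟶ D.F.obj Y) (τ : Z ⟶ D.F.obj Z) :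
    D.IsColinear (D.tensorCoaction (D.tensorCoaction ρ σ) τ)
      (D.tensorCoaction ρ (D.tensorCoaction σ τ)) (α_ X Y Z).hom := by
  have h1 : ((ρ ⊗ₘ σ) ≫ D.μ X Y) ⊗ₘ τ = ((ρ ⊗ₘ σ) ⊗ₘ τ) ≫ (D.μ X Y ▷ D.F.obj Z) := by
    rw [← tensorHom_id, tensorHom_comp_tensorHom, Category.comp_id]
  have h2 : ρ ⊗ₘ ((σ ⊗ₘ τ) ≫ D.μ Y Z) = (ρ ⊗ₘ (σ ⊗ₘ τ)) ≫ (D.F.obj X ◁ D.μ Y Z) := by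
    rw [← id_tensorHom, tensorHom_comp_tensorHom, Category.comp_id]
  unfold ComonadData.IsColinear tensorCoaction
  rw [h1, h2]
  simp only [Category.assoc]
  rw [hM.associativity, associator_naturality_assoc]

theorem IsMonoidalFunctor.isColinear_leftUnitor (hM : D.IsMonoidalFunctor) {X : C}
    (ρ : X ⟶ D.F.obj X) : D.IsColinear (D.tensorCoaction D.η ρ) ρ (λ_ X).hom := by
  unfold ComonadData.IsColinear tensorCoaction
  rw [tensorHom_def', Category.assoc, Category.assoc, ← hM.left_unitality,
    leftUnitor_naturality]

theorem IsMonoidalFunctor.isColinear_rightUnitor (hM : D.IsMonoidalFunctor) {X : C}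
    (ρ : X ⟶ D.F.obj X) : D.IsColinear (D.tensorCoaction ρ D.η) ρ (ρ_ X).hom := by
  unfold ComonadData.IsColinear tensorCoaction
  rw [MonoidalCategory.tensorHom_def, Category.assoc, Category.assoc, ← hM.right_unitality,
    rightUnitor_naturality]

end Colinear

end MonoidalComonadData

/-- A natural isomorphism `τ` between the underlying functors carries the comultiplication, the
counit and the monoidal structure maps of `D` to those of `D'`. -/
structure MonoidalComonadData.IsCompatibleIso (D D' : MonoidalComonadData C) (τ : D.F ≅ D'.F) :
    Prop where
  comul : ∀ X, D.comulAt X ≫ D.F.map (τ.hom.app X) ≫ τ.hom.app (D'.F.obj X) =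
    τ.hom.app X ≫ D'.comulAt X
  counit : ∀ X, τ.hom.app X ≫ D'.counitAt X = D.counitAt X
  tensor : ∀ X Y, D.μ X Y ≫ τ.hom.app (X ⊗ Y) = (τ.hom.app X ⊗ₘ τ.hom.app Y) ≫ D'.μ X Y
  unit : D.η ≫ τ.hom.app (𝟙_ C) = D'.η

namespace MonoidalComonadData.IsCompatibleIso

variable {D D' : MonoidalComonadData C} {τ : D.F ≅ D'.F}

theorem symm (h : IsCompatibleIso D D' τ) : IsCompatibleIso D' D τ.symm where
  comul X := by
    have h1 := h.comul X
    rw [← cancel_epi (τ.hom.app X), ← reassoc_of% h1]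
    simp
  counit X := by simp [← h.counit]
  tensor X Y := by
    rw [← cancel_epi (τ.hom.app X ⊗ₘ τ.hom.app Y), ← reassoc_of% h.tensor]
    simp
  unit := by simp [← h.unit]

theorem isComodule (h : IsCompatibleIso D D' τ) {X : C} {ρ : X ⟶ D.F.obj X}
    (hρ : D.IsComodule ρ) : D'.IsComodule (ρ ≫ τ.hom.app X) where
  coassoc := by
    change (ρ ≫ τ.hom.app X) ≫ D'.F.map (ρ ≫ τ.hom.app X) = (ρ ≫ τ.hom.app X) ≫ D'.comulAt X
    rw [Category.assoc, Category.assoc, ← h.comul, ← reassoc_of% hρ.coassoc', ← τ.hom.naturality,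
      Functor.map_comp_assoc]
  counit := by
    change (ρ ≫ τ.hom.app X) ≫ D'.counitAt X = 𝟙 X
    rw [Category.assoc, h.counit, hρ.counit']

theorem tensorCoaction_comp (h : IsCompatibleIso D D' τ) {X Y : C} (ρ : X ⟶ D.F.obj X)
    (σ : Y ⟶ D.F.obj Y) :
    D.tensorCoaction ρ σ ≫ τ.hom.app (X ⊗ Y) =
      D'.tensorCoaction (ρ ≫ τ.hom.app X) (σ ≫ τ.hom.app Y) := by
  simp only [tensorCoaction, Category.assoc]
  rw [h.tensor, tensorHom_comp_tensorHom_assoc]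

theorem isColinear_iff {X Y : C} {ρ : X ⟶ D.F.obj X} {σ : Y ⟶ D.F.obj Y} {f : X ⟶ Y} :
    D'.IsColinear (ρ ≫ τ.hom.app X) (σ ≫ τ.hom.app Y) f ↔ D.IsColinear ρ σ f := by
  unfold ComonadData.IsColinear
  rw [Category.assoc, ← τ.hom.naturality, ← Category.assoc, ← Category.assoc, cancel_mono]

theorem isComonad (h : IsCompatibleIso D D' τ) (hD : D.IsComonad) : D'.IsComonad := by
  obtain ⟨h1, h2, h3⟩ := D.isComonad_iff.1 hD
  refine D'.isComonad_iff.2 ⟨fun X => ?_, fun X => ?_, fun X => ?_⟩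
  · rw [← cancel_epi (τ.hom.app X), ← reassoc_of% h.comul, ← reassoc_of% h.comul, ← h.comul,
      ← τ.hom.naturality, reassoc_of% D.comulAt_naturality, ← reassoc_of% h1]
    have := map_comp_eq_comp D.F (h.comul X)
    simp only [Functor.map_comp] at this
    rw [← reassoc_of% this]
  · rw [← cancel_epi (τ.hom.app X), ← reassoc_of% h.comul, h.counit, D.counitAt_naturality,
      reassoc_of% h2, Category.comp_id]
  · rw [← cancel_epi (τ.hom.app X), ← reassoc_of% h.comul, ← τ.hom.naturality,
      ← D.F.map_comp_assoc, h.counit, reassoc_of% h3, Category.comp_id]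

/-- A bicomonad is transported along a compatible isomorphism to a monoidal functor, since the
tensor product of two `D'`-comodules is the image of that of the corresponding `D`-comodules. -/
theorem isBicomonad (h : IsCompatibleIso D D' τ) (hM : D'.IsMonoidalFunctor)
    (hD : D.IsBicomonad) : D'.IsBicomonad := by
  refine isBicomonad_of_isComodule (h.isComonad hD.isComonad) hM
    (fun {X Y} ρ σ hρ hσ => ?_) ?_
  · have h1 := h.isComodule (hD.isComodule_tensorCoaction (h.symm.isComodule hρ)
      (h.symm.isComodule hσ))
    convert h1 using 1
    rw [h.tensorCoaction_comp]
    simp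
  · rw [← h.unit]
    exact h.isComodule hD.isComodule_η

end MonoidalComonadData.IsCompatibleIso

end MonoidalComonads

/-! ### Bicomodules as comodules over the smash coproduct -/

section Bicomodules

variable {C : Type u} [Category.{v} C] {D E : ComonadData C} {φ : E.F ⋙ D.F ⟶ D.F ⋙ E.F}

theorem IsBicomodule.compat' {X : C} {θ : X ⟶ D.F.obj X} {ρ : X ⟶ E.F.obj X}
    (h : IsBicomodule D E φ θ ρ) : θ ≫ D.F.map ρ ≫ lawAt φ X = ρ ≫ E.F.map θ := h.compat

/-- The composite `F ρ ∘ θ` of the coactions of a bicomodule is coassociative over the smash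
coproduct. -/
theorem IsBicomodule.coassoc_comp {X : C}
    {θ : X ⟶ D.F.obj X} {ρ : X ⟶ E.F.obj X} (h : IsBicomodule D E φ θ ρ) :
    (θ ≫ D.F.map ρ) ≫ D.F.map (E.F.map (θ ≫ D.F.map ρ)) = (θ ≫ D.F.map ρ) ≫ smashComulAt φ X := by
  have h1 := map_comp_eq_comp D.F h.compat'.symm
  have h2 := map_comp_eq_comp D.F (lawAt_naturality φ ρ)
  have h3 := map_comp_eq_comp (D.F ⋙ D.F) h.right.coassoc'
  simp only [Functor.map_comp, Functor.comp_map, Functor.comp_obj] at h1 h2 h3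
  simp only [smashComulAt, Functor.map_comp, Category.assoc]
  rw [reassoc_of% h1, ← h2, reassoc_of% h.left.coassoc', reassoc_of% h3,
    reassoc_of% D.comulAt_naturality]

theorem IsBicomodule.counit_comp {X : C}
    {θ : X ⟶ D.F.obj X} {ρ : X ⟶ E.F.obj X} (h : IsBicomodule D E φ θ ρ) :
    (θ ≫ D.F.map ρ) ≫ D.F.map (E.counitAt X) ≫ D.counitAt X = 𝟙 X := by
  rw [Category.assoc, reassoc_of% map_comp_eq D.F h.right.counit', D.F.map_id, Category.id_comp,
    h.left.counit']

theorem comp_map_counitAt {X : C} (θ : X ⟶ D.F.obj X) {ρ : X ⟶ E.F.obj X} (h : E.IsComodule ρ) :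
    (θ ≫ D.F.map ρ) ≫ D.F.map (E.counitAt X) = θ := by
  rw [Category.assoc, map_comp_eq D.F h.counit', D.F.map_id, Category.comp_id]

theorem comp_counitAt {X : C} {θ : X ⟶ D.F.obj X} (h : D.IsComodule θ) (ρ : X ⟶ E.F.obj X) :
    (θ ≫ D.F.map ρ) ≫ D.counitAt (E.F.obj X) = ρ := by
  rw [Category.assoc, D.counitAt_naturality, reassoc_of% h.counit']

/-- A coaction `Ω` over the smash coproduct is the composite of the two coactions that it induces by
means of the counits. -/
theorem map_counitAt_comp_map_counitAt (hφ : IsDistributiveLaw D E φ) (hD : D.IsComonad)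
    (hE : E.IsComonad) {X : C}
    {Ω : X ⟶ D.F.obj (E.F.obj X)} (h : Ω ≫ D.F.map (E.F.map Ω) = Ω ≫ smashComulAt φ X) :
    (Ω ≫ D.F.map (E.counitAt X)) ≫ D.F.map (Ω ≫ D.counitAt (E.F.obj X)) = Ω := by
  rw [Category.assoc, Functor.map_comp,
    ← reassoc_of% map_comp_eq_comp D.F (E.counitAt_naturality Ω), reassoc_of% h,
    reassoc_of% smashComulAt_map_counitAt_of_law hφ.lawAt_counitAt_right hE,
    (D.isComonad_iff.1 hD).2.2, Category.comp_id]

/-- A coaction over the smash coproduct induces a bicomodule: all three axioms are coassociativity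
followed by suitable counits. -/
theorem isBicomodule_of_comp (hφ : IsDistributiveLaw D E φ) (hD : D.IsComonad)
    (hE : E.IsComonad) {X : C}
    {Ω : X ⟶ D.F.obj (E.F.obj X)} (h : Ω ≫ D.F.map (E.F.map Ω) = Ω ≫ smashComulAt φ X)
    (h' : Ω ≫ D.F.map (E.counitAt X) ≫ D.counitAt X = 𝟙 X) :
    IsBicomodule D E φ (Ω ≫ D.F.map (E.counitAt X)) (Ω ≫ D.counitAt (E.F.obj X)) := by
  have hΩ := map_counitAt_comp_map_counitAt hφ hD hE h
  have e1 : (Ω ≫ D.F.map (E.counitAt X)) ≫ D.F.map (Ω ≫ D.F.map (E.counitAt X)) =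
      (Ω ≫ D.F.map (E.counitAt X)) ≫ D.comulAt X := by
    rw [Category.assoc, Functor.map_comp,
      ← reassoc_of% map_comp_eq_comp D.F (E.counitAt_naturality Ω), reassoc_of% h,
      reassoc_of% smashComulAt_map_counitAt_of_law hφ.lawAt_counitAt_right hE, Category.assoc,
      D.comulAt_naturality]
  have e2 : (Ω ≫ D.counitAt (E.F.obj X)) ≫ E.F.map (Ω ≫ D.counitAt (E.F.obj X)) =
      (Ω ≫ D.counitAt (E.F.obj X)) ≫ E.comulAt X := by
    rw [Category.assoc, Functor.map_comp, ← reassoc_of% D.counitAt_naturality, reassoc_of% h,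
      reassoc_of% smashComulAt_counitAt φ hD, hφ.lawAt_counitAt_left, D.counitAt_naturality,
      Category.assoc]
  have e3 : (Ω ≫ D.counitAt (E.F.obj X)) ≫ E.F.map (Ω ≫ D.F.map (E.counitAt X)) =
      Ω ≫ lawAt φ X := by
    rw [Category.assoc, Functor.map_comp, ← reassoc_of% D.counitAt_naturality, reassoc_of% h,
      reassoc_of% smashComulAt_counitAt φ hD, map_comulAt_lawAt_counitAt φ hE]
  refine ⟨⟨e1, ?_⟩, ⟨e2, ?_⟩, ?_⟩
  · change (Ω ≫ D.F.map (E.counitAt X)) ≫ D.counitAt X = 𝟙 X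
    rw [Category.assoc, h']
  · change (Ω ≫ D.counitAt (E.F.obj X)) ≫ E.counitAt X = 𝟙 X
    rw [Category.assoc, ← D.counitAt_naturality, h']
  · change (Ω ≫ D.F.map (E.counitAt X)) ≫ D.F.map (Ω ≫ D.counitAt (E.F.obj X)) ≫ lawAt φ X = _
    rw [e3, ← Category.assoc, hΩ]

theorem isColinear_map_counitAt {X Y : C} {Ω : X ⟶ D.F.obj (E.F.obj X)}
    {Ω' : Y ⟶ D.F.obj (E.F.obj Y)} {f : X ⟶ Y} (h : Ω ≫ D.F.map (E.F.map f) = f ≫ Ω') :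
    D.IsColinear (Ω ≫ D.F.map (E.counitAt X)) (Ω' ≫ D.F.map (E.counitAt Y)) f := by
  unfold ComonadData.IsColinear
  rw [Category.assoc, ← map_comp_eq_comp D.F (E.counitAt_naturality f), reassoc_of% h]

theorem isColinear_counitAt {X Y : C} {Ω : X ⟶ D.F.obj (E.F.obj X)}
    {Ω' : Y ⟶ D.F.obj (E.F.obj Y)} {f : X ⟶ Y} (h : Ω ≫ D.F.map (E.F.map f) = f ≫ Ω') :
    E.IsColinear (Ω ≫ D.counitAt (E.F.obj X)) (Ω' ≫ D.counitAt (E.F.obj Y)) f := by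
  unfold ComonadData.IsColinear
  rw [Category.assoc, ← D.counitAt_naturality, reassoc_of% h]

theorem colinear_comp_map {X Y : C} {θ : X ⟶ D.F.obj X} {ρ : X ⟶ E.F.obj X}
    {θ' : Y ⟶ D.F.obj Y} {ρ' : Y ⟶ E.F.obj Y} {f : X ⟶ Y} (hD : D.IsColinear θ θ' f)
    (hE : E.IsColinear ρ ρ' f) :
    (θ ≫ D.F.map ρ) ≫ D.F.map (E.F.map f) = f ≫ θ' ≫ D.F.map ρ' := by
  unfold ComonadData.IsColinear at hD hE
  rw [Category.assoc, map_comp_eq_comp D.F hE, reassoc_of% hD]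

end Bicomodules

/-! ### Monoidal distributive laws -/

section MonoidalBicomodules

variable {C : Type u} [Category.{v} C] [MonoidalCategory C] {D E : MonoidalComonadData C}
  {φ : E.F ⋙ D.F ⟶ D.F ⋙ E.F}

theorem isComodule_smashCoproduct {X : C}
    {θ : X ⟶ D.F.obj X} {ρ : X ⟶ E.F.obj X}
    (h : IsBicomodule D.toComonadData E.toComonadData φ θ ρ) :
    (smashCoproduct D E φ).IsComodule (θ ≫ D.F.map ρ) :=
  ⟨h.coassoc_comp, h.counit_comp⟩

theorem isBicomodule_of_smashCoproduct
    (hφ : IsDistributiveLaw D.toComonadData E.toComonadData φ) (hD : D.IsComonad)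
    (hE : E.IsComonad) {X : C} {Ω : X ⟶ D.F.obj (E.F.obj X)}
    (h : (smashCoproduct D E φ).IsComodule Ω) :
    IsBicomodule D.toComonadData E.toComonadData φ (Ω ≫ D.F.map (E.counitAt X))
      (Ω ≫ D.counitAt (E.F.obj X)) :=
  isBicomodule_of_comp hφ hD hE h.1 h.2

theorem isComonad_smashCoproduct (hφ : IsDistributiveLaw D.toComonadData E.toComonadData φ)
    (hD : D.IsComonad) (hE : E.IsComonad) : (smashCoproduct D E φ).IsComonad :=
  (ComonadData.isComonad_iff _).2 ⟨smashComulAt_coassoc hφ hD hE,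
    smashComulAt_smashCounitAt hφ hD hE, smashComulAt_map_smashCounitAt hφ hD hE⟩

theorem isMonoidalFunctor_smashCoproduct (hD : D.IsMonoidalFunctor) (hE : E.IsMonoidalFunctor) :
    (smashCoproduct D E φ).IsMonoidalFunctor := by
  obtain ⟨L, hη, hμ⟩ := hD
  obtain ⟨L', hη', hμ'⟩ := hE
  refine ⟨@Functor.LaxMonoidal.comp _ _ _ _ _ _ _ _ _ E.F D.F L' L, ?_, fun X Y => ?_⟩
  · change L.ε ≫ D.F.map L'.ε = D.η ≫ D.F.map E.η
    rw [hη, hη']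
  · change L.μ _ _ ≫ D.F.map (L'.μ X Y) = D.μ _ _ ≫ D.F.map (E.μ X Y)
    rw [hμ, hμ']

/-- The coaction of the smash coproduct on a tensor product of bicomodules. -/
theorem tensorCoaction_comp_map (hD : D.IsMonoidalFunctor) {X Y : C}
    (θ : X ⟶ D.F.obj X) (ρ : X ⟶ E.F.obj X) (θ' : Y ⟶ D.F.obj Y) (ρ' : Y ⟶ E.F.obj Y) :
    D.tensorCoaction θ θ' ≫ D.F.map (E.tensorCoaction ρ ρ') =
      (smashCoproduct D E φ).tensorCoaction (θ ≫ D.F.map ρ) (θ' ≫ D.F.map ρ') := by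
  change ((θ ⊗ₘ θ') ≫ D.μ X Y) ≫ D.F.map ((ρ ⊗ₘ ρ') ≫ E.μ X Y) =
    ((θ ≫ D.F.map ρ) ⊗ₘ (θ' ≫ D.F.map ρ')) ≫ D.μ (E.F.obj X) (E.F.obj Y) ≫ D.F.map (E.μ X Y)
  rw [Category.assoc, Functor.map_comp, ← reassoc_of% hD.μ_naturality,
    tensorHom_comp_tensorHom_assoc]

/-- If tensor products of bicomodules and the unit are bicomodules, the smash coproduct is a
bicomonad. -/
theorem isBicomonad_smashCoproduct (hφ : IsDistributiveLaw D.toComonadData E.toComonadData φ)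
    (hD : D.IsBicomonad) (hE : E.IsBicomonad) (h : BicomoduleTensor D E φ) :
    (smashCoproduct D E φ).IsBicomonad := by
  have hDC := hD.isComonad
  have hEC := hE.isComonad
  refine MonoidalComonadData.isBicomonad_of_isComodule (isComonad_smashCoproduct hφ hDC hEC)
    (isMonoidalFunctor_smashCoproduct hD.isMonoidalFunctor hE.isMonoidalFunctor)
    (fun {X Y} Ω Ω' hΩ hΩ' => ?_) (isComodule_smashCoproduct h.tensorUnit)
  have h1 := h.tensorObj ⟨X, _, _, isBicomodule_of_smashCoproduct hφ hDC hEC hΩ⟩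
    ⟨Y, _, _, isBicomodule_of_smashCoproduct hφ hDC hEC hΩ'⟩
  have h2 := (tensorCoaction_comp_map (φ := φ) hD.isMonoidalFunctor _ _ _ _).trans
    (congrArg₂ (smashCoproduct D E φ).tensorCoaction
      (map_counitAt_comp_map_counitAt hφ hDC hEC hΩ.1)
      (map_counitAt_comp_map_counitAt hφ hDC hEC hΩ'.1))
  exact h2 ▸ isComodule_smashCoproduct h1

theorem IsMonoidalDistributiveLaw.tensor' (h : IsMonoidalDistributiveLaw D E φ) (M N : C) :
    D.μ (E.F.obj M) (E.F.obj N) ≫ D.F.map (E.μ M N) ≫ lawAt φ (M ⊗ N) =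
      (lawAt φ M ⊗ₘ lawAt φ N) ≫ E.μ (D.F.obj M) (D.F.obj N) ≫ E.F.map (D.μ M N) :=
  h.tensor M N

/-- Over a monoidal distributive law, tensor products of bicomodules are bicomodules. -/
theorem IsMonoidalDistributiveLaw.isBicomodule_tensor (h : IsMonoidalDistributiveLaw D E φ)
    (hD : D.IsBicomonad) (hE : E.IsBicomonad) {X Y : C} {θ : X ⟶ D.F.obj X} {ρ : X ⟶ E.F.obj X}
    {θ' : Y ⟶ D.F.obj Y} {ρ' : Y ⟶ E.F.obj Y}
    (hX : IsBicomodule D.toComonadData E.toComonadData φ θ ρ)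
    (hY : IsBicomodule D.toComonadData E.toComonadData φ θ' ρ') :
    IsBicomodule D.toComonadData E.toComonadData φ (D.tensorCoaction θ θ')
      (E.tensorCoaction ρ ρ') := by
  refine ⟨hD.isComodule_tensorCoaction hX.left hY.left,
    hE.isComodule_tensorCoaction hX.right hY.right, ?_⟩
  change D.tensorCoaction θ θ' ≫ D.F.map (E.tensorCoaction ρ ρ') ≫ lawAt φ (X ⊗ Y) =
    E.tensorCoaction ρ ρ' ≫ E.F.map (D.tensorCoaction θ θ')
  simp only [MonoidalComonadData.tensorCoaction, Functor.map_comp, Category.assoc]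
  rw [← reassoc_of% hD.isMonoidalFunctor.μ_naturality, h.tensor',
    ← reassoc_of% hE.isMonoidalFunctor.μ_naturality]
  simp only [tensorHom_comp_tensorHom_assoc]
  have e1 := hX.compat'
  have e2 := hY.compat'
  rw [← e1, ← e2]

theorem IsMonoidalDistributiveLaw.bicomoduleTensor (h : IsMonoidalDistributiveLaw D E φ)
    (hD : D.IsBicomonad) (hE : E.IsBicomonad) : BicomoduleTensor D E φ where
  tensorObj U V := h.isBicomodule_tensor hD hE U.isBicomodule V.isBicomodule
  tensorUnit := ⟨hD.isComodule_η, hE.isComodule_η, h.unit⟩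
  whiskerLeft _ _ _ f := ⟨hD.isMonoidalFunctor.isColinear_whiskerLeft _ f.left,
    hE.isMonoidalFunctor.isColinear_whiskerLeft _ f.right⟩
  whiskerRight f _ := ⟨hD.isMonoidalFunctor.isColinear_whiskerRight _ f.left,
    hE.isMonoidalFunctor.isColinear_whiskerRight _ f.right⟩
  associator _ _ _ := ⟨hD.isMonoidalFunctor.isColinear_associator _ _ _,
    hE.isMonoidalFunctor.isColinear_associator _ _ _⟩
  leftUnitor _ := ⟨hD.isMonoidalFunctor.isColinear_leftUnitor _,
    hE.isMonoidalFunctor.isColinear_leftUnitor _⟩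
  rightUnitor _ := ⟨hD.isMonoidalFunctor.isColinear_rightUnitor _,
    hE.isMonoidalFunctor.isColinear_rightUnitor _⟩

/-- If the smash coproduct is a bicomonad, then `φ` is a monoidal distributive law: since `φ` is the
smash comultiplication followed by the outer counits, the monoidality of the smash comultiplication
is inherited by `φ`. -/
theorem isMonoidalDistributiveLaw_of_isBicomonad (hD : D.IsBicomonad) (hE : E.IsBicomonad)
    (h : (smashCoproduct D E φ).IsBicomonad) : IsMonoidalDistributiveLaw D E φ := by
  obtain ⟨h1, h2, h3⟩ := (ComonadData.isComonad_iff _).1 h.isComonad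
  have hDC := hD.isComonad
  have hEC := hE.isComonad
  refine ⟨isDistributiveLaw_of_smashComulAt hDC hEC h1 h2 h3, fun M N => ?_, ?_⟩
  · change D.μ (E.F.obj M) (E.F.obj N) ≫ D.F.map (E.μ M N) ≫ lawAt φ (M ⊗ N) =
      (lawAt φ M ⊗ₘ lawAt φ N) ≫ E.μ (D.F.obj M) (D.F.obj N) ≫ E.F.map (D.μ M N)
    have c1 : (smashComulAt φ M ⊗ₘ smashComulAt φ N) ≫
        (D.μ (E.F.obj (D.F.obj (E.F.obj M))) (E.F.obj (D.F.obj (E.F.obj N))) ≫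
          D.F.map (E.μ (D.F.obj (E.F.obj M)) (D.F.obj (E.F.obj N)))) ≫
        D.F.map (E.F.map (D.μ (E.F.obj M) (E.F.obj N) ≫ D.F.map (E.μ M N))) =
      (D.μ (E.F.obj M) (E.F.obj N) ≫ D.F.map (E.μ M N)) ≫ smashComulAt φ (M ⊗ N) := h.C1 M N
    have c2 := c1 =≫ (D.counitAt _ ≫ E.F.map (D.F.map (E.counitAt (M ⊗ N))))
    simp only [Functor.map_comp, Category.assoc] at c2
    rw [reassoc_of% smashComulAt_counitAt φ hDC, map_comulAt_lawAt_counitAt φ hEC] at c2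
    rw [← c2]
    rw [reassoc_of% D.counitAt_naturality, reassoc_of% D.counitAt_naturality,
      reassoc_of% D.counitAt_naturality, reassoc_of% hD.counitAt_tensor,
      tensorHom_comp_tensorHom_assoc, smashComulAt_counitAt φ hDC, smashComulAt_counitAt φ hDC,
      map_comp_eq E.F (map_comp_eq D.F (hE.counitAt_tensor M N)),
      ← map_comp_eq_comp E.F (hD.isMonoidalFunctor.μ_naturality _ _),
      ← reassoc_of% hE.isMonoidalFunctor.μ_naturality, tensorHom_comp_tensorHom_assoc,
      Category.assoc, Category.assoc, map_comulAt_lawAt_counitAt φ hEC,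
      map_comulAt_lawAt_counitAt φ hEC]
  · change D.η ≫ D.F.map E.η ≫ lawAt φ (𝟙_ C) = E.η ≫ E.F.map D.η
    have c1 : (D.η ≫ D.F.map E.η) ≫ D.F.map (E.F.map (D.η ≫ D.F.map E.η)) =
      (D.η ≫ D.F.map E.η) ≫ smashComulAt φ (𝟙_ C) := h.C3
    have c2 := c1 =≫ (D.counitAt _ ≫ E.F.map (D.F.map (E.counitAt (𝟙_ C))))
    simp only [Functor.map_comp, Category.assoc] at c2
    rw [reassoc_of% smashComulAt_counitAt φ hDC, map_comulAt_lawAt_counitAt φ hEC] at c2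
    rw [← c2, reassoc_of% D.counitAt_naturality, reassoc_of% D.counitAt_naturality,
      reassoc_of% D.counitAt_naturality, reassoc_of% hD.counitAt_unit,
      map_comp_eq E.F (map_comp_eq D.F hE.counitAt_unit)]
    simp

end MonoidalBicomodules

/-! ### The comonad `- ⊗ A` on spaces with an automorphism -/

section TensorFunctor

variable {k : Type u} [Field k]

theorem tmul_left_injective {X V : Type*} [AddCommGroup X] [Module k X] [AddCommGroup V]
    [Module k V] (f : X →ₗ[k] k) {x : X} (hx : f x = 1) {v w : V}
    (h : x ⊗ₜ[k] v = x ⊗ₜ[k] w) : v = w := by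
  have h1 := congrArg (fun t => TensorProduct.lid k V (f.rTensor V t)) h
  simpa [hx] using h1

namespace HomBialgebraData

variable (A : HomBialgebraData k) {X Y : Type u} [AddCommGroup X] [Module k X] [AddCommGroup Y]
  [Module k Y]

theorem comul_symm (a : A.carrier) :
    A.comul (A.α.symm a) = TensorProduct.congr A.α.symm A.α.symm (A.comul a) := by
  have h := A.comul_map (A.α.symm a)
  rw [LinearEquiv.apply_symm_apply] at h
  rw [h, ← TensorProduct.congr_symm, LinearEquiv.symm_apply_apply]

theorem comul_zpow (n : ℤ) (a : A.carrier) :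
    A.comul ((A.α ^ n) a) = TensorProduct.congr (A.α ^ n) (A.α ^ n) (A.comul a) := by
  rw [zpow_conj A.comul A.α (TensorProduct.congr A.α A.α) A.comul_map, TensorProduct.congr_zpow]

theorem counit_symm (a : A.carrier) : A.counit (A.α.symm a) = A.counit a := by
  rw [← A.counit_map, LinearEquiv.apply_symm_apply]

theorem counit_zpow (n : ℤ) (a : A.carrier) : A.counit ((A.α ^ n) a) = A.counit a := by
  have h := zpow_conj A.counit A.α (LinearEquiv.refl k k) A.counit_map n a
  rw [h]
  change ((1 : k ≃ₗ[k] k) ^ n) _ = _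
  rw [one_zpow]; rfl

theorem zpow_apply_mul (n : ℤ) (a b : A.carrier) :
    (A.α ^ n) (A.mul a b) = A.mul ((A.α ^ n) a) ((A.α ^ n) b) := by
  have h := zpow_conj (TensorProduct.lift A.mul) (TensorProduct.congr A.α A.α) A.α
    (fun t => by
      induction t using TensorProduct.induction_on with
      | zero => simp
      | add c d hc hd => simp only [map_add, hc, hd]
      | tmul c d => simp [A.map_mul]) n (a ⊗ₜ[k] b)
  rw [TensorProduct.congr_zpow] at h
  simpa using h.symm

theorem mul_symm (a b : A.carrier) :
    A.α.symm (A.mul a b) = A.mul (A.α.symm a) (A.α.symm b) := by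
  have h := A.zpow_apply_mul (-1) a b
  rwa [zpow_neg_one] at h

theorem zpow_apply_one (n : ℤ) : (A.α ^ n) A.one = A.one := by
  have h := zpow_conj ((LinearMap.id (R := k) (M := k)).smulRight A.one) (LinearEquiv.refl k k) A.α
    (fun c => by simp [A.map_one]) n 1
  have h2 : ((LinearEquiv.refl k k) ^ n) (1 : k) = 1 := by
    change ((1 : k ≃ₗ[k] k) ^ n) _ = _
    rw [one_zpow]; rfl
  rw [h2] at h
  simpa using h.symm

theorem one_symm : A.α.symm A.one = A.one := by
  rw [LinearEquiv.symm_apply_eq, A.map_one]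

@[simp]
theorem tensorComulAux_tmul (αX : X ≃ₗ[k] X) (x : X) (c d : A.carrier) :
    A.tensorComulAux αX (x ⊗ₜ[k] (c ⊗ₜ[k] d)) = (αX x ⊗ₜ[k] c) ⊗ₜ[k] A.α.symm d := rfl

theorem tensorComul_tmul (αX : X ≃ₗ[k] X) (x : X) (a : A.carrier) :
    A.tensorComul αX (x ⊗ₜ[k] a) = A.tensorComulAux αX (x ⊗ₜ[k] A.comul a) := rfl

/-- Up to reassociation, the comultiplication of `- ⊗ A` is `α_X ⊗ Δ`. -/
theorem assoc_lTensor_tensorComul (αX : X ≃ₗ[k] X) (t : X ⊗[k] A.carrier) :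
    TensorProduct.assoc k X A.carrier A.carrier
      (A.α.toLinearMap.lTensor (X ⊗[k] A.carrier) (A.tensorComul αX t)) =
      TensorProduct.map αX.toLinearMap A.comul t := by
  induction t using TensorProduct.induction_on with
  | zero => simp
  | add c d hc hd => simp only [map_add, hc, hd]
  | tmul x a =>
    rw [tensorComul_tmul, TensorProduct.map_tmul]
    induction A.comul a using TensorProduct.induction_on with
    | zero => simp
    | add c d hc hd => simp only [map_add, TensorProduct.tmul_add, hc, hd]
    | tmul c d => simp

/-- Together with `assoc_lTensor_tensorComul`, this removes the twist `α⁻¹` from the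
comultiplication of `- ⊗ A`. -/
theorem assoc_lTensor_injective (V : Type u) [AddCommGroup V] [Module k V] :
    Function.Injective fun t : (V ⊗[k] A.carrier) ⊗[k] A.carrier =>
      TensorProduct.assoc k V A.carrier A.carrier
        (A.α.toLinearMap.lTensor (V ⊗[k] A.carrier) t) :=
  (TensorProduct.assoc k V A.carrier A.carrier).injective.comp
    (TensorProduct.congr (LinearEquiv.refl k (V ⊗[k] A.carrier)) A.α).injective

theorem tensorComulAux_injective (αX : X ≃ₗ[k] X) : Function.Injective (A.tensorComulAux αX) :=
  (TensorProduct.congr (TensorProduct.congr αX (LinearEquiv.refl k A.carrier))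
    A.α.symm).injective.comp (TensorProduct.assoc k X A.carrier A.carrier).symm.injective

/-- The map `x ⊗ (a ⊗ (b ⊗ c)) ↦ ((x ⊗ a) ⊗ α⁻¹(b)) ⊗ α⁻²(c)`. -/
def tripleEquiv (X : Type u) [AddCommGroup X] [Module k X] :
    X ⊗[k] (A.carrier ⊗[k] (A.carrier ⊗[k] A.carrier)) ≃ₗ[k]
      ((X ⊗[k] A.carrier) ⊗[k] A.carrier) ⊗[k] A.carrier :=
  (TensorProduct.assoc k X A.carrier (A.carrier ⊗[k] A.carrier)).symm ≪≫ₗ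
    (TensorProduct.assoc k (X ⊗[k] A.carrier) A.carrier A.carrier).symm ≪≫ₗ
    TensorProduct.congr (TensorProduct.congr (LinearEquiv.refl k _) A.α.symm)
      (A.α.symm ≪≫ₗ A.α.symm)

@[simp]
theorem tripleEquiv_tmul (x : X) (a b c : A.carrier) :
    A.tripleEquiv X (x ⊗ₜ[k] (a ⊗ₜ[k] (b ⊗ₜ[k] c))) =
      ((x ⊗ₜ[k] a) ⊗ₜ[k] A.α.symm b) ⊗ₜ[k] A.α.symm (A.α.symm c) := rfl

theorem rTensor_tensorComul_tensorComulAux (αX : X ≃ₗ[k] X) (x : X)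
    (s : A.carrier ⊗[k] A.carrier) :
    (A.tensorComul αX).rTensor A.carrier (A.tensorComulAux αX (x ⊗ₜ[k] s)) =
      A.tripleEquiv X (αX (αX x) ⊗ₜ[k] TensorProduct.assoc k A.carrier A.carrier A.carrier
        (TensorProduct.map A.comul A.α.toLinearMap s)) := by
  induction s using TensorProduct.induction_on with
  | zero => simp
  | add c d hc hd => simp only [map_add, TensorProduct.tmul_add, hc, hd]
  | tmul c d =>
    simp only [tensorComulAux_tmul, LinearMap.rTensor_tmul, tensorComul_tmul,
      TensorProduct.map_tmul]
    induction A.comul c using TensorProduct.induction_on with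
    | zero => simp
    | add c d hc hd => simp only [map_add, TensorProduct.tmul_add, TensorProduct.add_tmul, hc, hd]
    | tmul c d => simp

theorem tensorComul_tensorComulAux (αX : X ≃ₗ[k] X) (x : X)
    (s : A.carrier ⊗[k] A.carrier) :
    A.tensorComul (TensorProduct.congr αX A.α) (A.tensorComulAux αX (x ⊗ₜ[k] s)) =
      A.tripleEquiv X (αX (αX x) ⊗ₜ[k] TensorProduct.map A.α.toLinearMap A.comul s) := by
  induction s using TensorProduct.induction_on with
  | zero => simp
  | add c d hc hd => simp only [map_add, TensorProduct.tmul_add, hc, hd]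
  | tmul c d =>
    simp only [tensorComulAux_tmul, tensorComul_tmul, TensorProduct.map_tmul, comul_symm]
    induction A.comul d using TensorProduct.induction_on with
    | zero => simp
    | add c d hc hd => simp only [map_add, TensorProduct.tmul_add, hc, hd]
    | tmul c d => simp

theorem tensorCounit_tensorComulAux (αX : X ≃ₗ[k] X) (x : X) (s : A.carrier ⊗[k] A.carrier) :
    A.tensorCounit (TensorProduct.congr αX A.α) (A.tensorComulAux αX (x ⊗ₜ[k] s)) =
      x ⊗ₜ[k] A.α.symm (TensorProduct.rid k A.carrier (A.counit.lTensor A.carrier s)) := by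
  induction s using TensorProduct.induction_on with
  | zero => simp
  | add c d hc hd => simp only [map_add, TensorProduct.tmul_add, hc, hd]
  | tmul c d => simp [counit_symm]

theorem rTensor_tensorCounit_tensorComulAux (αX : X ≃ₗ[k] X) (x : X)
    (s : A.carrier ⊗[k] A.carrier) :
    (A.tensorCounit αX).rTensor A.carrier (A.tensorComulAux αX (x ⊗ₜ[k] s)) =
      x ⊗ₜ[k] A.α.symm (TensorProduct.lid k A.carrier (A.counit.rTensor A.carrier s)) := by
  induction s using TensorProduct.induction_on with
  | zero => simp
  | add c d hc hd => simp only [map_add, TensorProduct.tmul_add, hc, hd]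
  | tmul c d => simp [TensorProduct.smul_tmul]

variable (i j : ℤ)

/-- For the implication from left to right, evaluate the comonad axioms at the unit object and
cancel the factor `1`. -/
theorem isComonad_tensorFunctor_iff : (A.tensorFunctor i j).IsComonad ↔ A.IsHomCoalgebra := by
  rw [ComonadData.isComonad_iff]
  constructor
  · rintro ⟨h1, h2, h3⟩
    refine ⟨A.counit_map, fun a => ?_, fun a => ?_, fun a => ?_⟩
    · have h : (A.tensorComul (LinearEquiv.refl k k)).rTensor A.carrier
          (A.tensorComul (LinearEquiv.refl k k) (1 ⊗ₜ[k] a)) =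
          A.tensorComul (TensorProduct.congr (LinearEquiv.refl k k) A.α)
            (A.tensorComul (LinearEquiv.refl k k) (1 ⊗ₜ[k] a)) :=
        LinearMap.congr_fun (congrArg HomSpace.Hom.f (h1 (𝟙_ (HomSpace k i j)))) (1 ⊗ₜ[k] a)
      rw [tensorComul_tmul, rTensor_tensorComul_tensorComulAux, tensorComul_tensorComulAux] at h
      exact (tmul_left_injective LinearMap.id rfl ((A.tripleEquiv k).injective h)).symm
    · have h : (A.tensorCounit (LinearEquiv.refl k k)).rTensor A.carrier
          (A.tensorComul (LinearEquiv.refl k k) (1 ⊗ₜ[k] a)) = (1 : k) ⊗ₜ[k] a :=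
        LinearMap.congr_fun (congrArg HomSpace.Hom.f (h3 (𝟙_ (HomSpace k i j)))) (1 ⊗ₜ[k] a)
      rw [tensorComul_tmul, rTensor_tensorCounit_tensorComulAux] at h
      have h4 := tmul_left_injective LinearMap.id rfl h
      rwa [LinearEquiv.symm_apply_eq] at h4
    · have h : A.tensorCounit (TensorProduct.congr (LinearEquiv.refl k k) A.α)
          (A.tensorComul (LinearEquiv.refl k k) (1 ⊗ₜ[k] a)) = (1 : k) ⊗ₜ[k] a :=
        LinearMap.congr_fun (congrArg HomSpace.Hom.f (h2 (𝟙_ (HomSpace k i j)))) (1 ⊗ₜ[k] a)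
      rw [tensorComul_tmul, tensorCounit_tensorComulAux] at h
      have h4 := tmul_left_injective LinearMap.id rfl h
      rwa [LinearEquiv.symm_apply_eq] at h4
  · intro h
    refine ⟨fun X => HomSpace.hom_ext (TensorProduct.ext' fun x a => ?_),
      fun X => HomSpace.hom_ext (TensorProduct.ext' fun x a => ?_),
      fun X => HomSpace.hom_ext (TensorProduct.ext' fun x a => ?_)⟩
    · change (A.tensorComul X.α).rTensor A.carrier (A.tensorComul X.α (x ⊗ₜ[k] a)) =
        A.tensorComul (TensorProduct.congr X.α A.α) (A.tensorComul X.α (x ⊗ₜ[k] a))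
      rw [tensorComul_tmul, rTensor_tensorComul_tensorComulAux, tensorComul_tensorComulAux,
        h.hom_coassoc]
    · change A.tensorCounit (TensorProduct.congr X.α A.α) (A.tensorComul X.α (x ⊗ₜ[k] a)) =
        x ⊗ₜ[k] a
      rw [tensorComul_tmul, tensorCounit_tensorComulAux, h.comul_counit,
        LinearEquiv.symm_apply_apply]
    · change (A.tensorCounit X.α).rTensor A.carrier (A.tensorComul X.α (x ⊗ₜ[k] a)) = x ⊗ₜ[k] a
      rw [tensorComul_tmul, rTensor_tensorCounit_tensorComulAux, h.counit_comul,
        LinearEquiv.symm_apply_apply]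

/-- The structure maps of `- ⊗ A` form a monoidal functor when `A` is a Hom-algebra: with the
associativity constraint of the category, its associativity is Hom-associativity. -/
theorem isMonoidalFunctor_tensorFunctor (h : A.IsHomAlgebra) :
    (A.tensorFunctor i j).IsMonoidalFunctor := by
  refine ⟨{ ε := (A.tensorFunctor i j).η, μ := (A.tensorFunctor i j).μ
            μ_natural_left := fun {X Y} f Z => ?_
            μ_natural_right := fun {X Y} Z f => ?_
            associativity := fun X Y Z => ?_
            left_unitality := fun X => ?_
            right_unitality := fun X => ?_ }, rfl, fun _ _ => rfl⟩
  · exact HomSpace.hom_ext (TensorProduct.ext_fourfold' fun x a z b => rfl)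
  · exact HomSpace.hom_ext (TensorProduct.ext_fourfold' fun x a z b => rfl)
  · refine HomSpace.hom_ext (TensorProduct.ext (TensorProduct.ext_fourfold' fun x a y b =>
      TensorProduct.ext' fun z c => ?_))
    change ((X.α ^ (i + 1)) x ⊗ₜ[k] (y ⊗ₜ[k] (Z.α ^ (-j - 1)) z)) ⊗ₜ[k]
        A.mul ((A.α ^ i) (A.mul ((A.α ^ i) a) ((A.α ^ j) b))) ((A.α ^ j) c) =
      A.tensorator i j X.carrier (Y.carrier ⊗[k] Z.carrier)
        ((A.tensorator i j Y.carrier Z.carrier).lTensor (X.carrier ⊗[k] A.carrier)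
          ((TensorProduct.congr X.α A.α ^ (i + 1)) (x ⊗ₜ[k] a) ⊗ₜ[k] ((y ⊗ₜ[k] b) ⊗ₜ[k]
            (TensorProduct.congr Z.α A.α ^ (-j - 1)) (z ⊗ₜ[k] c))))
    rw [TensorProduct.congr_zpow, TensorProduct.congr_zpow, TensorProduct.congr_tmul,
      TensorProduct.congr_tmul, LinearMap.lTensor_tmul, tensorator_tmul, tensorator_tmul]
    -- Hom-associativity for the elements `α^(2i) a`, `α^(i+j) b` and `α^(j-1) c`.
    have h1 := h.hom_assoc ((A.α ^ i) ((A.α ^ i) a)) ((A.α ^ i) ((A.α ^ j) b))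
      ((A.α ^ (j - 1)) c)
    have e1 : A.α ((A.α ^ (j - 1)) c) = (A.α ^ j) c := by
      rw [← zpow_comm, ← LinearEquiv.mul_apply, ← zpow_add_one, sub_add_cancel]
    have e2 : (A.α ^ i) ((A.α ^ (i + 1)) a) = A.α ((A.α ^ i) ((A.α ^ i) a)) := by
      rw [zpow_add_one, LinearEquiv.mul_apply, zpow_comm, zpow_comm]
    have e3 : (A.α ^ j) ((A.α ^ j) ((A.α ^ (-j - 1)) c)) = (A.α ^ (j - 1)) c := by
      rw [zpow_apply_zpow, zpow_apply_zpow]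
      congr 2; ring
    rw [e1] at h1
    rw [zpow_apply_mul, zpow_apply_mul, e2, e3, ← h1, zpow_apply_zpow _ i j,
      zpow_apply_zpow _ j i, add_comm j i]
  · refine HomSpace.hom_ext (TensorProduct.ext (LinearMap.ext_ring
      (TensorProduct.ext' fun x a => ?_)))
    change (TensorProduct.congr X.α A.α ^ (j + 1)) ((1 : k) • (x ⊗ₜ[k] a)) =
      (X.α ^ (j + 1)) ((1 : k) • x) ⊗ₜ[k] A.mul ((A.α ^ i) A.one) ((A.α ^ j) a)
    rw [TensorProduct.congr_zpow, one_smul, one_smul, TensorProduct.congr_tmul, zpow_apply_one,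
      h.one_mul, add_comm j 1, zpow_one_add (A.α), LinearEquiv.mul_apply]
  · refine HomSpace.hom_ext (TensorProduct.ext
      (TensorProduct.ext' fun x a => LinearMap.ext_ring ?_))
    change (TensorProduct.congr X.α A.α ^ (i + 1)) ((1 : k) • (x ⊗ₜ[k] a)) =
      (X.α ^ (i + 1)) ((1 : k) • x) ⊗ₜ[k] A.mul ((A.α ^ i) a) ((A.α ^ j) A.one)
    rw [TensorProduct.congr_zpow, one_smul, one_smul, TensorProduct.congr_tmul, zpow_apply_one,
      h.mul_one, add_comm i 1, zpow_one_add (A.α), LinearEquiv.mul_apply]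

/-- The tensorator and the comultiplication of `- ⊗ A`, on tensors with prescribed coproducts. -/
theorem tensorator_tensorComulAux (αX : X ≃ₗ[k] X) (αY : Y ≃ₗ[k] Y) (x : X) (y : Y)
    (s t : A.carrier ⊗[k] A.carrier) :
    (A.tensorator i j X Y).rTensor A.carrier
      (A.tensorator i j (X ⊗[k] A.carrier) (Y ⊗[k] A.carrier)
        (A.tensorComulAux αX (x ⊗ₜ[k] s) ⊗ₜ[k] A.tensorComulAux αY (y ⊗ₜ[k] t))) =
      A.tensorComulAux (TensorProduct.congr αX αY) ((x ⊗ₜ[k] y) ⊗ₜ[k]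
        TensorProduct.map₂ A.mul A.mul (TensorProduct.congr (A.α ^ i) (A.α ^ i) s)
          (TensorProduct.congr (A.α ^ j) (A.α ^ j) t)) := by
  induction s using TensorProduct.induction_on with
  | zero => simp
  | add c d hc hd =>
    simp only [map_add, TensorProduct.tmul_add, TensorProduct.add_tmul, LinearMap.add_apply, hc, hd]
  | tmul c d =>
    induction t using TensorProduct.induction_on with
    | zero => simp
    | add c d hc hd => simp only [map_add, TensorProduct.tmul_add, hc, hd]
    | tmul e f =>
      have h1 : ∀ (n : ℤ) (a : A.carrier), (A.α ^ n) (A.α.symm a) = A.α.symm ((A.α ^ n) a) := by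
        intro n a
        rw [LinearEquiv.eq_symm_apply, ← zpow_comm, LinearEquiv.apply_symm_apply]
      simp [mul_symm, h1]

/-- The bicomonad axioms at the unit object are the multiplicativity of `Δ` and `ε`, on elements
twisted by powers of `α`. -/
theorem isHomBialgebra_of_isBicomonad (hA : A.IsHomAlgebra)
    (h : (A.tensorFunctor i j).IsBicomonad) : A.IsHomBialgebra := by
  refine ⟨hA, (A.isComonad_tensorFunctor_iff i j).1 h.isComonad, fun a b => ?_, ?_, fun a b => ?_,
    ?_⟩
  · have h1 : (A.tensorator i j k k).rTensor A.carrier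
        (A.tensorator i j (k ⊗[k] A.carrier) (k ⊗[k] A.carrier)
          (A.tensorComulAux (LinearEquiv.refl k k) (1 ⊗ₜ[k] A.comul ((A.α ^ (-i)) a)) ⊗ₜ[k]
            A.tensorComulAux (LinearEquiv.refl k k) (1 ⊗ₜ[k] A.comul ((A.α ^ (-j)) b)))) =
        A.tensorComulAux (TensorProduct.congr (LinearEquiv.refl k k) (LinearEquiv.refl k k))
          (((1 : k) ⊗ₜ[k] (1 : k)) ⊗ₜ[k]
          A.comul (A.mul ((A.α ^ i) ((A.α ^ (-i)) a)) ((A.α ^ j) ((A.α ^ (-j)) b)))) :=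
      LinearMap.congr_fun (congrArg HomSpace.Hom.f
        (h.C1 (𝟙_ (HomSpace k i j)) (𝟙_ (HomSpace k i j))))
          ((1 ⊗ₜ[k] (A.α ^ (-i)) a) ⊗ₜ[k] (1 ⊗ₜ[k] (A.α ^ (-j)) b))
    rw [tensorator_tensorComulAux, ← comul_zpow, ← comul_zpow, zpow_apply_zpow, zpow_apply_zpow,
      add_neg_cancel, add_neg_cancel] at h1
    exact (tmul_left_injective (TensorProduct.lid k k).toLinearMap (by simp)
      (A.tensorComulAux_injective _ h1)).symm
  · have h1 : ((1 : k) ⊗ₜ[k] A.one) ⊗ₜ[k] A.one =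
        A.tensorComulAux (LinearEquiv.refl k k) ((1 : k) ⊗ₜ[k] A.comul A.one) :=
      LinearMap.congr_fun (congrArg HomSpace.Hom.f h.C3) (1 : k)
    have h2 : ((1 : k) ⊗ₜ[k] A.one) ⊗ₜ[k] A.one =
        A.tensorComulAux (LinearEquiv.refl k k) ((1 : k) ⊗ₜ[k] (A.one ⊗ₜ[k] A.one)) := by
      rw [tensorComulAux_tmul, one_symm]; rfl
    exact tmul_left_injective LinearMap.id rfl (A.tensorComulAux_injective _ (h1.symm.trans h2))
  · have h1 : A.tensorCounit (TensorProduct.congr (LinearEquiv.refl k k) (LinearEquiv.refl k k))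
        (((1 : k) ⊗ₜ[k] (1 : k)) ⊗ₜ[k]
          A.mul ((A.α ^ i) ((A.α ^ (-i)) a)) ((A.α ^ j) ((A.α ^ (-j)) b))) =
        A.tensorCounit (LinearEquiv.refl k k) (1 ⊗ₜ[k] (A.α ^ (-i)) a) ⊗ₜ[k]
          A.tensorCounit (LinearEquiv.refl k k) (1 ⊗ₜ[k] (A.α ^ (-j)) b) :=
      LinearMap.congr_fun (congrArg HomSpace.Hom.f
        (h.C2 (𝟙_ (HomSpace k i j)) (𝟙_ (HomSpace k i j))))
          ((1 ⊗ₜ[k] (A.α ^ (-i)) a) ⊗ₜ[k] (1 ⊗ₜ[k] (A.α ^ (-j)) b))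
    rw [zpow_apply_zpow, zpow_apply_zpow, add_neg_cancel, add_neg_cancel,
      tensorCounit_tmul, tensorCounit_tmul, tensorCounit_tmul, counit_zpow, counit_zpow] at h1
    simpa using congrArg (TensorProduct.lid k k) h1
  · have h1 : A.tensorCounit (LinearEquiv.refl k k) ((1 : k) ⊗ₜ[k] A.one) = 1 :=
      LinearMap.congr_fun (congrArg HomSpace.Hom.f h.C4) (1 : k)
    simpa using h1

theorem isBicomonad_tensorFunctor (h : A.IsHomBialgebra) : (A.tensorFunctor i j).IsBicomonad := by
  refine ⟨(A.isComonad_tensorFunctor_iff i j).2 h.isHomCoalgebra,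
    A.isMonoidalFunctor_tensorFunctor i j h.isHomAlgebra,
    fun X Y => HomSpace.hom_ext (TensorProduct.ext_fourfold' fun x a y b => ?_),
    fun X Y => HomSpace.hom_ext (TensorProduct.ext_fourfold' fun x a y b => ?_),
    HomSpace.hom_ext (LinearMap.ext_ring ?_), HomSpace.hom_ext (LinearMap.ext_ring ?_)⟩
  · change (A.tensorator i j X.carrier Y.carrier).rTensor A.carrier
        (A.tensorator i j (X.carrier ⊗[k] A.carrier) (Y.carrier ⊗[k] A.carrier)
          (A.tensorComulAux X.α (x ⊗ₜ[k] A.comul a) ⊗ₜ[k]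
            A.tensorComulAux Y.α (y ⊗ₜ[k] A.comul b))) =
        A.tensorComulAux (TensorProduct.congr X.α Y.α)
          ((x ⊗ₜ[k] y) ⊗ₜ[k] A.comul (A.mul ((A.α ^ i) a) ((A.α ^ j) b)))
    rw [tensorator_tensorComulAux, h.comul_mul, comul_zpow, comul_zpow]
  · change A.tensorCounit (TensorProduct.congr X.α Y.α) ((x ⊗ₜ[k] y) ⊗ₜ[k]
        A.mul ((A.α ^ i) a) ((A.α ^ j) b)) =
      A.tensorCounit X.α (x ⊗ₜ[k] a) ⊗ₜ[k] A.tensorCounit Y.α (y ⊗ₜ[k] b)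
    simp only [tensorCounit_tmul, h.counit_mul, counit_zpow, TensorProduct.congr_symm_tmul]
    rw [mul_smul, TensorProduct.tmul_smul, ← TensorProduct.smul_tmul', smul_comm]
  · change ((1 : k) ⊗ₜ[k] A.one) ⊗ₜ[k] A.one =
        A.tensorComulAux (LinearEquiv.refl k k) ((1 : k) ⊗ₜ[k] A.comul A.one)
    rw [h.comul_one, tensorComulAux_tmul, one_symm]; rfl
  · change A.tensorCounit (LinearEquiv.refl k k) ((1 : k) ⊗ₜ[k] A.one) = 1
    simp [h.counit_one]

/-- The coaction of a Hom-comodule commutes with the structure automorphisms: apply the counit to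
the last factor of the Hom-coassociativity law. -/
theorem coaction_comm (hA : A.IsHomCoalgebra) {α : X ≃ₗ[k] X} {ρ : X →ₗ[k] X ⊗[k] A.carrier}
    (h : IsHomComodule A α ρ) :
    ρ ∘ₗ α.toLinearMap = (TensorProduct.congr α A.α).toLinearMap ∘ₗ ρ := by
  refine LinearMap.ext fun m => ?_
  let p : X ⊗[k] (A.carrier ⊗[k] A.carrier) →ₗ[k] X ⊗[k] A.carrier :=
    ((TensorProduct.rid k A.carrier).toLinearMap ∘ₗ A.counit.lTensor A.carrier).lTensor X
  have h1 := congrArg p (h.hom_coassoc m)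
  have e1 : ∀ t : X ⊗[k] A.carrier, p (TensorProduct.map α.toLinearMap A.comul t) =
      TensorProduct.congr α A.α t := by
    intro t
    induction t using TensorProduct.induction_on with
    | zero => simp
    | add c d hc hd => simp only [map_add, hc, hd]
    | tmul x a => simp [p, hA.comul_counit]
  have e2 : ∀ t : X ⊗[k] A.carrier, p (TensorProduct.assoc k X A.carrier A.carrier
      (TensorProduct.map ρ A.α.toLinearMap t)) =
      ρ (TensorProduct.rid k X (A.counit.lTensor X t)) := by
    intro t
    induction t using TensorProduct.induction_on with
    | zero => simp
    | add c d hc hd => simp only [map_add, hc, hd]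
    | tmul x a =>
      simp only [TensorProduct.map_tmul, LinearMap.lTensor_tmul, TensorProduct.rid_tmul, map_smul]
      induction ρ x using TensorProduct.induction_on with
      | zero => simp
      | add c d hc hd =>
        simp only [map_add, TensorProduct.add_tmul, smul_add, hc, hd]
      | tmul x b => simp [p, A.counit_map]
  rw [e1, e2, h.counit] at h1
  exact h1.symm

/-- Hom-comodules are the comodules over the comonad `- ⊗ A`. -/
theorem isComodule_tensorFunctor_iff {X : HomSpace k i j}
    (ρ : X.carrier →ₗ[k] X.carrier ⊗[k] A.carrier)
    (hρ : ρ ∘ₗ X.α.toLinearMap = (TensorProduct.congr X.α A.α).toLinearMap ∘ₗ ρ) :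
    (A.tensorFunctor i j).IsComodule (X := X) (HomSpace.mkHom ρ hρ) ↔
      IsHomComodule A X.α ρ := by
  have e1 : ∀ t : X.carrier ⊗[k] A.carrier, TensorProduct.assoc k X.carrier A.carrier A.carrier
      (A.α.toLinearMap.lTensor (X.carrier ⊗[k] A.carrier) (ρ.rTensor A.carrier t)) =
      TensorProduct.assoc k X.carrier A.carrier A.carrier
        (TensorProduct.map ρ A.α.toLinearMap t) := fun t => by
    rw [← LinearMap.comp_apply (f := LinearMap.lTensor _ _), LinearMap.lTensor_comp_rTensor]
  have e2 : ∀ t : X.carrier ⊗[k] A.carrier, A.tensorCounit X.α t =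
      X.α.symm (TensorProduct.rid k X.carrier (A.counit.lTensor X.carrier t)) := fun _ => rfl
  constructor
  · rintro ⟨h1, h2⟩
    refine ⟨fun m => ?_, fun m => ?_⟩
    · have h : ρ.rTensor A.carrier (ρ m) = A.tensorComul X.α (ρ m) :=
        LinearMap.congr_fun (congrArg HomSpace.Hom.f h1) m
      rw [← assoc_lTensor_tensorComul, ← h, e1]
    · have h : A.tensorCounit X.α (ρ m) = m :=
        LinearMap.congr_fun (congrArg HomSpace.Hom.f h2) m
      rwa [e2, LinearEquiv.symm_apply_eq] at h
  · rintro ⟨h1, h2⟩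
    refine ⟨HomSpace.hom_ext (LinearMap.ext fun m => A.assoc_lTensor_injective X.carrier ?_),
      HomSpace.hom_ext (LinearMap.ext fun m => ?_)⟩
    · exact (e1 _).trans ((h1 m).symm.trans (A.assoc_lTensor_tensorComul X.α _).symm)
    · exact (e2 _).trans ((LinearEquiv.symm_apply_eq _).2 (h2 m))

end HomBialgebraData

end TensorFunctor

/-! ### The distributive law of a Hom-cotwistor -/

section TwistedLaw

open HomBialgebraData

variable {k : Type u} [Field k] (B H : HomBialgebraData k)
  (φ : B.carrier ⊗[k] H.carrier →ₗ[k] H.carrier ⊗[k] B.carrier)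
  {X Y : Type u} [AddCommGroup X] [Module k X] [AddCommGroup Y] [Module k Y]

variable {B H φ} in
theorem IsCompatible.apply_tmul (hφ : IsCompatible B H φ) (b : B.carrier) (h : H.carrier) :
    φ (B.α b ⊗ₜ[k] H.α h) = TensorProduct.congr H.α B.α (φ (b ⊗ₜ[k] h)) :=
  LinearMap.congr_fun hφ (b ⊗ₜ[k] h)

theorem zpow_symm {M : Type*} [AddCommGroup M] [Module k M] (a : M ≃ₗ[k] M) (n : ℤ) (x : M) :
    (a ^ n) (a.symm x) = a.symm ((a ^ n) x) := by
  rw [LinearEquiv.eq_symm_apply, ← zpow_comm, LinearEquiv.apply_symm_apply]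

theorem twistedLawMap_tmul (n : ℤ) (x : X) (b : B.carrier) (h : H.carrier) :
    twistedLawMap B H φ n X ((x ⊗ₜ[k] b) ⊗ₜ[k] h) =
      (TensorProduct.assoc k X H.carrier B.carrier).symm
        (x ⊗ₜ[k] (B.α ^ n).toLinearMap.lTensor H.carrier
          (φ ((B.α ^ (-n - 1)) b ⊗ₜ[k] H.α h))) := rfl

/-- The element `∑ (h^φ)^ψ ⊗ (c^ψ ⊗ d^φ)`, for `s = c ⊗ d`; superscripts `φ`, `ψ` stand for two
applications of `φ`. With `s = Δ(b)`, and `α(h)` in place of `h`, it is the left-hand side of the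
first condition on a Hom-cotwistor. -/
def cotwistLeft (s : B.carrier ⊗[k] B.carrier) (h : H.carrier) :
    H.carrier ⊗[k] (B.carrier ⊗[k] B.carrier) :=
  TensorProduct.assoc k H.carrier B.carrier B.carrier (φ.rTensor B.carrier
    ((TensorProduct.assoc k B.carrier H.carrier B.carrier).symm (φ.lTensor B.carrier
      (TensorProduct.assoc k B.carrier B.carrier H.carrier (s ⊗ₜ[k] h)))))

/-- The element `∑ g^φ ⊗ (h^ψ ⊗ (b^φ)^ψ)`, for `t = g ⊗ h`; superscripts `φ`, `ψ` stand for two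
applications of `φ`. With `t = Δ(h)`, and `α(b)` in place of `b`, it is the left-hand side of the
second condition on a Hom-cotwistor. -/
def cotwistRight (b : B.carrier) (t : H.carrier ⊗[k] H.carrier) :
    H.carrier ⊗[k] (H.carrier ⊗[k] B.carrier) :=
  φ.lTensor H.carrier (TensorProduct.assoc k H.carrier B.carrier H.carrier
    (φ.rTensor H.carrier ((TensorProduct.assoc k B.carrier H.carrier H.carrier).symm (b ⊗ₜ[k] t))))

/-- The map `x ⊗ (g ⊗ (c ⊗ d)) ↦ ((x ⊗ g) ⊗ α^n(c)) ⊗ α^(n-1)(d)`. -/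
def leftLawEquiv (n : ℤ) (X : Type u) [AddCommGroup X] [Module k X] :
    X ⊗[k] (H.carrier ⊗[k] (B.carrier ⊗[k] B.carrier)) ≃ₗ[k]
      ((X ⊗[k] H.carrier) ⊗[k] B.carrier) ⊗[k] B.carrier :=
  (TensorProduct.assoc k X H.carrier (B.carrier ⊗[k] B.carrier)).symm ≪≫ₗ
    (TensorProduct.assoc k (X ⊗[k] H.carrier) B.carrier B.carrier).symm ≪≫ₗ
    TensorProduct.congr (TensorProduct.congr (LinearEquiv.refl k _) (B.α ^ n))
      ((B.α ^ n) ≪≫ₗ B.α.symm)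

@[simp]
theorem leftLawEquiv_tmul (n : ℤ) (x : X) (g : H.carrier) (c d : B.carrier) :
    leftLawEquiv B H n X (x ⊗ₜ[k] (g ⊗ₜ[k] (c ⊗ₜ[k] d))) =
      ((x ⊗ₜ[k] g) ⊗ₜ[k] (B.α ^ n) c) ⊗ₜ[k] B.α.symm ((B.α ^ n) d) := rfl

/-- The map `x ⊗ (g ⊗ (h ⊗ c)) ↦ ((x ⊗ g) ⊗ α⁻¹(h)) ⊗ α^(n-1)(c)`. -/
def rightLawEquiv (n : ℤ) (X : Type u) [AddCommGroup X] [Module k X] :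
    X ⊗[k] (H.carrier ⊗[k] (H.carrier ⊗[k] B.carrier)) ≃ₗ[k]
      ((X ⊗[k] H.carrier) ⊗[k] H.carrier) ⊗[k] B.carrier :=
  (TensorProduct.assoc k X H.carrier (H.carrier ⊗[k] B.carrier)).symm ≪≫ₗ
    (TensorProduct.assoc k (X ⊗[k] H.carrier) H.carrier B.carrier).symm ≪≫ₗ
    TensorProduct.congr (TensorProduct.congr (LinearEquiv.refl k _) H.α.symm)
      ((B.α ^ n) ≪≫ₗ B.α.symm)

@[simp]
theorem rightLawEquiv_tmul (n : ℤ) (x : X) (g h : H.carrier) (c : B.carrier) :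
    rightLawEquiv B H n X (x ⊗ₜ[k] (g ⊗ₜ[k] (h ⊗ₜ[k] c))) =
      ((x ⊗ₜ[k] g) ⊗ₜ[k] H.α.symm h) ⊗ₜ[k] B.α.symm ((B.α ^ n) c) := rfl

/-- One side of the compatibility with the comultiplication of `- ⊗ B`. Both sides are images of the
same injective map `leftLawEquiv`, which reduces the law to the first condition on a
Hom-cotwistor. -/
theorem map_comulAt_lawAt_lawAt_apply (hφ : IsCompatible B H φ) (n : ℤ) (αX : X ≃ₗ[k] X) (x : X)
    (s : B.carrier ⊗[k] B.carrier) (h : H.carrier) :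
    (twistedLawMap B H φ n X).rTensor B.carrier (twistedLawMap B H φ n (X ⊗[k] B.carrier)
      (B.tensorComulAux αX (x ⊗ₜ[k] s) ⊗ₜ[k] h)) =
    leftLawEquiv B H n X (αX x ⊗ₜ[k] cotwistLeft B H φ
      (TensorProduct.congr (B.α ^ (-n - 1)) (B.α ^ (-n - 1)) s) (H.α (H.α h))) := by
  induction s using TensorProduct.induction_on with
  | zero => simp [cotwistLeft]
  | add c d hc hd =>
    simp only [map_add, TensorProduct.tmul_add, TensorProduct.add_tmul, cotwistLeft] at hc hd ⊢
    rw [hc, hd]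
  | tmul c d =>
    have e : φ ((B.α ^ (-n - 1)) d ⊗ₜ[k] H.α (H.α h)) = TensorProduct.congr H.α B.α
        (φ ((B.α ^ (-n - 1)) (B.α.symm d) ⊗ₜ[k] H.α h)) := by
      rw [← hφ.apply_tmul, ← zpow_comm, LinearEquiv.apply_symm_apply]
    simp only [tensorComulAux_tmul, twistedLawMap_tmul, cotwistLeft, TensorProduct.congr_tmul,
      TensorProduct.assoc_tmul, LinearMap.lTensor_tmul, e]
    induction φ ((B.α ^ (-n - 1)) (B.α.symm d) ⊗ₜ[k] H.α h) using TensorProduct.induction_on with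
    | zero => simp
    | add u v hu hv => simp only [map_add, TensorProduct.tmul_add, hu, hv]
    | tmul g e =>
      simp only [LinearMap.lTensor_tmul, TensorProduct.assoc_symm_tmul, LinearMap.rTensor_tmul,
        twistedLawMap_tmul, TensorProduct.congr_tmul]
      induction φ ((B.α ^ (-n - 1)) c ⊗ₜ[k] H.α g) using TensorProduct.induction_on with
      | zero => simp
      | add u v hu hv => simp only [map_add, TensorProduct.tmul_add, TensorProduct.add_tmul, hu, hv]
      | tmul p q => simp [zpow_comm]

theorem lawAt_comulAt_apply (n : ℤ) (αX : X ≃ₗ[k] X) (x : X) (b : B.carrier) (h : H.carrier) :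
    B.tensorComul (TensorProduct.congr αX H.α) (twistedLawMap B H φ n X
      ((x ⊗ₜ[k] b) ⊗ₜ[k] h)) =
    leftLawEquiv B H n X (αX x ⊗ₜ[k] TensorProduct.map H.α.toLinearMap B.comul
      (φ ((B.α ^ (-n - 1)) b ⊗ₜ[k] H.α h))) := by
  rw [twistedLawMap_tmul]
  induction φ ((B.α ^ (-n - 1)) b ⊗ₜ[k] H.α h) using TensorProduct.induction_on with
  | zero => simp
  | add u v hu hv => simp only [map_add, TensorProduct.tmul_add, hu, hv]
  | tmul g c =>
    simp only [LinearMap.lTensor_tmul, TensorProduct.assoc_symm_tmul, LinearEquiv.coe_coe,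
      tensorComul_tmul, comul_zpow, TensorProduct.map_tmul]
    induction B.comul c using TensorProduct.induction_on with
    | zero => simp
    | add u v hu hv => simp only [map_add, TensorProduct.tmul_add, hu, hv]
    | tmul p q => simp

/-- One side of the compatibility with the comultiplication of `- ⊗ H`; as before, both sides are
images of the same injective map `rightLawEquiv`. -/
theorem comulAt_map_lawAt_lawAt_apply (hφ : IsCompatible B H φ) (n : ℤ) (αX : X ≃ₗ[k] X) (x : X)
    (b : B.carrier) (t : H.carrier ⊗[k] H.carrier) :
    twistedLawMap B H φ n (X ⊗[k] H.carrier) ((twistedLawMap B H φ n X).rTensor H.carrier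
      (H.tensorComulAux (TensorProduct.congr αX B.α) ((x ⊗ₜ[k] b) ⊗ₜ[k] t))) =
    rightLawEquiv B H n X (αX x ⊗ₜ[k] cotwistRight B H φ (B.α ((B.α ^ (-n - 1)) b))
      (TensorProduct.congr H.α H.α t)) := by
  induction t using TensorProduct.induction_on with
  | zero => simp [cotwistRight]
  | add c d hc hd =>
    simp only [map_add, TensorProduct.tmul_add, cotwistRight] at hc hd ⊢
    rw [hc, hd]
  | tmul c d =>
    simp only [tensorComulAux_tmul, cotwistRight, TensorProduct.congr_tmul,
      TensorProduct.assoc_symm_tmul, LinearMap.rTensor_tmul, twistedLawMap_tmul, zpow_comm]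
    induction φ (B.α ((B.α ^ (-n - 1)) b) ⊗ₜ[k] H.α c) using TensorProduct.induction_on with
    | zero => simp
    | add u v hu hv => simp only [map_add, TensorProduct.tmul_add, TensorProduct.add_tmul, hu, hv]
    | tmul g e =>
      have h1 : (B.α ^ (-n - 1)) ((B.α ^ n) e) = B.α.symm e := by
        rw [zpow_apply_zpow, show -n - 1 + n = -1 by ring, zpow_neg_one]; rfl
      have h2 : φ (e ⊗ₜ[k] H.α d) = TensorProduct.congr H.α B.α (φ (B.α.symm e ⊗ₜ[k] d)) := by
        rw [← hφ.apply_tmul, LinearEquiv.apply_symm_apply]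
      simp only [LinearMap.lTensor_tmul, TensorProduct.assoc_symm_tmul, LinearEquiv.coe_coe,
        twistedLawMap_tmul, TensorProduct.assoc_tmul, h1, h2, LinearEquiv.apply_symm_apply]
      induction φ (B.α.symm e ⊗ₜ[k] d) using TensorProduct.induction_on with
      | zero => simp
      | add u v hu hv => simp only [map_add, TensorProduct.tmul_add, hu, hv]
      | tmul p q => simp [zpow_comm]

theorem lawAt_map_comulAt_apply (n : ℤ) (αX : X ≃ₗ[k] X) (x : X) (b : B.carrier)
    (h : H.carrier) :
    (H.tensorComul αX).rTensor B.carrier (twistedLawMap B H φ n X ((x ⊗ₜ[k] b) ⊗ₜ[k] h)) =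
    rightLawEquiv B H n X (αX x ⊗ₜ[k] TensorProduct.assoc k H.carrier H.carrier B.carrier
      (TensorProduct.map H.comul B.α.toLinearMap (φ ((B.α ^ (-n - 1)) b ⊗ₜ[k] H.α h)))) := by
  rw [twistedLawMap_tmul]
  induction φ ((B.α ^ (-n - 1)) b ⊗ₜ[k] H.α h) using TensorProduct.induction_on with
  | zero => simp
  | add u v hu hv => simp only [map_add, TensorProduct.tmul_add, hu, hv]
  | tmul g c =>
    simp only [LinearMap.lTensor_tmul, TensorProduct.assoc_symm_tmul, LinearEquiv.coe_coe,
      LinearMap.rTensor_tmul, tensorComul_tmul, TensorProduct.map_tmul]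
    induction H.comul g using TensorProduct.induction_on with
    | zero => simp
    | add u v hu hv => simp only [map_add, TensorProduct.tmul_add, TensorProduct.add_tmul, hu, hv]
    | tmul p q => simp [zpow_comm]

theorem lawAt_counitAt_left_apply (n : ℤ) (αX : X ≃ₗ[k] X) (x : X) (b : B.carrier)
    (h : H.carrier) :
    (H.tensorCounit αX).rTensor B.carrier (twistedLawMap B H φ n X ((x ⊗ₜ[k] b) ⊗ₜ[k] h)) =
      αX.symm x ⊗ₜ[k] (B.α ^ n) (TensorProduct.lid k B.carrier (H.counit.rTensor B.carrier
        (φ ((B.α ^ (-n - 1)) b ⊗ₜ[k] H.α h)))) := by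
  rw [twistedLawMap_tmul]
  induction φ ((B.α ^ (-n - 1)) b ⊗ₜ[k] H.α h) using TensorProduct.induction_on with
  | zero => simp
  | add u v hu hv => simp only [map_add, TensorProduct.tmul_add, hu, hv]
  | tmul g c => simp [TensorProduct.smul_tmul]

theorem lawAt_counitAt_right_apply (n : ℤ) (αX : X ≃ₗ[k] X) (x : X) (b : B.carrier)
    (h : H.carrier) :
    B.tensorCounit (TensorProduct.congr αX H.α) (twistedLawMap B H φ n X
      ((x ⊗ₜ[k] b) ⊗ₜ[k] h)) =
      αX.symm x ⊗ₜ[k] H.α.symm (TensorProduct.rid k H.carrier (B.counit.lTensor H.carrier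
        (φ ((B.α ^ (-n - 1)) b ⊗ₜ[k] H.α h)))) := by
  rw [twistedLawMap_tmul]
  induction φ ((B.α ^ (-n - 1)) b ⊗ₜ[k] H.α h) using TensorProduct.induction_on with
  | zero => simp
  | add u v hu hv => simp only [map_add, TensorProduct.tmul_add, hu, hv]
  | tmul g c => simp [counit_zpow]

variable (i j : ℤ)

/-- On `(x ⊗ b) ⊗ h`, the distributive laws amount to the conditions on a Hom-cotwistor at the pair
`(α^(-n-1)(b), α(h))`, up to injective maps. To recover the conditions, the laws are evaluated at
the unit object. -/
theorem isDistributiveLaw_twistedLaw_iff (hφ : IsCompatible B H φ) (n : ℤ) :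
    IsDistributiveLaw (H.tensorFunctor i j).toComonadData (B.tensorFunctor i j).toComonadData
      (twistedLaw i j B H φ hφ n) ↔ IsHomCotwistor B H φ := by
  have eB : ∀ b : B.carrier, (B.α ^ (-n - 1)) ((B.α ^ (n + 1)) b) = b := fun b => by
    rw [zpow_apply_zpow, show -n - 1 + (n + 1) = 0 by ring, zpow_zero]
    rfl
  constructor
  · intro hL
    have M1 : ∀ b h, cotwistLeft B H φ (B.comul b) (H.α h) =
        TensorProduct.map H.α.toLinearMap B.comul (φ (b ⊗ₜ[k] h)) := by
      intro b h
      have h1 := (map_comulAt_lawAt_lawAt_apply B H φ hφ n (LinearEquiv.refl k k) 1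
        (B.comul ((B.α ^ (n + 1)) b)) (H.α.symm h)).symm.trans
        ((LinearMap.congr_fun (congrArg HomSpace.Hom.f (hL.L1 (𝟙_ (HomSpace k i j))))
        ((1 ⊗ₜ[k] (B.α ^ (n + 1)) b) ⊗ₜ[k] H.α.symm h)).trans
        (lawAt_comulAt_apply B H φ n (LinearEquiv.refl k k) 1 _ _))
      have h2 := tmul_left_injective LinearMap.id rfl ((leftLawEquiv B H n k).injective h1)
      rwa [← comul_zpow, eB, LinearEquiv.apply_symm_apply] at h2
    have M2 : ∀ b h, cotwistRight B H φ (B.α b) (H.comul h) =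
        TensorProduct.assoc k H.carrier H.carrier B.carrier
          (TensorProduct.map H.comul B.α.toLinearMap (φ (b ⊗ₜ[k] h))) := by
      intro b h
      have h1 := (comulAt_map_lawAt_lawAt_apply B H φ hφ n (LinearEquiv.refl k k) 1
        ((B.α ^ (n + 1)) b) (H.comul (H.α.symm h))).symm.trans
        ((LinearMap.congr_fun (congrArg HomSpace.Hom.f (hL.L2 (𝟙_ (HomSpace k i j))))
        ((1 ⊗ₜ[k] (B.α ^ (n + 1)) b) ⊗ₜ[k] H.α.symm h)).trans
        (lawAt_map_comulAt_apply B H φ n (LinearEquiv.refl k k) 1 _ _))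
      have h2 := tmul_left_injective LinearMap.id rfl ((rightLawEquiv B H n k).injective h1)
      rwa [← comul_map, eB, LinearEquiv.apply_symm_apply] at h2
    refine ⟨hφ, M1, M2, fun b h => ?_, fun b h => ?_⟩
    · have h1 : (1 : k) ⊗ₜ[k] _ = H.tensorCounit (TensorProduct.congr (LinearEquiv.refl k k) B.α)
          (((1 : k) ⊗ₜ[k] (B.α ^ (n + 1)) b) ⊗ₜ[k] H.α.symm h) :=
        (lawAt_counitAt_left_apply B H φ n (LinearEquiv.refl k k) 1
          ((B.α ^ (n + 1)) b) (H.α.symm h)).symm.trans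
        (LinearMap.congr_fun (congrArg HomSpace.Hom.f (hL.L3 (𝟙_ (HomSpace k i j))))
        ((1 ⊗ₜ[k] (B.α ^ (n + 1)) b) ⊗ₜ[k] H.α.symm h))
      rw [tensorCounit_tmul, counit_symm, TensorProduct.congr_symm_tmul, ← TensorProduct.tmul_smul,
        eB, LinearEquiv.apply_symm_apply] at h1
      have h2 := tmul_left_injective LinearMap.id rfl h1
      apply (B.α ^ n).injective
      rw [h2, map_smul, ← zpow_symm, zpow_add_one, LinearEquiv.mul_apply,
        LinearEquiv.apply_symm_apply]
    · have h1 : (1 : k) ⊗ₜ[k] _ = (B.tensorCounit (LinearEquiv.refl k k)).rTensor H.carrier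
          (((1 : k) ⊗ₜ[k] (B.α ^ (n + 1)) b) ⊗ₜ[k] H.α.symm h) :=
        (lawAt_counitAt_right_apply B H φ n (LinearEquiv.refl k k) 1
          ((B.α ^ (n + 1)) b) (H.α.symm h)).symm.trans
        (LinearMap.congr_fun (congrArg HomSpace.Hom.f (hL.L4 (𝟙_ (HomSpace k i j))))
        ((1 ⊗ₜ[k] (B.α ^ (n + 1)) b) ⊗ₜ[k] H.α.symm h))
      rw [LinearMap.rTensor_tmul, tensorCounit_tmul, counit_zpow, TensorProduct.smul_tmul,
        eB, LinearEquiv.apply_symm_apply] at h1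
      have h2 := tmul_left_injective LinearMap.id rfl h1
      apply H.α.symm.injective
      rw [h2, map_smul]
  · intro hM
    refine ⟨fun X => HomSpace.hom_ext (TensorProduct.ext_threefold fun x b h => ?_),
      fun X => HomSpace.hom_ext (TensorProduct.ext_threefold fun x b h => ?_),
      fun X => HomSpace.hom_ext (TensorProduct.ext_threefold fun x b h => ?_),
      fun X => HomSpace.hom_ext (TensorProduct.ext_threefold fun x b h => ?_)⟩
    · refine (map_comulAt_lawAt_lawAt_apply B H φ hφ n X.α x (B.comul b) h).trans
        (Eq.trans ?_ (lawAt_comulAt_apply B H φ n X.α x b h).symm)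
      rw [← comul_zpow, ← hM.M1]
      rfl
    · refine (comulAt_map_lawAt_lawAt_apply B H φ hφ n X.α x b (H.comul h)).trans
        (Eq.trans ?_ (lawAt_map_comulAt_apply B H φ n X.α x b h).symm)
      rw [← comul_map, ← hM.M2]
      rfl
    · refine (lawAt_counitAt_left_apply B H φ n X.α x b h).trans ?_
      change _ = H.tensorCounit (TensorProduct.congr X.α B.α) ((x ⊗ₜ[k] b) ⊗ₜ[k] h)
      rw [hM.M3, tensorCounit_tmul, counit_map, TensorProduct.congr_symm_tmul,
        map_smul, TensorProduct.tmul_smul, zpow_apply_zpow, show n + (-n - 1) = -1 by ring,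
        zpow_neg_one]
      rfl
    · refine (lawAt_counitAt_right_apply B H φ n X.α x b h).trans ?_
      change _ = (B.tensorCounit X.α).rTensor H.carrier ((x ⊗ₜ[k] b) ⊗ₜ[k] h)
      rw [hM.M4, LinearMap.rTensor_tmul, tensorCounit_tmul, counit_zpow, map_smul,
        LinearEquiv.symm_apply_apply, TensorProduct.smul_tmul]

end TwistedLaw

/-! ### Monoidality of the distributive law -/

section MonoidalTwistedLaw

open HomBialgebraData

variable {k : Type u} [Field k] (B H : HomBialgebraData k)
  (φ : B.carrier ⊗[k] H.carrier →ₗ[k] H.carrier ⊗[k] B.carrier)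
  {X Y : Type u} [AddCommGroup X] [Module k X] [AddCommGroup Y] [Module k Y]

variable {B H φ} in
theorem IsCompatible.apply_zpow_tmul (hφ : IsCompatible B H φ) (n : ℤ) (b : B.carrier)
    (h : H.carrier) : φ ((B.α ^ n) b ⊗ₜ[k] (H.α ^ n) h) =
      TensorProduct.congr (H.α ^ n) (B.α ^ n) (φ (b ⊗ₜ[k] h)) := by
  have h1 := zpow_conj φ (TensorProduct.congr B.α H.α) (TensorProduct.congr H.α B.α)
    (fun t => LinearMap.congr_fun hφ t) n (b ⊗ₜ[k] h)
  rwa [TensorProduct.congr_zpow, TensorProduct.congr_zpow, TensorProduct.congr_tmul] at h1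

theorem tensorator_lawAt_apply (i j n : ℤ) (x : X) (y : Y) (s t : H.carrier ⊗[k] B.carrier) :
    (H.tensorator i j X Y).rTensor B.carrier (B.tensorator i j (X ⊗[k] H.carrier)
      (Y ⊗[k] H.carrier)
        ((TensorProduct.assoc k X H.carrier B.carrier).symm
          (x ⊗ₜ[k] (B.α ^ n).toLinearMap.lTensor H.carrier s) ⊗ₜ[k]
        (TensorProduct.assoc k Y H.carrier B.carrier).symm
          (y ⊗ₜ[k] (B.α ^ n).toLinearMap.lTensor H.carrier t))) =
      (TensorProduct.assoc k (X ⊗[k] Y) H.carrier B.carrier).symm ((x ⊗ₜ[k] y) ⊗ₜ[k]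
        (B.α ^ n).toLinearMap.lTensor H.carrier (TensorProduct.map₂ H.mul B.mul
          (TensorProduct.congr (H.α ^ i) (B.α ^ i) s)
          (TensorProduct.congr (H.α ^ j) (B.α ^ j) t))) := by
  induction s using TensorProduct.induction_on with
  | zero => simp
  | add u v hu hv =>
    simp only [map_add, TensorProduct.tmul_add, TensorProduct.add_tmul, LinearMap.add_apply, hu, hv]
  | tmul g c =>
    induction t using TensorProduct.induction_on with
    | zero => simp
    | add u v hu hv => simp only [map_add, TensorProduct.tmul_add, hu, hv]
    | tmul h d =>
      simp only [LinearMap.lTensor_tmul, LinearEquiv.coe_coe, TensorProduct.assoc_symm_tmul,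
        tensorator_tmul, LinearMap.rTensor_tmul, TensorProduct.congr_tmul,
        TensorProduct.map₂_apply_tmul, TensorProduct.map_tmul, zpow_apply_mul]
      rw [zpow_apply_zpow _ i, zpow_apply_zpow _ j, zpow_apply_zpow _ n, zpow_apply_zpow _ n,
        add_comm i, add_comm j]

variable (i j : ℤ)

/-- The distributive law is monoidal exactly when `φ` is multiplicative and preserves the unit. -/
theorem isMonoidalDistributiveLaw_twistedLaw_iff (hφ : IsCompatible B H φ) (n : ℤ) :
    IsMonoidalDistributiveLaw (H.tensorFunctor i j) (B.tensorFunctor i j)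
      (twistedLaw i j B H φ hφ n) ↔ IsMonoidalHomCotwistor B H φ := by
  have inj : Function.Injective ((B.α ^ n).toLinearMap.lTensor H.carrier) :=
    (TensorProduct.congr (LinearEquiv.refl k H.carrier) (B.α ^ n)).injective
  constructor
  · intro hL
    refine ⟨(isDistributiveLaw_twistedLaw_iff B H φ i j hφ n).1 hL.isDistributiveLaw,
      fun a b h g => ?_, ?_⟩
    · -- The exponents make all powers of the automorphisms cancel.
      have key := (LinearMap.congr_fun (congrArg HomSpace.Hom.f
        (hL.tensor (𝟙_ (HomSpace k i j)) (𝟙_ (HomSpace k i j))))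
        (((1 ⊗ₜ[k] (B.α ^ (n + 1 - i)) a) ⊗ₜ[k] (H.α ^ (-1 - i)) h) ⊗ₜ[k]
          ((1 ⊗ₜ[k] (B.α ^ (n + 1 - j)) b) ⊗ₜ[k] (H.α ^ (-1 - j)) g))).trans
        (tensorator_lawAt_apply B H i j n (1 : k) (1 : k)
          (φ ((B.α ^ (-n - 1)) ((B.α ^ (n + 1 - i)) a) ⊗ₜ[k] H.α ((H.α ^ (-1 - i)) h)))
          (φ ((B.α ^ (-n - 1)) ((B.α ^ (n + 1 - j)) b) ⊗ₜ[k] H.α ((H.α ^ (-1 - j)) g))))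
      have key2 : (TensorProduct.assoc k (k ⊗[k] k) H.carrier B.carrier).symm
          (((1 : k) ⊗ₜ[k] (1 : k)) ⊗ₜ[k] (B.α ^ n).toLinearMap.lTensor H.carrier
            (φ ((B.α ^ (-n - 1)) (B.mul ((B.α ^ i) ((B.α ^ (n + 1 - i)) a))
              ((B.α ^ j) ((B.α ^ (n + 1 - j)) b))) ⊗ₜ[k]
              H.α (H.mul ((H.α ^ i) ((H.α ^ (-1 - i)) h)) ((H.α ^ j) ((H.α ^ (-1 - j)) g)))))) =
          _ := key
      have h1 := inj (tmul_left_injective (TensorProduct.lid k k).toLinearMap (by simp)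
        ((TensorProduct.assoc k (k ⊗[k] k) H.carrier B.carrier).symm.injective key2))
      have c1 : ∀ (l : ℤ) (b : B.carrier),
          (B.α ^ (-n - 1)) ((B.α ^ l) ((B.α ^ (n + 1 - l)) b)) = b := fun l b => by
        rw [zpow_apply_zpow, zpow_apply_zpow, show -n - 1 + l + (n + 1 - l) = 0 by ring,
          zpow_zero]
        rfl
      have c2 : ∀ (l : ℤ) (h : H.carrier),
          H.α ((H.α ^ l) ((H.α ^ (-1 - l)) h)) = h := fun l h => by
        rw [← LinearEquiv.mul_apply, ← LinearEquiv.mul_apply, ← zpow_one_add, ← zpow_add,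
          show 1 + l + (-1 - l) = 0 by ring, zpow_zero]
        rfl
      have c3 : ∀ (l : ℤ) (b : B.carrier),
          (B.α ^ l) ((B.α ^ (-n - 1)) ((B.α ^ (n + 1 - l)) b)) = b := fun l b => by
        rw [zpow_apply_zpow, zpow_apply_zpow, show l + (-n - 1) + (n + 1 - l) = 0 by ring,
          zpow_zero]
        rfl
      have c4 : ∀ (l : ℤ) (h : H.carrier),
          (H.α ^ l) (H.α ((H.α ^ (-1 - l)) h)) = h := fun l h => by
        rw [zpow_comm, c2]
      rw [zpow_apply_mul, H.map_mul, c1, c1, c2, c2, ← hφ.apply_zpow_tmul,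
        ← hφ.apply_zpow_tmul] at h1
      rw [h1, c3, c3, c4, c4]
    · have h1 : (TensorProduct.assoc k k H.carrier B.carrier).symm
          ((1 : k) ⊗ₜ[k] (B.α ^ n).toLinearMap.lTensor H.carrier
            (φ ((B.α ^ (-n - 1)) B.one ⊗ₜ[k] H.α H.one))) =
          (TensorProduct.assoc k k H.carrier B.carrier).symm
          ((1 : k) ⊗ₜ[k] (B.α ^ n).toLinearMap.lTensor H.carrier (H.one ⊗ₜ[k] B.one)) :=
        (LinearMap.congr_fun (congrArg HomSpace.Hom.f hL.unit) (1 : k)).trans (by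
          change ((1 : k) ⊗ₜ[k] H.one) ⊗ₜ[k] B.one = _
          rw [LinearMap.lTensor_tmul, LinearEquiv.coe_coe, zpow_apply_one]; rfl)
      rw [zpow_apply_one, H.map_one] at h1
      exact inj (tmul_left_injective LinearMap.id rfl
        ((TensorProduct.assoc k k H.carrier B.carrier).symm.injective h1))
  · intro hM
    refine ⟨(isDistributiveLaw_twistedLaw_iff B H φ i j hφ n).2 hM.isHomCotwistor,
      fun X Y => HomSpace.hom_ext (TensorProduct.ext (TensorProduct.ext_threefold
        fun x b h => TensorProduct.ext_threefold fun y c g => ?_)),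
      HomSpace.hom_ext (LinearMap.ext_ring ?_)⟩
    · refine Eq.trans ?_ (tensorator_lawAt_apply B H i j n x y
        (φ ((B.α ^ (-n - 1)) b ⊗ₜ[k] H.α h)) (φ ((B.α ^ (-n - 1)) c ⊗ₜ[k] H.α g))).symm
      change (TensorProduct.assoc k (X.carrier ⊗[k] Y.carrier) H.carrier B.carrier).symm
          ((x ⊗ₜ[k] y) ⊗ₜ[k] (B.α ^ n).toLinearMap.lTensor H.carrier
            (φ ((B.α ^ (-n - 1)) (B.mul ((B.α ^ i) b) ((B.α ^ j) c)) ⊗ₜ[k]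
              H.α (H.mul ((H.α ^ i) h) ((H.α ^ j) g))))) = _
      rw [← hφ.apply_zpow_tmul, ← hφ.apply_zpow_tmul, hM.M5, zpow_apply_mul, H.map_mul,
        zpow_apply_zpow _ i, zpow_apply_zpow _ j, add_comm i, add_comm j, ← zpow_apply_zpow,
        ← zpow_apply_zpow, zpow_comm, zpow_comm]
    · change (TensorProduct.assoc k k H.carrier B.carrier).symm
          ((1 : k) ⊗ₜ[k] (B.α ^ n).toLinearMap.lTensor H.carrier
            (φ ((B.α ^ (-n - 1)) B.one ⊗ₜ[k] H.α H.one))) = ((1 : k) ⊗ₜ[k] H.one) ⊗ₜ[k] B.one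
      rw [zpow_apply_one, H.map_one, hM.M6, LinearMap.lTensor_tmul, LinearEquiv.coe_coe,
        zpow_apply_one]
      rfl

end MonoidalTwistedLaw

/-! ### The isomorphism of `(- ⊗ B) ⊗ H` with `- ⊗ (B ⊗ H)` -/

section SmashIso

open HomBialgebraData

variable {k : Type u} [Field k] (B H : HomBialgebraData k)
  (φ : B.carrier ⊗[k] H.carrier →ₗ[k] H.carrier ⊗[k] B.carrier)
  {X Y : Type u} [AddCommGroup X] [Module k X] [AddCommGroup Y] [Module k Y]

/-- The isomorphism `(x ⊗ b) ⊗ h ↦ α⁻¹(x) ⊗ (α^(-n-2)(b) ⊗ h)`. The factor `α⁻¹` on `x` is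
needed for the counits, and the exponent `-n-2` for the comultiplications. -/
def smashEquiv (n : ℤ) (αX : X ≃ₗ[k] X) :
    (X ⊗[k] B.carrier) ⊗[k] H.carrier ≃ₗ[k] X ⊗[k] (B.carrier ⊗[k] H.carrier) :=
  TensorProduct.assoc k X B.carrier H.carrier ≪≫ₗ TensorProduct.congr αX.symm
    (TensorProduct.congr (B.α ^ (-n - 2)) (LinearEquiv.refl k H.carrier))

@[simp]
theorem smashEquiv_tmul (n : ℤ) (αX : X ≃ₗ[k] X) (x : X) (b : B.carrier) (h : H.carrier) :
    smashEquiv B H n αX ((x ⊗ₜ[k] b) ⊗ₜ[k] h) =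
      αX.symm x ⊗ₜ[k] ((B.α ^ (-n - 2)) b ⊗ₜ[k] h) := rfl

theorem smashComulAux_tmul (b c : B.carrier) (g h : H.carrier) :
    smashComulAux B H φ ((b ⊗ₜ[k] c) ⊗ₜ[k] (g ⊗ₜ[k] h)) =
      (TensorProduct.assoc k B.carrier H.carrier (B.carrier ⊗[k] H.carrier)).symm
        (b ⊗ₜ[k] TensorProduct.assoc k H.carrier B.carrier H.carrier (φ (c ⊗ₜ[k] g) ⊗ₜ[k] h)) :=
  rfl

/-- Compatibility with the comultiplications, on an element whose coproduct in `H` is replaced by an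
arbitrary tensor `t`. -/
theorem smashEquiv_comul_apply (hφ : IsCompatible B H φ) (n : ℤ) (αX : X ≃ₗ[k] X) (x : X)
    (b : B.carrier) (t : H.carrier ⊗[k] H.carrier) :
    smashEquiv B H n (TensorProduct.congr αX (TensorProduct.congr B.α H.α))
      ((((smashEquiv B H n αX).toLinearMap.rTensor B.carrier).rTensor H.carrier)
        ((twistedLawMap B H φ n (X ⊗[k] B.carrier)).rTensor H.carrier
          (((B.tensorComul αX).rTensor H.carrier).rTensor H.carrier
            (H.tensorComulAux (TensorProduct.congr αX B.α) ((x ⊗ₜ[k] b) ⊗ₜ[k] t))))) =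
    TensorProduct.map (αX.toLinearMap.rTensor (B.carrier ⊗[k] H.carrier))
      (TensorProduct.congr B.α H.α).symm.toLinearMap
      ((TensorProduct.assoc k X (B.carrier ⊗[k] H.carrier) (B.carrier ⊗[k] H.carrier)).symm
        (αX.symm x ⊗ₜ[k] smashComulAux B H φ (B.comul ((B.α ^ (-n - 2)) b) ⊗ₜ[k] t))) := by
  induction t using TensorProduct.induction_on with
  | zero => simp
  | add u v hu hv => simp only [map_add, TensorProduct.tmul_add, hu, hv]
  | tmul g h =>
    simp only [tensorComulAux_tmul, LinearMap.rTensor_tmul, TensorProduct.congr_tmul,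
      tensorComul_tmul, comul_map, comul_zpow]
    induction B.comul b using TensorProduct.induction_on with
    | zero => simp
    | add u v hu hv => simp only [map_add, TensorProduct.tmul_add, TensorProduct.add_tmul, hu, hv]
    | tmul c d =>
      have e1 : φ ((B.α ^ (-n - 1)) d ⊗ₜ[k] H.α g) =
          TensorProduct.congr H.α B.α (φ ((B.α ^ (-n - 2)) d ⊗ₜ[k] g)) := by
        rw [← hφ.apply_tmul, ← LinearEquiv.mul_apply, ← zpow_one_add,
          show 1 + (-n - 2) = -n - 1 by ring]
      have e2 : ∀ c, B.α ((B.α ^ (-n - 2)) ((B.α ^ n) c)) = B.α.symm c := fun c => by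
        rw [zpow_apply_zpow, show -n - 2 + n = -1 + -1 by ring, ← zpow_apply_zpow, zpow_neg_one]
        exact B.α.apply_symm_apply _
      simp only [TensorProduct.congr_tmul, tensorComulAux_tmul, LinearEquiv.symm_apply_apply,
        twistedLawMap_tmul, smashComulAux_tmul, e1]
      induction φ ((B.α ^ (-n - 2)) d ⊗ₜ[k] g) using TensorProduct.induction_on with
      | zero => simp
      | add u v hu hv => simp only [map_add, TensorProduct.tmul_add, TensorProduct.add_tmul, hu, hv]
      | tmul p q => simp [e2, zpow_comm]

variable (i j : ℤ)

/-- The natural isomorphism of `(- ⊗ B) ⊗ H` with `- ⊗ (B ⊗ H)` given by `smashEquiv`. -/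
def smashFunctorIso (hφ : IsCompatible B H φ) (n : ℤ) :
    (smashCoproduct (H.tensorFunctor i j) (B.tensorFunctor i j) (twistedLaw i j B H φ hφ n)).F ≅
      ((smash B H φ hφ).tensorFunctor i j).F :=
  NatIso.ofComponents
    (fun X => HomSpace.mkIso (X := ((B.tensorFunctor i j).F ⋙ (H.tensorFunctor i j).F).obj X)
      (Y := ((smash B H φ hφ).tensorFunctor i j).F.obj X) (smashEquiv B H n X.α)
      (TensorProduct.ext_threefold fun x b h => by
        change X.α.symm (X.α x) ⊗ₜ[k] ((B.α ^ (-n - 2)) (B.α b) ⊗ₜ[k] H.α h) =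
          X.α (X.α.symm x) ⊗ₜ[k] (B.α ((B.α ^ (-n - 2)) b) ⊗ₜ[k] H.α h)
        rw [LinearEquiv.symm_apply_apply, LinearEquiv.apply_symm_apply, zpow_comm]))
    (fun {X Y} f => HomSpace.hom_ext (TensorProduct.ext_threefold fun x b h => by
      change Y.α.symm (f.f x) ⊗ₜ[k] ((B.α ^ (-n - 2)) b ⊗ₜ[k] h) =
        f.f (X.α.symm x) ⊗ₜ[k] ((B.α ^ (-n - 2)) b ⊗ₜ[k] h)
      have hf : Y.α.symm (f.f x) = f.f (X.α.symm x) := by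
        rw [LinearEquiv.symm_apply_eq, ← HomSpace.comm_apply, LinearEquiv.apply_symm_apply]
      rw [hf]))

/-- The isomorphism identifies the smash coproduct of `- ⊗ H` and `- ⊗ B` with `- ⊗ (B ⊗ H)`, for
every `n` and without any condition on `φ`. -/
theorem isCompatibleIso_smashFunctorIso (hφ : IsCompatible B H φ) (n : ℤ) :
    MonoidalComonadData.IsCompatibleIso _ _ (smashFunctorIso B H φ i j hφ n) where
  comul X := HomSpace.hom_ext (TensorProduct.ext_threefold fun x b h =>
    smashEquiv_comul_apply B H φ hφ n X.α x b (H.comul h))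
  counit X := HomSpace.hom_ext (TensorProduct.ext_threefold fun x b h => by
    change X.α.symm (TensorProduct.rid k X.carrier (X.α.symm x ⊗ₜ[k]
        (B.counit ((B.α ^ (-n - 2)) b) * H.counit h))) =
      H.tensorCounit X.α (B.tensorCounit X.α (x ⊗ₜ[k] b) ⊗ₜ[k] h)
    rw [tensorCounit_tmul, tensorCounit_tmul, counit_zpow, TensorProduct.rid_tmul, map_smul,
      map_smul, mul_comm, mul_smul])
  tensor X Y := HomSpace.hom_ext (TensorProduct.ext (TensorProduct.ext_threefold
    fun x b h => TensorProduct.ext_threefold fun y c g => by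
      change (X.α.symm x ⊗ₜ[k] Y.α.symm y) ⊗ₜ[k]
          ((B.α ^ (-n - 2)) (B.mul ((B.α ^ i) b) ((B.α ^ j) c)) ⊗ₜ[k]
            H.mul ((H.α ^ i) h) ((H.α ^ j) g)) =
        (X.α.symm x ⊗ₜ[k] Y.α.symm y) ⊗ₜ[k] TensorProduct.map₂ B.mul H.mul
          ((TensorProduct.congr B.α H.α ^ i) ((B.α ^ (-n - 2)) b ⊗ₜ[k] h))
          ((TensorProduct.congr B.α H.α ^ j) ((B.α ^ (-n - 2)) c ⊗ₜ[k] g))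
      rw [TensorProduct.congr_zpow, TensorProduct.congr_zpow, TensorProduct.congr_tmul,
        TensorProduct.congr_tmul, TensorProduct.map₂_apply_tmul, TensorProduct.map_tmul,
        zpow_apply_mul, zpow_apply_zpow, zpow_apply_zpow, zpow_apply_zpow, zpow_apply_zpow,
        add_comm i, add_comm j]))
  unit := HomSpace.hom_ext (LinearMap.ext_ring (by
    change (1 : k) ⊗ₜ[k] ((B.α ^ (-n - 2)) B.one ⊗ₜ[k] H.one) = (1 : k) ⊗ₜ[k] (B.one ⊗ₜ[k] H.one)
    rw [zpow_apply_one]))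

theorem isHomAlgebra_smash (hφ : IsCompatible B H φ) (hB : B.IsHomAlgebra) (hH : H.IsHomAlgebra) :
    (smash B H φ hφ).IsHomAlgebra where
  map_one := (smash B H φ hφ).map_one
  hom_assoc := by
    change ∀ a b c : B.carrier ⊗[k] H.carrier,
      TensorProduct.map₂ B.mul H.mul (TensorProduct.congr B.α H.α a)
        (TensorProduct.map₂ B.mul H.mul b c) =
      TensorProduct.map₂ B.mul H.mul (TensorProduct.map₂ B.mul H.mul a b)
        (TensorProduct.congr B.α H.α c)
    intro a b c
    induction a using TensorProduct.induction_on with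
    | zero => simp
    | add u v hu hv => simp only [map_add, LinearMap.add_apply, hu, hv]
    | tmul a a' =>
      induction b using TensorProduct.induction_on with
      | zero => simp
      | add u v hu hv => simp only [map_add, LinearMap.add_apply, hu, hv]
      | tmul b b' =>
        induction c using TensorProduct.induction_on with
        | zero => simp
        | add u v hu hv => simp only [map_add, hu, hv]
        | tmul c c' => simp [hB.hom_assoc, hH.hom_assoc]
  one_mul := by
    change ∀ a : B.carrier ⊗[k] H.carrier,
      TensorProduct.map₂ B.mul H.mul (B.one ⊗ₜ[k] H.one) a = TensorProduct.congr B.α H.α a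
    intro a
    induction a using TensorProduct.induction_on with
    | zero => simp
    | add u v hu hv => simp only [map_add, hu, hv]
    | tmul a a' => simp [hB.one_mul, hH.one_mul]
  mul_one := by
    change ∀ a : B.carrier ⊗[k] H.carrier,
      TensorProduct.map₂ B.mul H.mul a (B.one ⊗ₜ[k] H.one) = TensorProduct.congr B.α H.α a
    intro a
    induction a using TensorProduct.induction_on with
    | zero => simp
    | add u v hu hv => simp only [map_add, LinearMap.add_apply, hu, hv]
    | tmul a a' => simp [hB.mul_one, hH.mul_one]

end SmashIso

/-! ### The monoidal categories of bicomodules and of Hom-comodules -/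

section BicomoduleCategory

variable {C : Type u} [Category.{v} C] {D E : ComonadData C} {φ : E.F ⋙ D.F ⟶ D.F ⋙ E.F}

theorem Bicomodule.eqToHom_f {M N : Bicomodule D E φ} (h : M = N) :
    Bicomodule.Hom.f (eqToHom h) = eqToHom (congrArg Bicomodule.X h) := by
  subst h; rfl

theorem Bicomodule.hom_heq {M N M' N' : Bicomodule D E φ} (hM : M = M') (hN : N = N')
    {f : Bicomodule.Hom M N} {f' : Bicomodule.Hom M' N'} (h : HEq f.f f'.f) : HEq f f' := by
  subst hM hN
  exact heq_of_eq (Bicomodule.Hom.ext (eq_of_heq h))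

theorem Bicomodule.mk_eq (M : Bicomodule D E φ) {θ : M.X ⟶ D.F.obj M.X} {ρ : M.X ⟶ E.F.obj M.X}
    (h : IsBicomodule D E φ θ ρ) (hθ : θ = M.θ) (hρ : ρ = M.ρ) :
    (⟨M.X, θ, ρ, h⟩ : Bicomodule D E φ) = M := by
  subst hθ hρ; rfl

end BicomoduleCategory

section MonoidalBicomoduleCategory

variable {C : Type u} [Category.{v} C] [MonoidalCategory C] {D E : MonoidalComonadData C}
  {φ : E.F ⋙ D.F ⟶ D.F ⋙ E.F}

/-- The monoidal category of bicomodules; its axioms are those of the underlying category. -/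
abbrev BicomoduleTensor.monoidalCategory (h : BicomoduleTensor D E φ) :
    MonoidalCategory (Bicomodule D.toComonadData E.toComonadData φ) where
  toMonoidalCategoryStruct := h.struct
  tensorHom_def _ _ := rfl
  id_tensorHom_id X Y := Bicomodule.Hom.ext (by
    change (𝟙 X.X ▷ Y.X) ≫ (X.X ◁ 𝟙 Y.X) = 𝟙 (X.X ⊗ Y.X)
    simp)
  tensorHom_comp_tensorHom {X₁ Y₁ Z₁ X₂ Y₂ Z₂} f₁ f₂ g₁ g₂ := Bicomodule.Hom.ext (by
    change ((f₁.f ▷ X₂.X) ≫ (Y₁.X ◁ f₂.f)) ≫ ((g₁.f ▷ Y₂.X) ≫ (Z₁.X ◁ g₂.f)) =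
      ((f₁.f ≫ g₁.f) ▷ X₂.X) ≫ (Z₁.X ◁ (f₂.f ≫ g₂.f))
    simp [whisker_exchange_assoc])
  whiskerLeft_id X Y := Bicomodule.Hom.ext (whiskerLeft_id X.X Y.X)
  id_whiskerRight X Y := Bicomodule.Hom.ext (id_whiskerRight X.X Y.X)
  associator_naturality {X₁ X₂ X₃ Y₁ Y₂ Y₃} f₁ f₂ f₃ := Bicomodule.Hom.ext (by
    change ((((f₁.f ▷ X₂.X) ≫ (Y₁.X ◁ f₂.f)) ▷ X₃.X) ≫ ((Y₁.X ⊗ Y₂.X) ◁ f₃.f)) ≫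
        (α_ Y₁.X Y₂.X Y₃.X).hom =
      (α_ X₁.X X₂.X X₃.X).hom ≫ (f₁.f ▷ (X₂.X ⊗ X₃.X)) ≫
        (Y₁.X ◁ ((f₂.f ▷ X₃.X) ≫ (Y₂.X ◁ f₃.f)))
    simp)
  leftUnitor_naturality f := Bicomodule.Hom.ext (leftUnitor_naturality f.f)
  rightUnitor_naturality f := Bicomodule.Hom.ext (rightUnitor_naturality f.f)
  pentagon W X Y Z := Bicomodule.Hom.ext (MonoidalCategory.pentagon W.X X.X Y.X Z.X)
  triangle X Y := Bicomodule.Hom.ext (MonoidalCategory.triangle X.X Y.X)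

end MonoidalBicomoduleCategory

/-- A functor that preserves the tensor product and the unit on the nose is strict monoidal as soon
as the equalities are natural and compatible with the constraints. -/
theorem isStrictMonoidal_of_eq {C D : Type*} [Category C] [MonoidalCategory C] [Category D]
    [MonoidalCategory D] (P : C ⥤ D) (hu : 𝟙_ D = P.obj (𝟙_ C))
    (ht : ∀ X Y, P.obj X ⊗ P.obj Y = P.obj (X ⊗ Y))
    (h1 : ∀ {X Y : C} (f : X ⟶ Y) (Z : C), (P.map f ▷ P.obj Z) ≫ eqToHom (ht Y Z) =
      eqToHom (ht X Z) ≫ P.map (f ▷ Z))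
    (h2 : ∀ {X Y : C} (Z : C) (f : X ⟶ Y), (P.obj Z ◁ P.map f) ≫ eqToHom (ht Z Y) =
      eqToHom (ht Z X) ≫ P.map (Z ◁ f))
    (h3 : ∀ X Y Z : C, (eqToHom (ht X Y) ▷ P.obj Z) ≫ eqToHom (ht (X ⊗ Y) Z) ≫
      P.map (α_ X Y Z).hom = (α_ (P.obj X) (P.obj Y) (P.obj Z)).hom ≫
        (P.obj X ◁ eqToHom (ht Y Z)) ≫ eqToHom (ht X (Y ⊗ Z)))
    (h4 : ∀ X, (λ_ (P.obj X)).hom = (eqToHom hu ▷ P.obj X) ≫ eqToHom (ht (𝟙_ C) X) ≫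
      P.map (λ_ X).hom)
    (h5 : ∀ X, (ρ_ (P.obj X)).hom = (P.obj X ◁ eqToHom hu) ≫ eqToHom (ht X (𝟙_ C)) ≫
      P.map (ρ_ X).hom) : IsStrictMonoidal P := by
  let K : P.CoreMonoidal :=
    { εIso := eqToIso hu, μIso := fun X Y => eqToIso (ht X Y)
      μIso_hom_natural_left := h1, μIso_hom_natural_right := h2, associativity := h3
      left_unitality := h4, right_unitality := h5 }
  exact ⟨K.toMonoidal, ⟨hu, rfl⟩, fun X Y => ⟨ht X Y, rfl⟩⟩

section MonoidalHomComodules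

open HomBialgebraData

variable {k : Type u} [Field k] {A : HomBialgebraData k} {i j : ℤ}

theorem HomComodule.hom_heq {M N M' N' : HomComodule A} (hM : M = M') (hN : N = N')
    {f : HomComodule.Hom M N} {f' : HomComodule.Hom M' N'} (h : HEq f.f f'.f) : HEq f f' := by
  subst hM hN
  exact heq_of_eq (HomComodule.Hom.ext (eq_of_heq h))

theorem HomComodule.mk_eq (M : HomComodule A) {ρ : M.carrier →ₗ[k] M.carrier ⊗[k] A.carrier}
    (h : IsHomComodule A M.α ρ) (hρ : ρ = M.ρ) :
    (⟨M.carrier, M.α, ρ, h⟩ : HomComodule A) = M := by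
  subst hρ; rfl

/-- The monoidal category of Hom-comodules; its axioms are those of the category of spaces with
automorphism. -/
abbrev HomComoduleTensor.monoidalCategory (h : HomComoduleTensor i j A) :
    MonoidalCategory (HomComodule A) where
  toMonoidalCategoryStruct := h.struct
  tensorHom_def _ _ := rfl
  id_tensorHom_id X Y := HomComodule.hom_ext (TensorProduct.ext' fun _ _ => rfl)
  tensorHom_comp_tensorHom {X₁ Y₁ Z₁ X₂ Y₂ Z₂} f₁ f₂ g₁ g₂ :=
    HomComodule.hom_ext (TensorProduct.ext' fun _ _ => rfl)
  whiskerLeft_id X Y := HomComodule.hom_ext (TensorProduct.ext' fun _ _ => rfl)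
  id_whiskerRight X Y := HomComodule.hom_ext (TensorProduct.ext' fun _ _ => rfl)
  associator_naturality {X₁ X₂ X₃ Y₁ Y₂ Y₃} f₁ f₂ f₃ := HomComodule.hom_ext (by
    refine TensorProduct.ext_threefold fun x y z => ?_
    change (Y₁.α ^ (i + 1)) (f₁.f x) ⊗ₜ[k] (f₂.f y ⊗ₜ[k] (Y₃.α ^ (-j - 1)) (f₃.f z)) =
      f₁.f ((X₁.α ^ (i + 1)) x) ⊗ₜ[k] (f₂.f y ⊗ₜ[k] f₃.f ((X₃.α ^ (-j - 1)) z))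
    rw [zpow_conj f₁.f X₁.α Y₁.α f₁.comm, zpow_conj f₃.f X₃.α Y₃.α f₃.comm])
  leftUnitor_naturality f := HomComodule.hom_ext
    (congrArg HomSpace.Hom.f (leftUnitor_naturality ((HomComodule.forget i j A).map f)))
  rightUnitor_naturality f := HomComodule.hom_ext
    (congrArg HomSpace.Hom.f (rightUnitor_naturality ((HomComodule.forget i j A).map f)))
  pentagon W X Y Z := HomComodule.hom_ext (congrArg HomSpace.Hom.f
    (MonoidalCategory.pentagon (W.toHomSpace i j) (X.toHomSpace i j) (Y.toHomSpace i j)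
      (Z.toHomSpace i j)))
  triangle X Y := HomComodule.hom_ext (congrArg HomSpace.Hom.f
    (MonoidalCategory.triangle (X.toHomSpace i j) (Y.toHomSpace i j)))

/-- The coaction of a Hom-comodule, as a morphism of spaces with automorphism. -/
abbrev HomComodule.coactionHom (hA : A.IsHomCoalgebra) (i j : ℤ) (M : HomComodule A) :
    M.toHomSpace i j ⟶ (A.tensorFunctor i j).F.obj (M.toHomSpace i j) :=
  HomSpace.mkHom M.ρ (A.coaction_comm hA M.isHomComodule)

theorem HomComodule.isComodule_coactionHom (hA : A.IsHomCoalgebra) (i j : ℤ)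
    (M : HomComodule A) : (A.tensorFunctor i j).IsComodule (M.coactionHom hA i j) :=
  (A.isComodule_tensorFunctor_iff i j (X := M.toHomSpace i j) _ _).2 M.isHomComodule

/-- The Hom-comodule of a comodule over the comonad `- ⊗ A`. -/
abbrev HomComodule.ofComodule {X : HomSpace k i j} (ρ : X ⟶ (A.tensorFunctor i j).F.obj X)
    (h : (A.tensorFunctor i j).IsComodule ρ) : HomComodule A :=
  ⟨X.carrier, X.α, ρ.f, (A.isComodule_tensorFunctor_iff i j ρ.f ρ.comm).1 h⟩

/-- Over a bicomonad `- ⊗ A`, the constraints are colinear because `- ⊗ A` is a monoidal functor. -/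
theorem homComoduleTensor_of_isBicomonad (h : (A.tensorFunctor i j).IsBicomonad) :
    HomComoduleTensor i j A := by
  have hA := (A.isComonad_tensorFunctor_iff i j).1 h.isComonad
  have hM := h.isMonoidalFunctor
  exact
    { tensorObj := fun U V => (HomComodule.ofComodule _ (h.isComodule_tensorCoaction
        (U.isComodule_coactionHom hA i j) (V.isComodule_coactionHom hA i j))).isHomComodule
      tensorUnit := (HomComodule.ofComodule _ h.isComodule_η).isHomComodule
      whiskerLeft := fun U {V W} f => (congrArg HomSpace.Hom.f
        (hM.isColinear_whiskerLeft (U.coactionHom hA i j) (σ := V.coactionHom hA i j)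
          (τ := W.coactionHom hA i j) (f := (HomComodule.forget i j A).map f)
          (HomSpace.hom_ext f.colinear.symm))).symm
      whiskerRight := fun {V W} f U => (congrArg HomSpace.Hom.f
        (hM.isColinear_whiskerRight (U.coactionHom hA i j) (σ := V.coactionHom hA i j)
          (τ := W.coactionHom hA i j) (f := (HomComodule.forget i j A).map f)
          (HomSpace.hom_ext f.colinear.symm))).symm
      associator := fun U V W => (congrArg HomSpace.Hom.f (hM.isColinear_associator
        (U.coactionHom hA i j) (V.coactionHom hA i j) (W.coactionHom hA i j))).symm
      leftUnitor := fun U => (congrArg HomSpace.Hom.f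
        (hM.isColinear_leftUnitor (U.coactionHom hA i j))).symm
      rightUnitor := fun U => (congrArg HomSpace.Hom.f
        (hM.isColinear_rightUnitor (U.coactionHom hA i j))).symm }

theorem isBicomonad_of_homComoduleTensor (hA : A.IsHomAlgebra) (hC : A.IsHomCoalgebra)
    (h : HomComoduleTensor i j A) : (A.tensorFunctor i j).IsBicomonad :=
  MonoidalComonadData.isBicomonad_of_isComodule ((A.isComonad_tensorFunctor_iff i j).2 hC)
    (A.isMonoidalFunctor_tensorFunctor i j hA)
    (fun {X Y} ρ σ hρ hσ => (A.isComodule_tensorFunctor_iff i j (X := X ⊗ Y) _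
      ((A.tensorFunctor i j).tensorCoaction ρ σ).comm).2
        (h.tensorObj (HomComodule.ofComodule ρ hρ) (HomComodule.ofComodule σ hσ)))
    ((A.isComodule_tensorFunctor_iff i j (X := 𝟙_ (HomSpace k i j)) _
      (A.tensorFunctor i j).η.comm).2 h.tensorUnit)

end MonoidalHomComodules

/-! ### The comparison of Hom-comodules over `B ⊗ H` with bicomodules -/

section Comparison

open HomBialgebraData

variable {k : Type u} [Field k] {i j : ℤ} {B H : HomBialgebraData k}
  {φ : B.carrier ⊗[k] H.carrier →ₗ[k] H.carrier ⊗[k] B.carrier} {hφ : IsCompatible B H φ} {n : ℤ}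

/-- The coaction of the smash coproduct of the comonads `- ⊗ H` and `- ⊗ B` on a Hom-comodule over
`B ⊗ H`. -/
def smashCoaction (hA : (smash B H φ hφ).IsHomCoalgebra) (i j n : ℤ)
    (M : HomComodule (smash B H φ hφ)) :
    M.toHomSpace i j ⟶ (H.tensorFunctor i j).F.obj
      ((B.tensorFunctor i j).F.obj (M.toHomSpace i j)) :=
  M.coactionHom hA i j ≫ (smashFunctorIso B H φ i j hφ n).inv.app (M.toHomSpace i j)

theorem isComodule_smashCoaction (hA : (smash B H φ hφ).IsHomCoalgebra) (i j n : ℤ)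
    (M : HomComodule (smash B H φ hφ)) :
    (smashCoproduct (H.tensorFunctor i j) (B.tensorFunctor i j)
      (twistedLaw i j B H φ hφ n)).IsComodule (smashCoaction hA i j n M) :=
  (isCompatibleIso_smashFunctorIso B H φ i j hφ n).symm.isComodule (M.isComodule_coactionHom hA i j)

/-- The coaction is recovered from the coaction of the smash coproduct. -/
theorem smashCoaction_comp (hA : (smash B H φ hφ).IsHomCoalgebra) (i j n : ℤ)
    (M : HomComodule (smash B H φ hφ)) :
    smashCoaction hA i j n M ≫ (smashFunctorIso B H φ i j hφ n).hom.app (M.toHomSpace i j) =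
      M.coactionHom hA i j := by
  have h := (smashFunctorIso B H φ i j hφ n).inv_hom_id_app (M.toHomSpace i j)
  exact (Category.assoc _ _ _).trans ((congrArg (M.coactionHom hA i j ≫ ·) h).trans
    (Category.comp_id _))

theorem smashCoaction_colinear (hA : (smash B H φ hφ).IsHomCoalgebra) (i j n : ℤ)
    {M N : HomComodule (smash B H φ hφ)} (f : M ⟶ N) :
    smashCoaction hA i j n M ≫ (H.tensorFunctor i j).F.map ((B.tensorFunctor i j).F.map
        ((HomComodule.forget i j _).map f)) =
      (HomComodule.forget i j _).map f ≫ smashCoaction hA i j n N :=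
  (MonoidalComonadData.IsCompatibleIso.isColinear_iff
    (D := (smash B H φ hφ).tensorFunctor i j)
    (D' := smashCoproduct (H.tensorFunctor i j) (B.tensorFunctor i j) (twistedLaw i j B H φ hφ n))
    (τ := (smashFunctorIso B H φ i j hφ n).symm)).2
    (HomSpace.hom_ext f.colinear.symm)

/-- The functor from Hom-comodules over `B ⊗ H` to bicomodules: it cuts the coaction into its two
components by means of the counits. -/
def toBicomodule (hH : H.IsHomCoalgebra) (hB : B.IsHomCoalgebra)
    (hA : (smash B H φ hφ).IsHomCoalgebra)
    (hL : IsDistributiveLaw (H.tensorFunctor i j).toComonadData (B.tensorFunctor i j).toComonadData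
      (twistedLaw i j B H φ hφ n)) :
    HomComodule (smash B H φ hφ) ⥤ TwistedBicomodule i j B H φ hφ n where
  obj M := ⟨M.toHomSpace i j,
    smashCoaction hA i j n M ≫ (H.tensorFunctor i j).F.map ((B.tensorFunctor i j).counitAt _),
    smashCoaction hA i j n M ≫ (H.tensorFunctor i j).counitAt _,
    isBicomodule_of_smashCoproduct hL ((H.isComonad_tensorFunctor_iff i j).2 hH)
      ((B.isComonad_tensorFunctor_iff i j).2 hB) (isComodule_smashCoaction hA i j n M)⟩
  map f := ⟨(HomComodule.forget i j _).map f, isColinear_map_counitAt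
    (smashCoaction_colinear hA i j n f), isColinear_counitAt (smashCoaction_colinear hA i j n f)⟩
  map_id _ := rfl
  map_comp _ _ := rfl

/-- The functor from bicomodules to Hom-comodules over `B ⊗ H`, composing the two coactions. -/
def ofBicomodule (i j n : ℤ) (B H : HomBialgebraData k)
    (φ : B.carrier ⊗[k] H.carrier →ₗ[k] H.carrier ⊗[k] B.carrier) (hφ : IsCompatible B H φ) :
    TwistedBicomodule i j B H φ hφ n ⥤ HomComodule (smash B H φ hφ) where
  obj N := HomComodule.ofComodule
    ((N.θ ≫ (H.tensorFunctor i j).F.map N.ρ) ≫ (smashFunctorIso B H φ i j hφ n).hom.app N.X)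
    ((isCompatibleIso_smashFunctorIso B H φ i j hφ n).isComodule
      (isComodule_smashCoproduct N.isBicomodule))
  map f := ⟨f.f.f, (congrArg HomSpace.Hom.f
    ((MonoidalComonadData.IsCompatibleIso.isColinear_iff
      (D := smashCoproduct (H.tensorFunctor i j) (B.tensorFunctor i j)
        (twistedLaw i j B H φ hφ n))
      (D' := (smash B H φ hφ).tensorFunctor i j)
      (τ := smashFunctorIso B H φ i j hφ n)).2 (colinear_comp_map f.left f.right))).symm⟩
  map_id _ := rfl
  map_comp _ _ := rfl

theorem toBicomodule_comp_ofBicomodule (hH : H.IsHomCoalgebra) (hB : B.IsHomCoalgebra)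
    (hA : (smash B H φ hφ).IsHomCoalgebra)
    (hL : IsDistributiveLaw (H.tensorFunctor i j).toComonadData (B.tensorFunctor i j).toComonadData
      (twistedLaw i j B H φ hφ n)) :
    toBicomodule hH hB hA hL ⋙ ofBicomodule i j n B H φ hφ = 𝟭 _ := by
  have key (M : HomComodule (smash B H φ hφ)) :
      (toBicomodule hH hB hA hL ⋙ ofBicomodule i j n B H φ hφ).obj M = M := by
    refine M.mk_eq _ (congrArg HomSpace.Hom.f (Eq.trans ?_ (smashCoaction_comp hA i j n M)))
    exact congrArg (· ≫ (smashFunctorIso B H φ i j hφ n).hom.app (M.toHomSpace i j))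
      (map_counitAt_comp_map_counitAt hL ((H.isComonad_tensorFunctor_iff i j).2 hH)
        ((B.isComonad_tensorFunctor_iff i j).2 hB) (isComodule_smashCoaction hA i j n M).1)
  exact CategoryTheory.Functor.hext key fun M N f =>
    HomComodule.hom_heq (key M) (key N) HEq.rfl

theorem ofBicomodule_comp_toBicomodule (hH : H.IsHomCoalgebra) (hB : B.IsHomCoalgebra)
    (hA : (smash B H φ hφ).IsHomCoalgebra)
    (hL : IsDistributiveLaw (H.tensorFunctor i j).toComonadData (B.tensorFunctor i j).toComonadData
      (twistedLaw i j B H φ hφ n)) :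
    ofBicomodule i j n B H φ hφ ⋙ toBicomodule hH hB hA hL = 𝟭 _ := by
  have h1 (N : TwistedBicomodule i j B H φ hφ n) :
      smashCoaction hA i j n ((ofBicomodule i j n B H φ hφ).obj N) =
        N.θ ≫ (H.tensorFunctor i j).F.map N.ρ :=
    (Category.assoc _ _ _).trans ((congrArg ((N.θ ≫ (H.tensorFunctor i j).F.map N.ρ) ≫ ·)
      ((smashFunctorIso B H φ i j hφ n).hom_inv_id_app N.X)).trans (Category.comp_id _))
  have key (N : TwistedBicomodule i j B H φ hφ n) :
      (ofBicomodule i j n B H φ hφ ⋙ toBicomodule hH hB hA hL).obj N = N :=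
    N.mk_eq _ ((congrArg (· ≫ (H.tensorFunctor i j).F.map ((B.tensorFunctor i j).counitAt N.X))
        (h1 N)).trans (comp_map_counitAt N.θ N.isBicomodule.right))
      ((congrArg (· ≫ (H.tensorFunctor i j).counitAt ((B.tensorFunctor i j).F.obj N.X))
        (h1 N)).trans (comp_counitAt N.isBicomodule.left N.ρ))
  exact CategoryTheory.Functor.hext key fun M N f =>
    Bicomodule.hom_heq (key M) (key N) HEq.rfl

theorem toBicomodule_comp_forget (hH : H.IsHomCoalgebra) (hB : B.IsHomCoalgebra)
    (hA : (smash B H φ hφ).IsHomCoalgebra)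
    (hL : IsDistributiveLaw (H.tensorFunctor i j).toComonadData (B.tensorFunctor i j).toComonadData
      (twistedLaw i j B H φ hφ n)) :
    toBicomodule hH hB hA hL ⋙ Bicomodule.forget _ _ _ = HomComodule.forget i j _ := rfl

end Comparison

/-! ### Strict monoidality of the comparison -/

section StrictMonoidal

open HomBialgebraData

variable {k : Type u} [Field k] {i j : ℤ} {B H : HomBialgebraData k}
  {φ : B.carrier ⊗[k] H.carrier →ₗ[k] H.carrier ⊗[k] B.carrier} {hφ : IsCompatible B H φ} {n : ℤ}

/-- The coaction of the smash coproduct on a tensor product is the composite of the tensor products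
of the two component coactions. -/
theorem smashCoaction_tensorObj (hH : H.IsHomBialgebra) (hB : B.IsHomBialgebra)
    (hA : (smash B H φ hφ).IsHomCoalgebra)
    (hL : IsDistributiveLaw (H.tensorFunctor i j).toComonadData (B.tensorFunctor i j).toComonadData
      (twistedLaw i j B H φ hφ n))
    (hT : HomComoduleTensor i j (smash B H φ hφ)) (M N : HomComodule (smash B H φ hφ)) :
    smashCoaction hA i j n (hT.struct.tensorObj M N) =
      (H.tensorFunctor i j).tensorCoaction
        (smashCoaction hA i j n M ≫
          (H.tensorFunctor i j).F.map ((B.tensorFunctor i j).counitAt _))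
        (smashCoaction hA i j n N ≫
          (H.tensorFunctor i j).F.map ((B.tensorFunctor i j).counitAt _)) ≫
      (H.tensorFunctor i j).F.map ((B.tensorFunctor i j).tensorCoaction
        (smashCoaction hA i j n M ≫ (H.tensorFunctor i j).counitAt _)
        (smashCoaction hA i j n N ≫ (H.tensorFunctor i j).counitAt _)) := by
  have hD := H.isBicomonad_tensorFunctor i j hH
  have hE := B.isBicomonad_tensorFunctor i j hB
  have h1 := (tensorCoaction_comp_map (E := B.tensorFunctor i j)
    (φ := twistedLaw i j B H φ hφ n) hD.isMonoidalFunctor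
    (smashCoaction hA i j n M ≫ (H.tensorFunctor i j).F.map ((B.tensorFunctor i j).counitAt _))
    (smashCoaction hA i j n M ≫ (H.tensorFunctor i j).counitAt _)
    (smashCoaction hA i j n N ≫ (H.tensorFunctor i j).F.map ((B.tensorFunctor i j).counitAt _))
    (smashCoaction hA i j n N ≫ (H.tensorFunctor i j).counitAt _)).trans
    (congrArg₂ (smashCoproduct (H.tensorFunctor i j) (B.tensorFunctor i j)
        (twistedLaw i j B H φ hφ n)).tensorCoaction
      (map_counitAt_comp_map_counitAt hL hD.isComonad hE.isComonad
        (isComodule_smashCoaction hA i j n M).1)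
      (map_counitAt_comp_map_counitAt hL hD.isComonad hE.isComonad
        (isComodule_smashCoaction hA i j n N).1))
  exact ((isCompatibleIso_smashFunctorIso B H φ i j hφ n).symm.tensorCoaction_comp
    (M.coactionHom hA i j) (N.coactionHom hA i j)).trans h1.symm

theorem smashCoaction_tensorUnit (hA : (smash B H φ hφ).IsHomCoalgebra)
    (hT : HomComoduleTensor i j (smash B H φ hφ)) :
    smashCoaction hA i j n hT.struct.tensorUnit =
      (H.tensorFunctor i j).η ≫ (H.tensorFunctor i j).F.map (B.tensorFunctor i j).η :=
  (isCompatibleIso_smashFunctorIso B H φ i j hφ n).symm.unit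

/-- The functor is the identity on underlying objects, so all equalities `P M ⊗ P N = P (M ⊗ N)`
have the identity as underlying morphism. -/
theorem isStrictMonoidal_toBicomodule (hH : H.IsHomBialgebra) (hB : B.IsHomBialgebra)
    (hA : (smash B H φ hφ).IsHomCoalgebra)
    (hL : IsDistributiveLaw (H.tensorFunctor i j).toComonadData (B.tensorFunctor i j).toComonadData
      (twistedLaw i j B H φ hφ n))
    (hT : HomComoduleTensor i j (smash B H φ hφ))
    (hT' : BicomoduleTensor (H.tensorFunctor i j) (B.tensorFunctor i j)
      (twistedLaw i j B H φ hφ n)) :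
    @IsStrictMonoidal _ _ hT.monoidalCategory _ _ hT'.monoidalCategory
      (toBicomodule hH.isHomCoalgebra hB.isHomCoalgebra hA hL) := by
  let := hT.monoidalCategory
  let := hT'.monoidalCategory
  let P := toBicomodule hH.isHomCoalgebra hB.isHomCoalgebra hA hL
  have ht (M N : HomComodule (smash B H φ hφ)) : P.obj M ⊗ P.obj N = P.obj (M ⊗ N) := by
    have h := smashCoaction_tensorObj hH hB hA hL hT M N
    have h' := (P.obj M ⊗ P.obj N).isBicomodule
    exact (Bicomodule.mk_eq (P.obj M ⊗ P.obj N) _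
      ((congrArg (· ≫ (H.tensorFunctor i j).F.map ((B.tensorFunctor i j).counitAt _)) h).trans
        (comp_map_counitAt _ h'.right))
      ((congrArg (· ≫ (H.tensorFunctor i j).counitAt ((B.tensorFunctor i j).F.obj _)) h).trans
        (comp_counitAt h'.left _))).symm
  have hu : 𝟙_ (TwistedBicomodule i j B H φ hφ n) = P.obj (𝟙_ _) := by
    have h := smashCoaction_tensorUnit (n := n) hA hT
    have h' := hT'.tensorUnit
    exact (Bicomodule.mk_eq (𝟙_ (TwistedBicomodule i j B H φ hφ n)) _
      ((congrArg (· ≫ (H.tensorFunctor i j).F.map ((B.tensorFunctor i j).counitAt _)) h).trans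
        (comp_map_counitAt _ h'.right))
      ((congrArg (· ≫ (H.tensorFunctor i j).counitAt ((B.tensorFunctor i j).F.obj _)) h).trans
        (comp_counitAt h'.left _))).symm
  have et (M N) : Bicomodule.Hom.f (eqToHom (ht M N)) = 𝟙 _ := Bicomodule.eqToHom_f (ht M N)
  have eu : Bicomodule.Hom.f (eqToHom hu) = 𝟙 _ := Bicomodule.eqToHom_f hu
  let U := HomComodule.forget i j (smash B H φ hφ)
  refine isStrictMonoidal_of_eq P hu ht (fun {M N} f Z => Bicomodule.Hom.ext ?_)
    (fun {M N} Z f => Bicomodule.Hom.ext ?_) (fun M N K => Bicomodule.Hom.ext ?_)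
    (fun M => Bicomodule.Hom.ext ?_) (fun M => Bicomodule.Hom.ext ?_)
  · change (U.map f ▷ U.obj Z) ≫ Bicomodule.Hom.f (eqToHom (ht N Z)) =
      Bicomodule.Hom.f (eqToHom (ht M Z)) ≫ (U.map f ▷ U.obj Z)
    rw [et, et]
    exact (Category.comp_id _).trans (Category.id_comp _).symm
  · change (U.obj Z ◁ U.map f) ≫ Bicomodule.Hom.f (eqToHom (ht Z N)) =
      Bicomodule.Hom.f (eqToHom (ht Z M)) ≫ (U.obj Z ◁ U.map f)
    rw [et, et]
    exact (Category.comp_id _).trans (Category.id_comp _).symm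
  · change (Bicomodule.Hom.f (eqToHom (ht M N)) ▷ U.obj K) ≫
        Bicomodule.Hom.f (eqToHom (ht (M ⊗ N) K)) ≫ (α_ (U.obj M) (U.obj N) (U.obj K)).hom =
      (α_ (U.obj M) (U.obj N) (U.obj K)).hom ≫
        (U.obj M ◁ Bicomodule.Hom.f (eqToHom (ht N K))) ≫
          Bicomodule.Hom.f (eqToHom (ht M (N ⊗ K)))
    rw [et, et, et, et]
    exact HomSpace.hom_ext (TensorProduct.ext_threefold fun _ _ _ => rfl)
  · change (λ_ (U.obj M)).hom = (Bicomodule.Hom.f (eqToHom hu) ▷ U.obj M) ≫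
        Bicomodule.Hom.f (eqToHom (ht (𝟙_ _) M)) ≫ (λ_ (U.obj M)).hom
    rw [et, eu]
    exact HomSpace.hom_ext (TensorProduct.ext' fun _ _ => rfl)
  · change (ρ_ (U.obj M)).hom = (U.obj M ◁ Bicomodule.Hom.f (eqToHom hu)) ≫
        Bicomodule.Hom.f (eqToHom (ht M (𝟙_ _))) ≫ (ρ_ (U.obj M)).hom
    rw [et, eu]
    exact HomSpace.hom_ext (TensorProduct.ext' fun _ _ => rfl)

end StrictMonoidal

end HomCotwist

open HomCotwist in
theorem theorem4p10 {k : Type*} [Field k] (i j n : ℤ) (B H : HomBialgebraData k)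
    (hB : B.IsHomBialgebra) (hH : H.IsHomBialgebra)
    (φ : B.carrier ⊗[k] H.carrier →ₗ[k] H.carrier ⊗[k] B.carrier) (hφ : IsCompatible B H φ) :
    List.TFAE
      [ IsDistributiveLaw (H.tensorFunctor i j).toComonadData (B.tensorFunctor i j).toComonadData
            (twistedLaw i j B H φ hφ n) ∧
          ∃ M : MonoidalCategory (TwistedBicomodule i j B H φ hφ n), IsBicomoduleMonoidal M,
        IsMonoidalHomCotwistor B H φ,
        IsMonoidalDistributiveLaw (H.tensorFunctor i j) (B.tensorFunctor i j)
          (twistedLaw i j B H φ hφ n),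
        (smashCoproduct (H.tensorFunctor i j) (B.tensorFunctor i j)
          (twistedLaw i j B H φ hφ n)).IsBicomonad,
        (smash B H φ hφ).IsHomBialgebra,
        ((smash B H φ hφ).tensorFunctor i j).IsBicomonad,
        (smash B H φ hφ).IsHomCoalgebra ∧
          ∃ M : MonoidalCategory (HomComodule (smash B H φ hφ)), IsCorepMonoidal i j M ] ∧
    (IsMonoidalHomCotwistor B H φ → ∀ m : ℤ,
      ∃ (M₁ : MonoidalCategory (HomComodule (smash B H φ hφ)))
        (M₂ : MonoidalCategory (TwistedBicomodule i j B H φ hφ m)),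
        IsCorepMonoidal i j M₁ ∧ IsBicomoduleMonoidal M₂ ∧
        ∃ (P : HomComodule (smash B H φ hφ) ⥤ TwistedBicomodule i j B H φ hφ m)
          (Q : TwistedBicomodule i j B H φ hφ m ⥤ HomComodule (smash B H φ hφ)),
          P ⋙ Q = 𝟭 _ ∧ Q ⋙ P = 𝟭 _ ∧
          P ⋙ Bicomodule.forget _ _ _ = HomComodule.forget i j (smash B H φ hφ) ∧
          IsStrictMonoidal P) := by
  have hD := H.isBicomonad_tensorFunctor i j hH
  have hE := B.isBicomonad_tensorFunctor i j hB
  have hA := isHomAlgebra_smash B H φ hφ hB.isHomAlgebra hH.isHomAlgebra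
  have hτ := isCompatibleIso_smashFunctorIso B H φ i j hφ
  have hM := (smash B H φ hφ).isMonoidalFunctor_tensorFunctor i j hA
  refine ⟨?_, fun h m => ?_⟩
  · tfae_have 2 ↔ 3 := (isMonoidalDistributiveLaw_twistedLaw_iff B H φ i j hφ n).symm
    tfae_have 3 → 1 := fun h =>
      ⟨h.isDistributiveLaw, (h.bicomoduleTensor hD hE).monoidalCategory,
        h.bicomoduleTensor hD hE, rfl⟩
    tfae_have 1 → 4 := fun ⟨h, _, hT, _⟩ => isBicomonad_smashCoproduct h hD hE hT
    tfae_have 4 → 3 := isMonoidalDistributiveLaw_of_isBicomonad hD hE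
    tfae_have 4 → 6 := (hτ n).isBicomonad hM
    tfae_have 6 → 4 := (hτ n).symm.isBicomonad
      (isMonoidalFunctor_smashCoproduct hD.isMonoidalFunctor hE.isMonoidalFunctor)
    tfae_have 6 → 5 := (smash B H φ hφ).isHomBialgebra_of_isBicomonad i j hA
    tfae_have 5 → 6 := (smash B H φ hφ).isBicomonad_tensorFunctor i j
    tfae_have 6 → 7 := fun h =>
      ⟨((smash B H φ hφ).isComonad_tensorFunctor_iff i j).1 h.isComonad,
        (homComoduleTensor_of_isBicomonad h).monoidalCategory,
        homComoduleTensor_of_isBicomonad h, rfl⟩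
    tfae_have 7 → 6 := fun ⟨h, _, hT, _⟩ => isBicomonad_of_homComoduleTensor hA h hT
    tfae_finish
  · have hL := (isMonoidalDistributiveLaw_twistedLaw_iff B H φ i j hφ m).2 h
    have hT' := hL.bicomoduleTensor hD hE
    have hS := (hτ m).isBicomonad hM
      (isBicomonad_smashCoproduct hL.isDistributiveLaw hD hE hT')
    have hC := ((smash B H φ hφ).isComonad_tensorFunctor_iff i j).1 hS.isComonad
    have hT := homComoduleTensor_of_isBicomonad hS
    exact ⟨hT.monoidalCategory, hT'.monoidalCategory, ⟨hT, rfl⟩, ⟨hT', rfl⟩,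
      toBicomodule hH.isHomCoalgebra hB.isHomCoalgebra hC hL.isDistributiveLaw,
      ofBicomodule i j m B H φ hφ, toBicomodule_comp_ofBicomodule _ _ _ _,
      ofBicomodule_comp_toBicomodule _ _ _ _, toBicomodule_comp_forget _ _ _ _,
      isStrictMonoidal_toBicomodule hH hB hC hL.isDistributiveLaw hT hT'⟩
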